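/- Let $\mu=(\mu_1,\dots,\mu_n)\in\mathbb R^n$ with $\mu_i>-\tfrac12$ for all $i$, let $\mathbb R^n_+=(0,\infty)^n$, and write $x^\beta=x_1^{\beta_1}\cdots x_n^{\beta_n}$. Put $C_\mu=\prod_{i}2^{\mu_i}\Gamma(\mu_i+1)$, $s(x)=x^{2\mu+1}/C_\mu$ and $r(x)=x^{-\mu-1/2}$ (where the scalars are added to each component of the exponent). Let $L^1(sr)$ and $L^\infty(r)$ be the spaces of (classes of) complex measurable functions $f$ on $\mathbb R^n_+$ with $\|f\|_{L^1(sr)}=\int_{\mathbb R^n_+}|f|\,s\,r\,dx<\infty$, respectively $\|f\|_{L^\infty(r)}=\operatorname{ess\,sup}|rf|<\infty$, and let $Y=L^1(sr)\cap L^\infty(r)$ with norm $\|f\|_Y=\max\{\|f\|_{L^1(sr)},\|f\|_{L^\infty(r)}\}$. Let $\mathcal H_\mu$ be the space of all $\phi\in C^\infty(\mathbb R^n_+)$ such that $\sup_{x\in\mathbb R^n_+}\bigl|(1+\|x\|^2)^mT^k\{x^{-\mu-1/2}\phi(x)\}\bigr|<\infty$ for all $m\in\mathbb N_0$, $k\in\mathbb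 N_0^n$, where $T^k=T_n^{k_n}\circ\cdots\circ T_1^{k_1}$ and $T_i=x_i^{-1}\partial/\partial x_i$. On $\mathcal H_\mu$ let $$S_\mu=\sum_{i=1}^n\Bigl(\frac{\partial^2}{\partial x_i^2}-\frac{4\mu_i^2-1}{4x_i^2}\Bigr),$$ and extend $S_\mu$ to the dual $\mathcal H_\mu'$ by transposition; thus, for $f,g\in Y$, $S_\mu f=g$ means $\int_{\mathbb R^n_+} g\,\phi\,dx=\int_{\mathbb R^n_+} f\,S_\mu\phi\,dx$ for all $\phi\in\mathcal H_\mu$. Let $(S_\mu)_Y$ be the operator $f\mapsto S_\mu f$ with domain $\{f\in Y: S_\mu f\in Y\}$, and let $$\mathcal B=\{f\in Y:\ S_\mu^kf\in Y\text{ for }k=0,1,2,\dots\}=\bigcap_{k\ge0}D\bigl[((S_\mu)_Y)^k\bigr],$$ with the topology generated by the seminorms $\rho_m(f)=\max_{0\le k\le m}\|S_\mu^kf\|_Y$, $m=0,1,2,\dots$. Let $(S_\mu)_{\mathcal B}:\mathcal B\to\mathcal B$ be the restriction of $S_\mu$ to $\mathcal B$. Then $\mathcal B$ is a Fréchet space (a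 complete metrizable locally convex space), and $-(S_\mu)_{\mathcal B}$ is a continuous and non-negative operator on $\mathcal B$. Here an operator $A$ is non-negative if it is closed, for every $\lambda>0$ the operator $\lambda+A$ is a bijection from $D(A)$ onto the space with continuous inverse, and the family $\{\lambda(\lambda+A)^{-1}\}_{\lambda>0}$ is equicontinuous: for every $m$ there are $m'$ and $C\ge0$ with $\rho_m(\lambda(\lambda+A)^{-1}f)\le C\,\rho_{m'}(f)$ for all $\lambda>0$ and $f$. -/

import Mathlib

open MeasureTheory Set
open scoped ContDiff ENNReal

namespace Bessel

/-- The open orthant `(0, ∞)ⁿ`. -/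
def orthant (n : ℕ) : Set (Fin n → ℝ) := {x | ∀ i, 0 < x i}

/-- Lebesgue measure on the open orthant. -/
noncomputable def orthantMeasure (n : ℕ) : Measure (Fin n → ℝ) := volume.restrict (orthant n)

/-- `x ^ β = x₁ ^ β₁ ⋯ xₙ ^ βₙ`. -/
noncomputable def multiPow {n : ℕ} (x β : Fin n → ℝ) : ℝ := ∏ i, x i ^ β i

/-- The constant `C_μ = 2 ^ μ Γ(μ₁ + 1) ⋯ Γ(μₙ + 1)`, where `2 ^ μ = 2 ^ μ₁ ⋯ 2 ^ μₙ`. -/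
noncomputable def normConst {n : ℕ} (μ : Fin n → ℝ) : ℝ :=
  (∏ i, (2 : ℝ) ^ μ i) * ∏ i, Real.Gamma (μ i + 1)

/-- The weight `s(x) = x ^ (2μ + 1) / C_μ`. -/
noncomputable def weightS {n : ℕ} (μ x : Fin n → ℝ) : ℝ :=
  multiPow x (fun i => 2 * μ i + 1) / normConst μ

/-- The weight `r(x) = x ^ (-μ - 1/2)`. -/
noncomputable def weightR {n : ℕ} (μ x : Fin n → ℝ) : ℝ :=
  multiPow x (fun i => -μ i - 1 / 2)

/-! ### Test functions and the Bessel operator on them -/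

/-- The partial derivative `∂φ/∂x_j`. -/
noncomputable def pderiv {n : ℕ} (j : Fin n) (φ : (Fin n → ℝ) → ℂ) (x : Fin n → ℝ) : ℂ :=
  fderiv ℝ φ x (Pi.single j 1)

/-- The operator `T_j = x_j⁻¹ ∂/∂x_j`. -/
noncomputable def opT {n : ℕ} (j : Fin n) (φ : (Fin n → ℝ) → ℂ) (x : Fin n → ℝ) : ℂ :=
  (x j)⁻¹ • pderiv j φ x

/-- `T ^ k = T_n ^ k_n ∘ ⋯ ∘ T_1 ^ k_1` for a multi-index `k`. -/
noncomputable def opTPow {n : ℕ} (k : Fin n → ℕ) (φ : (Fin n → ℝ) → ℂ) : (Fin n → ℝ) → ℂ :=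
  (List.finRange n).foldl (fun g j => (opT j)^[k j] g) φ

/-- Membership in the Zemanian space `H_μ`: `φ` is smooth on the open orthant and
`sup (1 + ‖x‖²) ^ m |T ^ k {x ^ (-μ - 1/2) φ(x)}|` over the orthant is finite for all `m`, `k`.
Only the values of `φ` on the orthant matter. -/
structure IsZemanian {n : ℕ} (μ : Fin n → ℝ) (φ : (Fin n → ℝ) → ℂ) : Prop where
  smooth : ContDiffOn ℝ ∞ φ (orthant n)
  bounded : ∀ (m : ℕ) (k : Fin n → ℕ), ∃ C : ℝ, ∀ x ∈ orthant n,
    ‖(1 + ∑ i, x i ^ 2) ^ m • opTPow k (fun y => weightR μ y • φ y) x‖ ≤ C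

/-- The Bessel operator `S_μ = ∑ᵢ (∂²/∂xᵢ² - (4 μᵢ² - 1) / (4 xᵢ²))` on smooth functions. -/
noncomputable def besselOp {n : ℕ} (μ : Fin n → ℝ) (φ : (Fin n → ℝ) → ℂ) (x : Fin n → ℝ) : ℂ :=
  ∑ i, (pderiv i (pderiv i φ) x - ((4 * μ i ^ 2 - 1) / (4 * x i ^ 2)) • φ x)

/-! ### The space `Y = L¹(sr) ∩ L^∞(r)` -/

/-- The space `Y = L¹(sr) ∩ L^∞(r)` of (classes of) measurable functions on the orthant. -/
noncomputable def ySubmodule {n : ℕ} (μ : Fin n → ℝ) :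
    Submodule ℂ ((Fin n → ℝ) →ₘ[orthantMeasure n] ℂ) where
  carrier := {f | MemLp (fun x => (weightS μ x * weightR μ x) • f x) 1 (orthantMeasure n) ∧
    MemLp (fun x => weightR μ x • f x) ∞ (orthantMeasure n)}
  add_mem' := by
    intro f g hf hg
    have h := AEEqFun.coeFn_add f g
    refine ⟨(hf.1.add hg.1).ae_eq ?_, (hf.2.add hg.2).ae_eq ?_⟩ <;>
    · filter_upwards [h] with x hx
      simp [hx, smul_add]
  zero_mem' := by
    have h : ((0 : (Fin n → ℝ) →ₘ[orthantMeasure n] ℂ) : (Fin n → ℝ) → ℂ)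
      =ᵐ[orthantMeasure n] 0 := AEEqFun.coeFn_zero
    refine ⟨(MemLp.zero (ε := ℂ)).ae_eq ?_, (MemLp.zero (ε := ℂ)).ae_eq ?_⟩ <;>
    · filter_upwards [h] with x hx
      simp [hx]
  smul_mem' := by
    intro c f hf
    have h := AEEqFun.coeFn_smul c f
    refine ⟨(hf.1.const_smul c).ae_eq ?_, (hf.2.const_smul c).ae_eq ?_⟩ <;>
    · filter_upwards [h] with x hx
      simp only [Pi.smul_apply, hx]
      exact smul_comm _ _ _

/-- The space `Y` as a type. -/
def SpaceY {n : ℕ} (μ : Fin n → ℝ) : Type := ySubmodule μ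

noncomputable instance {n : ℕ} (μ : Fin n → ℝ) : AddCommGroup (SpaceY μ) :=
  inferInstanceAs (AddCommGroup (ySubmodule μ))

noncomputable instance {n : ℕ} (μ : Fin n → ℝ) : Module ℂ (SpaceY μ) :=
  inferInstanceAs (Module ℂ (ySubmodule μ))

@[simp]
theorem SpaceY.coe_add {n : ℕ} {μ : Fin n → ℝ} (f g : SpaceY μ) : (f + g).1 = f.1 + g.1 := rfl

@[simp]
theorem SpaceY.coe_zero {n : ℕ} {μ : Fin n → ℝ} : (0 : SpaceY μ).1 = 0 := rfl

@[simp]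
theorem SpaceY.coe_smul {n : ℕ} {μ : Fin n → ℝ} (c : ℂ) (f : SpaceY μ) :
    (c • f).1 = c • f.1 := rfl

/-- The norm of `L¹(sr)`. -/
noncomputable def normL1 {n : ℕ} (μ : Fin n → ℝ) (f : (Fin n → ℝ) → ℂ) : ℝ :=
  (eLpNorm (fun x => (weightS μ x * weightR μ x) • f x) 1 (orthantMeasure n)).toReal

/-- The norm of `L^∞(r)`. -/
noncomputable def normLinf {n : ℕ} (μ : Fin n → ℝ) (f : (Fin n → ℝ) → ℂ) : ℝ :=
  (eLpNorm (fun x => weightR μ x • f x) ∞ (orthantMeasure n)).toReal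

theorem toReal_eLpNorm_weight_add {n : ℕ} (w : (Fin n → ℝ) → ℝ) (p : ℝ≥0∞) (hp : 1 ≤ p)
    (f g : (Fin n → ℝ) →ₘ[orthantMeasure n] ℂ)
    (hf : MemLp (fun x => w x • f x) p (orthantMeasure n))
    (hg : MemLp (fun x => w x • g x) p (orthantMeasure n)) :
    (eLpNorm (fun x => w x • (f + g) x) p (orthantMeasure n)).toReal ≤
      (eLpNorm (fun x => w x • f x) p (orthantMeasure n)).toReal +
      (eLpNorm (fun x => w x • g x) p (orthantMeasure n)).toReal := by
  have h : (fun x => w x • (f + g) x) =ᵐ[orthantMeasure n]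
      (fun x => w x • f x) + fun x => w x • g x := by
    filter_upwards [AEEqFun.coeFn_add f g] with x hx
    simp [hx]
  rw [eLpNorm_congr_ae h, ← ENNReal.toReal_add hf.2.ne hg.2.ne]
  exact ENNReal.toReal_mono (ENNReal.add_ne_top.2 ⟨hf.2.ne, hg.2.ne⟩)
    (eLpNorm_add_le hf.1 hg.1 hp)

theorem toReal_eLpNorm_weight_smul {n : ℕ} (w : (Fin n → ℝ) → ℝ) (p : ℝ≥0∞) (c : ℂ)
    (f : (Fin n → ℝ) →ₘ[orthantMeasure n] ℂ) :
    (eLpNorm (fun x => w x • (c • f) x) p (orthantMeasure n)).toReal =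
      ‖c‖ * (eLpNorm (fun x => w x • f x) p (orthantMeasure n)).toReal := by
  have h : (fun x => w x • (c • f) x) =ᵐ[orthantMeasure n] c • (fun x => w x • f x) := by
    filter_upwards [AEEqFun.coeFn_smul c f] with x hx
    simp only [Pi.smul_apply, hx]
    exact smul_comm _ _ _
  rw [eLpNorm_congr_ae h, eLpNorm_const_smul, ENNReal.toReal_mul]
  simp

/-- The norm `‖f‖_Y = max {‖f‖_{L¹(sr)}, ‖f‖_{L^∞(r)}}` of `Y`, as a seminorm. -/
noncomputable def normY {n : ℕ} (μ : Fin n → ℝ) : Seminorm ℂ (SpaceY μ) :=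
  Seminorm.of (fun f => max (normL1 μ f.1) (normLinf μ f.1))
    (fun f g => by
      refine (max_le_max
        (toReal_eLpNorm_weight_add _ 1 le_rfl f.1 g.1 f.2.1 g.2.1)
        (toReal_eLpNorm_weight_add _ ∞ le_top f.1 g.1 f.2.2 g.2.2)).trans ?_
      exact max_add_add_le_max_add_max)
    (fun c f => by
      have h1 := toReal_eLpNorm_weight_smul (fun x => weightS μ x * weightR μ x) 1 c f.1
      have h2 := toReal_eLpNorm_weight_smul (weightR μ) ∞ c f.1
      simp only [normL1, normLinf, SpaceY.coe_smul, h1, h2]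
      rw [mul_max_of_nonneg _ _ (norm_nonneg c)])

/-! ### Facts needed for the operator to be well defined -/

theorem isOpen_orthant (n : ℕ) : IsOpen (orthant n) := by
  have : orthant n = ⋂ i, {x | 0 < x i} := by ext x; simp [orthant]
  rw [this]
  exact isOpen_iInter_of_finite fun i => isOpen_lt continuous_const (continuous_apply i)

theorem ae_mem_orthant (n : ℕ) : ∀ᵐ x ∂(orthantMeasure n), x ∈ orthant n :=
  ae_restrict_mem (isOpen_orthant n).measurableSet

theorem multiPow_pos {n : ℕ} {x : Fin n → ℝ} (hx : x ∈ orthant n) (β : Fin n → ℝ) :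
    0 < multiPow x β :=
  Finset.prod_pos fun i _ => Real.rpow_pos_of_pos (hx i) _

theorem contDiffOn_multiPow {n : ℕ} (β : Fin n → ℝ) :
    ContDiffOn ℝ ∞ (fun x => multiPow x β) (orthant n) := by
  unfold multiPow
  refine contDiffOn_prod fun i _ => ?_
  exact (contDiff_apply ℝ ℝ i).contDiffOn.rpow_const_of_ne fun x hx => (hx i).ne'

theorem normConst_pos {n : ℕ} {μ : Fin n → ℝ} (hμ : ∀ i, -1 / 2 < μ i) : 0 < normConst μ :=
  mul_pos (Finset.prod_pos fun i _ => Real.rpow_pos_of_pos two_pos _)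
    (Finset.prod_pos fun i _ => Real.Gamma_pos_of_pos (by linarith [hμ i]))

theorem normConst_mul_weights {n : ℕ} {μ : Fin n → ℝ} (hμ : ∀ i, -1 / 2 < μ i)
    {x : Fin n → ℝ} (hx : x ∈ orthant n) :
    normConst μ * (weightS μ x * weightR μ x * weightR μ x) = 1 := by
  have h : multiPow x (fun i => 2 * μ i + 1) * multiPow x (fun i => -μ i - 1 / 2) *
      multiPow x (fun i => -μ i - 1 / 2) = 1 := by
    unfold multiPow
    rw [← Finset.prod_mul_distrib, ← Finset.prod_mul_distrib]
    refine Finset.prod_eq_one fun i _ => ?_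
    rw [← Real.rpow_add (hx i), ← Real.rpow_add (hx i)]
    ring_nf
    exact Real.rpow_zero _
  have hC := (normConst_pos hμ).ne'
  unfold weightS weightR
  rw [div_mul_eq_mul_div, div_mul_eq_mul_div, mul_div_cancel₀ _ hC]
  exact h

theorem pderiv_smul {n : ℕ} (i : Fin n) {u : (Fin n → ℝ) → ℝ} {g : (Fin n → ℝ) → ℂ}
    {x : Fin n → ℝ} (hu : DifferentiableAt ℝ u x) (hg : DifferentiableAt ℝ g x) :
    pderiv i (fun y => u y • g y) x =
      u x • pderiv i g x + (fderiv ℝ u x (Pi.single i 1)) • g x := by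
  unfold pderiv
  rw [fderiv_fun_smul hu hg]
  rfl

theorem pderiv_congr {n : ℕ} (i : Fin n) {f g : (Fin n → ℝ) → ℂ}
    (h : EqOn f g (orthant n)) {x : Fin n → ℝ} (hx : x ∈ orthant n) :
    pderiv i f x = pderiv i g x := by
  have : f =ᶠ[nhds x] g := h.eventuallyEq_of_mem ((isOpen_orthant n).mem_nhds hx)
  simp [pderiv, this.fderiv_eq]

theorem contDiffOn_pderiv {n : ℕ} (i : Fin n) {f : (Fin n → ℝ) → ℂ}
    (h : ContDiffOn ℝ ∞ f (orthant n)) : ContDiffOn ℝ ∞ (pderiv i f) (orthant n) :=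
  (h.fderiv_of_isOpen (isOpen_orthant n) le_rfl).clm_apply contDiffOn_const

theorem differentiableAt_of_contDiffOn {n : ℕ} {F : Type*} [NormedAddCommGroup F]
    [NormedSpace ℝ F] {f : (Fin n → ℝ) → F}
    (h : ContDiffOn ℝ ∞ f (orthant n)) {x : Fin n → ℝ} (hx : x ∈ orthant n) :
    DifferentiableAt ℝ f x :=
  (h.contDiffAt ((isOpen_orthant n).mem_nhds hx)).differentiableAt (by simp)

theorem fderiv_multiPow {n : ℕ} (i : Fin n) (β : Fin n → ℝ) {x : Fin n → ℝ}
    (hx : x ∈ orthant n) :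
    fderiv ℝ (fun y => multiPow y β) x (Pi.single i 1) = β i * (x i)⁻¹ * multiPow x β := by
  have h1 : (fun y => multiPow y β) =ᶠ[nhds x]
      fun y => Real.exp (∑ j, Real.log (y j) * β j) := by
    filter_upwards [(isOpen_orthant n).mem_nhds hx] with y hy
    rw [Real.exp_sum]
    exact Finset.prod_congr rfl fun j _ => Real.rpow_def_of_pos (hy j) _
  have h2 : HasFDerivAt (fun y : Fin n → ℝ => ∑ j, Real.log (y j) * β j)
      (∑ j, β j • ((x j)⁻¹ • ContinuousLinearMap.proj (R := ℝ) (φ := fun _ : Fin n => ℝ) j)) x :=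
    HasFDerivAt.fun_sum fun j _ =>
      (((ContinuousLinearMap.proj (R := ℝ) (φ := fun _ : Fin n => ℝ) j).hasFDerivAt).log
        (hx j).ne').mul_const (β j)
  have h3 : Real.exp (∑ j, Real.log (x j) * β j) = multiPow x β := h1.self_of_nhds.symm
  rw [h1.fderiv_eq, h2.exp.fderiv, h3]
  simp [Pi.single_apply]
  ring

theorem fderiv_const_mul_inv {n : ℕ} (i : Fin n) (a : ℝ) {x : Fin n → ℝ}
    (hx : x ∈ orthant n) :
    DifferentiableAt ℝ (fun y : Fin n → ℝ => a * (y i)⁻¹) x ∧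
    fderiv ℝ (fun y : Fin n → ℝ => a * (y i)⁻¹) x (Pi.single i 1) = -(a * ((x i)⁻¹) ^ 2) := by
  have h := ((hasDerivAt_inv (hx i).ne').comp_hasFDerivAt x
    (ContinuousLinearMap.proj (R := ℝ) (φ := fun _ : Fin n => ℝ) i).hasFDerivAt).const_mul a
  refine ⟨h.differentiableAt, ?_⟩
  have h' : fderiv ℝ (fun y : Fin n → ℝ => a * (y i)⁻¹) x = _ := h.fderiv
  rw [h']
  simp

theorem weightR_smul_besselOp {n : ℕ} (μ : Fin n → ℝ) {φ : (Fin n → ℝ) → ℂ}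
    (hφ : ContDiffOn ℝ ∞ φ (orthant n)) {x : Fin n → ℝ} (hx : x ∈ orthant n) :
    weightR μ x • besselOp μ φ x =
      ∑ i, ((x i ^ 2) • opT i (opT i (fun y => weightR μ y • φ y)) x +
        (2 * μ i + 2) • opT i (fun y => weightR μ y • φ y) x) := by
  have hr : ContDiffOn ℝ ∞ (weightR μ) (orthant n) := contDiffOn_multiPow _
  have hψ : ContDiffOn ℝ ∞ (fun y => weightR μ y • φ y) (orthant n) := hr.smul hφ
  unfold besselOp
  rw [Finset.smul_sum]
  refine Finset.sum_congr rfl fun i _ => ?_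
  have key : ∀ g : (Fin n → ℝ) → ℂ, ContDiffOn ℝ ∞ g (orthant n) → ∀ y ∈ orthant n,
      pderiv i (fun z => weightR μ z • g z) y =
        weightR μ y • pderiv i g y + ((-μ i - 1 / 2) * (y i)⁻¹) • weightR μ y • g y := by
    intro g hg y hy
    rw [pderiv_smul i (differentiableAt_of_contDiffOn hr hy) (differentiableAt_of_contDiffOn hg hy)]
    have := fderiv_multiPow i (fun i => -μ i - 1 / 2) hy
    unfold weightR
    rw [this, mul_smul]
  have hinv := fderiv_const_mul_inv i (-μ i - 1 / 2) hx
  have h2 : pderiv i (pderiv i (fun y => weightR μ y • φ y)) x =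
      pderiv i (fun y => weightR μ y • pderiv i φ y) x +
      pderiv i (fun y => ((-μ i - 1 / 2) * (y i)⁻¹) • weightR μ y • φ y) x := by
    rw [pderiv_congr i (key φ hφ) hx]
    have d1 : DifferentiableAt ℝ (fun y => weightR μ y • pderiv i φ y) x :=
      differentiableAt_of_contDiffOn (hr.smul (contDiffOn_pderiv i hφ)) hx
    have d2 : DifferentiableAt ℝ
        (fun y => ((-μ i - 1 / 2) * (y i)⁻¹) • weightR μ y • φ y) x :=
      hinv.1.smul (differentiableAt_of_contDiffOn hψ hx)
    have d3 := fderiv_fun_add d1 d2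
    exact congrArg (fun L => L (Pi.single i 1)) d3
  rw [key _ (contDiffOn_pderiv i hφ) x hx,
    pderiv_smul i hinv.1 (differentiableAt_of_contDiffOn hψ hx), hinv.2, key φ hφ x hx] at h2
  have hinv1 := fderiv_const_mul_inv i 1 hx
  have h3 : opT i (opT i (fun y => weightR μ y • φ y)) x =
      (x i)⁻¹ • ((1 * (x i)⁻¹) • pderiv i (pderiv i (fun y => weightR μ y • φ y)) x +
        (-(1 * ((x i)⁻¹) ^ 2)) • pderiv i (fun y => weightR μ y • φ y) x) := by
    have : opT i (fun y => weightR μ y • φ y) =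
        fun y => (1 * (y i)⁻¹) • pderiv i (fun y => weightR μ y • φ y) y := by
      funext y; simp [opT]
    rw [this]
    conv_lhs => unfold opT
    rw [pderiv_smul i hinv1.1 (differentiableAt_of_contDiffOn (contDiffOn_pderiv i hψ) hx),
      hinv1.2]
  rw [h3, h2]
  unfold opT
  rw [key φ hφ x hx]
  have hxi : (x i : ℂ) ≠ 0 := by exact_mod_cast (hx i).ne'
  simp only [Complex.real_smul]
  push_cast
  field_simp
  ring

theorem foldl_iterate_eq_self {n : ℕ} (k : Fin n → ℕ) (l : List (Fin n))
    (h : ∀ j ∈ l, k j = 0) (φ : (Fin n → ℝ) → ℂ) :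
    l.foldl (fun g j => (opT j)^[k j] g) φ = φ := by
  induction l generalizing φ with
  | nil => rfl
  | cons a l ih =>
    rw [List.foldl_cons, h a (by simp)]
    exact ih (fun j hj => h j (by simp [hj])) φ

theorem foldl_iterate_single {n : ℕ} (i : Fin n) (m : ℕ) (l : List (Fin n)) (hl : l.Nodup)
    (hi : i ∈ l) (φ : (Fin n → ℝ) → ℂ) :
    l.foldl (fun g j => (opT j)^[(Pi.single i m : Fin n → ℕ) j] g) φ = (opT i)^[m] φ := by
  induction l generalizing φ with
  | nil => simp at hi
  | cons a l ih =>
    rw [List.foldl_cons]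
    rw [List.nodup_cons] at hl
    by_cases h : i = a
    · subst h
      rw [Pi.single_eq_same]
      refine foldl_iterate_eq_self _ l (fun j hj => ?_) _
      exact Pi.single_eq_of_ne (by rintro rfl; exact hl.1 hj) _
    · have : (Pi.single i m : Fin n → ℕ) a = 0 := Pi.single_eq_of_ne (Ne.symm h) _
      rw [this]
      refine ih hl.2 ?_ φ
      simpa [h] using hi

theorem opTPow_zero {n : ℕ} (φ : (Fin n → ℝ) → ℂ) : opTPow 0 φ = φ :=
  foldl_iterate_eq_self 0 _ (fun _ _ => rfl) φ

theorem opTPow_single {n : ℕ} (i : Fin n) (m : ℕ) (φ : (Fin n → ℝ) → ℂ) :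
    opTPow (Pi.single i m) φ = (opT i)^[m] φ :=
  foldl_iterate_single i m _ (List.nodup_finRange n) (List.mem_finRange i) φ

theorem IsZemanian.weightR_bounded {n : ℕ} {μ : Fin n → ℝ} {φ : (Fin n → ℝ) → ℂ}
    (hφ : IsZemanian μ φ) : ∃ C : ℝ, ∀ x ∈ orthant n, ‖weightR μ x • φ x‖ ≤ C := by
  obtain ⟨C, hC⟩ := hφ.bounded 0 0
  refine ⟨C, fun x hx => ?_⟩
  have := hC x hx
  rwa [opTPow_zero, pow_zero, one_smul] at this

theorem IsZemanian.weightR_besselOp_bounded {n : ℕ} {μ : Fin n → ℝ} {φ : (Fin n → ℝ) → ℂ}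
    (hφ : IsZemanian μ φ) : ∃ C : ℝ, ∀ x ∈ orthant n, ‖weightR μ x • besselOp μ φ x‖ ≤ C := by
  choose C1 hC1 using fun i : Fin n => hφ.bounded 1 (Pi.single i 2)
  choose C2 hC2 using fun i : Fin n => hφ.bounded 0 (Pi.single i 1)
  refine ⟨∑ i, (C1 i + ‖2 * μ i + 2‖ * C2 i), fun x hx => ?_⟩
  rw [weightR_smul_besselOp μ hφ.smooth hx]
  refine norm_sum_le_of_le _ fun i _ => (norm_add_le _ _).trans (add_le_add ?_ ?_)
  · refine le_trans ?_ (hC1 i x hx)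
    rw [opTPow_single, pow_one, norm_smul, norm_smul]
    refine mul_le_mul_of_nonneg_right ?_ (norm_nonneg _)
    have h0 : 0 ≤ ∑ j, x j ^ 2 := Finset.sum_nonneg fun j _ => sq_nonneg _
    have h1 : x i ^ 2 ≤ ∑ j, x j ^ 2 :=
      Finset.single_le_sum (f := fun j => x j ^ 2) (fun j _ => sq_nonneg _) (Finset.mem_univ i)
    rw [Real.norm_of_nonneg (sq_nonneg _), Real.norm_of_nonneg (by linarith)]
    linarith
  · have := hC2 i x hx
    rw [opTPow_single, pow_zero, one_smul, Function.iterate_one] at this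
    rw [norm_smul]
    exact mul_le_mul_of_nonneg_left this (norm_nonneg _)

theorem contDiffOn_besselOp {n : ℕ} (μ : Fin n → ℝ) {φ : (Fin n → ℝ) → ℂ}
    (hφ : ContDiffOn ℝ ∞ φ (orthant n)) : ContDiffOn ℝ ∞ (besselOp μ φ) (orthant n) := by
  unfold besselOp
  refine ContDiffOn.sum fun i _ => ?_
  refine (contDiffOn_pderiv i (contDiffOn_pderiv i hφ)).sub ?_
  refine ContDiffOn.smul (f := fun x : Fin n → ℝ => (4 * μ i ^ 2 - 1) / (4 * x i ^ 2)) ?_ hφ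
  refine contDiffOn_const.div (contDiffOn_const.mul ((contDiff_apply ℝ ℝ i).contDiffOn.pow 2)) ?_
  intro x hx
  have := hx i
  positivity

theorem integrable_pairing {n : ℕ} {μ : Fin n → ℝ} (hμ : ∀ i, -1 / 2 < μ i) (f : SpaceY μ)
    {ψ : (Fin n → ℝ) → ℂ} (hψ : ContinuousOn ψ (orthant n))
    (hb : ∃ C : ℝ, ∀ x ∈ orthant n, ‖weightR μ x • ψ x‖ ≤ C) :
    Integrable (fun x => f.1 x * ψ x) (orthantMeasure n) := by
  obtain ⟨C, hC⟩ := hb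
  have h1 : Integrable (fun x => (weightS μ x * weightR μ x) • f.1 x) (orthantMeasure n) :=
    memLp_one_iff_integrable.1 f.2.1
  have hm : AEStronglyMeasurable (fun x => weightR μ x • ψ x) (orthantMeasure n) :=
    ((contDiffOn_multiPow _).continuousOn.smul hψ).aestronglyMeasurable
      (isOpen_orthant n).measurableSet
  have h2 := (h1.mul_bdd hm ((ae_mem_orthant n).mono hC)).const_mul ((normConst μ : ℝ) : ℂ)
  refine h2.congr ?_
  filter_upwards [ae_mem_orthant n] with x hx
  have h3 : ((normConst μ : ℝ) : ℂ) * (weightS μ x * weightR μ x * weightR μ x) = 1 := by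
    exact_mod_cast normConst_mul_weights hμ hx
  simp only [Complex.real_smul, Complex.ofReal_mul]
  linear_combination (f.1 x * ψ x) * h3

theorem contDiff_smul_of_tsupport {n : ℕ} {w : (Fin n → ℝ) → ℝ} {ψ : (Fin n → ℝ) → ℂ}
    (hw : ContDiffOn ℝ ∞ w (orthant n)) (hψ : ContDiff ℝ ∞ ψ) (hs : tsupport ψ ⊆ orthant n) :
    ContDiff ℝ ∞ (fun x => w x • ψ x) := by
  rw [contDiff_iff_contDiffAt]
  intro x
  by_cases hx : x ∈ orthant n
  · exact (hw.contDiffAt ((isOpen_orthant n).mem_nhds hx)).smul hψ.contDiffAt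
  · have h0 : ψ =ᶠ[nhds x] 0 := notMem_tsupport_iff_eventuallyEq.1 fun h => hx (hs h)
    refine (contDiffAt_const (c := (0 : ℂ))).congr_of_eventuallyEq ?_
    filter_upwards [h0] with y hy
    simp [hy]

theorem hasCompactSupport_real_smul {n : ℕ} (w : (Fin n → ℝ) → ℝ) {ψ : (Fin n → ℝ) → ℂ}
    (h : HasCompactSupport ψ) : HasCompactSupport (fun x => w x • ψ x) :=
  IsCompact.of_isClosed_subset h isClosed_closure (tsupport_smul_subset_right w ψ)

/-- Smooth functions with compact support in the orthant belong to `H_μ`. -/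
theorem isZemanian_of_compactSupport {n : ℕ} (μ : Fin n → ℝ) {φ : (Fin n → ℝ) → ℂ}
    (hφ : ContDiff ℝ ∞ φ) (hc : HasCompactSupport φ) (hs : tsupport φ ⊆ orthant n) :
    IsZemanian μ φ := by
  let P : ((Fin n → ℝ) → ℂ) → Prop := fun ψ =>
    ContDiff ℝ ∞ ψ ∧ HasCompactSupport ψ ∧ tsupport ψ ⊆ orthant n
  have hsmul : ∀ (w : (Fin n → ℝ) → ℝ) ψ, ContDiffOn ℝ ∞ w (orthant n) → P ψ →
      P (fun x => w x • ψ x) := fun w ψ hw hψ =>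
    ⟨contDiff_smul_of_tsupport hw hψ.1 hψ.2.2, hasCompactSupport_real_smul w hψ.2.1,
      (tsupport_smul_subset_right w ψ).trans hψ.2.2⟩
  have hT : ∀ j ψ, P ψ → P (opT j ψ) := by
    intro j ψ hψ
    refine hsmul (fun x => (x j)⁻¹) (pderiv j ψ) ?_ ⟨?_, ?_, ?_⟩
    · exact (contDiff_apply ℝ ℝ j).contDiffOn.inv fun x hx => (hx j).ne'
    · exact (hψ.1.fderiv_right le_rfl).clm_apply contDiff_const
    · exact hψ.2.1.fderiv_apply ℝ _
    · exact (tsupport_fderiv_apply_subset ℝ _).trans hψ.2.2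
  have hTi : ∀ j (m : ℕ) ψ, P ψ → P ((opT j)^[m] ψ) := by
    intro j m
    induction m with
    | zero => exact fun ψ h => h
    | succ m ih => exact fun ψ h => ih _ (hT j ψ h)
  have hl : ∀ (k : Fin n → ℕ) (l : List (Fin n)) ψ, P ψ →
      P (l.foldl (fun g j => (opT j)^[k j] g) ψ) := by
    intro k l
    induction l with
    | nil => exact fun ψ h => h
    | cons a l ih => exact fun ψ h => ih _ (hTi a (k a) ψ h)
  refine ⟨hφ.contDiffOn, fun m k => ?_⟩
  have h1 : P (fun x => (1 + ∑ i, x i ^ 2) ^ m • opTPow k (fun y => weightR μ y • φ y) x) := by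
    refine hsmul _ _ ?_ (hl k _ _ (hsmul _ _ (contDiffOn_multiPow _) ⟨hφ, hc, hs⟩))
    exact ContDiff.contDiffOn (by fun_prop)
  obtain ⟨C, hC⟩ := h1.1.continuous.bounded_above_of_compact_support h1.2.1
  exact ⟨C, fun x _ => hC x⟩

/-- An element of `Y` is determined by its pairings with `H_μ`. -/
theorem eq_zero_of_pairing {n : ℕ} {μ : Fin n → ℝ} (hμ : ∀ i, -1 / 2 < μ i) (f : SpaceY μ)
    (h : ∀ φ, IsZemanian μ φ → ∫ x, f.1 x * φ x ∂(orthantMeasure n) = 0) : f = 0 := by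
  have h1 : Integrable (fun x => (weightS μ x * weightR μ x) • f.1 x) (orthantMeasure n) :=
    memLp_one_iff_integrable.1 f.2.1
  have hw : ContDiffOn ℝ ∞ (fun x => weightS μ x * weightR μ x) (orthant n) :=
    ((contDiffOn_multiPow _).div_const _).mul (contDiffOn_multiPow _)
  have h2 := (isOpen_orthant n).ae_eq_zero_of_integral_contDiff_smul_eq_zero
    (h1.locallyIntegrable.locallyIntegrableOn _) (fun g hg hgc hgs => by
      have hg' : ContDiff ℝ ∞ (fun x => ((g x : ℝ) : ℂ)) := Complex.ofRealCLM.contDiff.comp hg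
      have hsub : tsupport (fun x => ((g x : ℝ) : ℂ)) ⊆ tsupport g :=
        closure_mono fun x hx => by
          simpa using hx
      have hc' : HasCompactSupport (fun x => ((g x : ℝ) : ℂ)) :=
        IsCompact.of_isClosed_subset hgc isClosed_closure hsub
      have hz := h _ (isZemanian_of_compactSupport μ
        (contDiff_smul_of_tsupport hw hg' (hsub.trans hgs)) (hasCompactSupport_real_smul _ hc')
        ((tsupport_smul_subset_right _ _).trans (hsub.trans hgs)))
      rw [← hz]
      refine integral_congr_ae (Filter.Eventually.of_forall fun x => ?_)
      simp only [Complex.real_smul]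
      ring)
  refine Subtype.ext (AEEqFun.ext ?_)
  have h0 : ((0 : (Fin n → ℝ) →ₘ[orthantMeasure n] ℂ) : (Fin n → ℝ) → ℂ)
      =ᵐ[orthantMeasure n] 0 := AEEqFun.coeFn_zero
  filter_upwards [h2, ae_mem_orthant n, h0] with x hx hxo hx0
  have h3 := normConst_mul_weights hμ hxo
  have hne : weightS μ x * weightR μ x ≠ 0 := by
    intro h; rw [h] at h3; simp at h3
  rcases smul_eq_zero.1 (hx hxo) with h4 | h4
  · exact absurd h4 hne
  · rw [h4]; exact hx0.symm

/-! ### The Bessel operator in `Y` -/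

/-- `S_μ f = g` in `H'_μ`, for `f, g ∈ Y` regarded as regular elements of `H'_μ`; here `S_μ` acts on
`H'_μ` by transposition, `(S_μ f, φ) = (f, S_μ φ)` for `φ ∈ H_μ`. -/
def IsBesselOf {n : ℕ} (μ : Fin n → ℝ) (f g : SpaceY μ) : Prop :=
  ∀ φ, IsZemanian μ φ →
    ∫ x, g.1 x * φ x ∂(orthantMeasure n) = ∫ x, f.1 x * besselOp μ φ x ∂(orthantMeasure n)

/-- The graph of `S_μ` in `Y × Y`. -/
noncomputable def besselGraph {n : ℕ} {μ : Fin n → ℝ} (hμ : ∀ i, -1 / 2 < μ i) :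
    Submodule ℂ (SpaceY μ × SpaceY μ) where
  carrier := {p | IsBesselOf μ p.1 p.2}
  add_mem' := by
    intro p q hp hq φ hφ
    have h1 := AEEqFun.coeFn_add p.1.1 q.1.1
    have h2 := AEEqFun.coeFn_add p.2.1 q.2.1
    have hc := (contDiffOn_besselOp μ hφ.smooth).continuousOn
    have e1 : ∫ x, (p + q).2.1 x * φ x ∂(orthantMeasure n) =
        ∫ x, (p.2.1 x * φ x + q.2.1 x * φ x) ∂(orthantMeasure n) := by
      refine integral_congr_ae ?_
      filter_upwards [h2] with x hx
      simp [hx, add_mul]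
    have e2 : ∫ x, (p + q).1.1 x * besselOp μ φ x ∂(orthantMeasure n) =
        ∫ x, (p.1.1 x * besselOp μ φ x + q.1.1 x * besselOp μ φ x) ∂(orthantMeasure n) := by
      refine integral_congr_ae ?_
      filter_upwards [h1] with x hx
      simp [hx, add_mul]
    rw [e1, e2, integral_add, integral_add, hp φ hφ, hq φ hφ]
    · exact integrable_pairing hμ _ hc hφ.weightR_besselOp_bounded
    · exact integrable_pairing hμ _ hc hφ.weightR_besselOp_bounded
    · exact integrable_pairing hμ _ hφ.smooth.continuousOn hφ.weightR_bounded
    · exact integrable_pairing hμ _ hφ.smooth.continuousOn hφ.weightR_bounded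
  zero_mem' := by
    intro φ hφ
    have h : ((0 : (Fin n → ℝ) →ₘ[orthantMeasure n] ℂ) : (Fin n → ℝ) → ℂ)
      =ᵐ[orthantMeasure n] 0 := AEEqFun.coeFn_zero
    have h' : ∀ ψ : (Fin n → ℝ) → ℂ,
        ∫ x, (0 : (Fin n → ℝ) →ₘ[orthantMeasure n] ℂ) x * ψ x ∂(orthantMeasure n) = 0 := by
      intro ψ
      refine integral_eq_zero_of_ae ?_
      filter_upwards [h] with x hx
      simp [hx]
    exact (h' φ).trans (h' _).symm
  smul_mem' := by
    intro c p hp φ hφ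
    have h' : ∀ (f : (Fin n → ℝ) →ₘ[orthantMeasure n] ℂ) (ψ : (Fin n → ℝ) → ℂ),
        ∫ x, (c • f) x * ψ x ∂(orthantMeasure n) = c * ∫ x, f x * ψ x ∂(orthantMeasure n) := by
      intro f ψ
      rw [← integral_const_mul]
      refine integral_congr_ae ?_
      filter_upwards [AEEqFun.coeFn_smul c f] with x hx
      simp [hx, mul_assoc]
    have := hp φ hφ
    exact (h' _ _).trans ((congrArg _ this).trans (h' _ _).symm)

theorem besselGraph_single_valued {n : ℕ} {μ : Fin n → ℝ} (hμ : ∀ i, -1 / 2 < μ i) :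
    ∀ p ∈ besselGraph hμ, p.1 = 0 → p.2 = 0 := by
  intro p hp h0
  refine eq_zero_of_pairing hμ p.2 fun φ hφ => ?_
  rw [hp φ hφ, h0]
  have h : ((0 : (Fin n → ℝ) →ₘ[orthantMeasure n] ℂ) : (Fin n → ℝ) → ℂ)
    =ᵐ[orthantMeasure n] 0 := AEEqFun.coeFn_zero
  refine integral_eq_zero_of_ae ?_
  filter_upwards [h] with x hx
  simp [hx]

/-- The part `(S_μ)_Y` of the Bessel operator in `Y`, with domain `{f ∈ Y : S_μ f ∈ Y}`. -/
noncomputable def besselY {n : ℕ} {μ : Fin n → ℝ} (hμ : ∀ i, -1 / 2 < μ i) :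
    SpaceY μ →ₗ.[ℂ] SpaceY μ :=
  (besselGraph hμ).toLinearPMap

theorem besselY_graph {n : ℕ} {μ : Fin n → ℝ} (hμ : ∀ i, -1 / 2 < μ i) :
    (besselY hμ).graph = besselGraph hμ :=
  Submodule.toLinearPMap_graph_eq _ (besselGraph_single_valued hμ)

theorem mem_besselY_domain {n : ℕ} {μ : Fin n → ℝ} (hμ : ∀ i, -1 / 2 < μ i) (f : SpaceY μ) :
    f ∈ (besselY hμ).domain ↔ ∃ g, IsBesselOf μ f g := by
  rw [LinearPMap.mem_domain_iff, besselY_graph]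
  rfl

theorem besselY_spec {n : ℕ} {μ : Fin n → ℝ} (hμ : ∀ i, -1 / 2 < μ i)
    (f : (besselY hμ).domain) : IsBesselOf μ f (besselY hμ f) := by
  have h := (besselY hμ).mem_graph f
  rw [besselY_graph] at h
  exact h

/-! ### The space `B` -/

/-- The domain of the `k`-th power of a partially defined operator `A`:
`D(A⁰)` is everything and `D(A^(k+1)) = {f ∈ D(A) : A f ∈ D(A^k)}`. -/
noncomputable def powDomain {X : Type*} [AddCommGroup X] [Module ℂ X] (A : X →ₗ.[ℂ] X) :
    ℕ → Submodule ℂ X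
  | 0 => ⊤
  | k + 1 => ((powDomain A k).comap A.toFun).map A.domain.subtype

/-- `B = {f ∈ Y : S_μ ^ k f ∈ Y for all k} = ⋂ₖ D(((S_μ)_Y) ^ k)`. -/
noncomputable def besselSubmodule {n : ℕ} {μ : Fin n → ℝ} (hμ : ∀ i, -1 / 2 < μ i) :
    Submodule ℂ (SpaceY μ) :=
  ⨅ k, powDomain (besselY hμ) k

/-- The space `B` as a type. -/
abbrev BesselSpace {n : ℕ} {μ : Fin n → ℝ} (hμ : ∀ i, -1 / 2 < μ i) : Type :=
  besselSubmodule hμ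

theorem mem_domain_of_mem_besselSubmodule {n : ℕ} {μ : Fin n → ℝ} {hμ : ∀ i, -1 / 2 < μ i}
    {f : SpaceY μ} (hf : f ∈ besselSubmodule hμ) : f ∈ (besselY hμ).domain := by
  obtain ⟨g, -, rfl⟩ := (Submodule.mem_iInf _).1 hf 1
  exact g.2

theorem besselY_mem_besselSubmodule {n : ℕ} {μ : Fin n → ℝ} {hμ : ∀ i, -1 / 2 < μ i}
    {f : SpaceY μ} (hf : f ∈ besselSubmodule hμ) :
    besselY hμ ⟨f, mem_domain_of_mem_besselSubmodule hf⟩ ∈ besselSubmodule hμ := by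
  refine (Submodule.mem_iInf _).2 fun k => ?_
  obtain ⟨g, hg, rfl⟩ := (Submodule.mem_iInf _).1 hf (k + 1)
  exact hg

/-- The part `(S_μ)_B` of the Bessel operator in `B`; its domain is all of `B`. -/
noncomputable def besselB {n : ℕ} {μ : Fin n → ℝ} (hμ : ∀ i, -1 / 2 < μ i) :
    BesselSpace hμ →ₗ[ℂ] BesselSpace hμ where
  toFun f := ⟨besselY hμ ⟨f.1, mem_domain_of_mem_besselSubmodule f.2⟩,
    besselY_mem_besselSubmodule f.2⟩
  map_add' f g := Subtype.ext ((besselY hμ).map_add ⟨f.1, mem_domain_of_mem_besselSubmodule f.2⟩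
    ⟨g.1, mem_domain_of_mem_besselSubmodule g.2⟩)
  map_smul' c f := Subtype.ext ((besselY hμ).map_smul c
    ⟨f.1, mem_domain_of_mem_besselSubmodule f.2⟩)

/-- The seminorms `ρ_m(f) = max_{0 ≤ k ≤ m} ‖S_μ ^ k f‖_Y` of `B`. -/
noncomputable def rho {n : ℕ} {μ : Fin n → ℝ} (hμ : ∀ i, -1 / 2 < μ i) :
    SeminormFamily ℂ (BesselSpace hμ) ℕ :=
  fun m => (Finset.range (m + 1)).sup fun k =>
    (normY μ).comp ((besselSubmodule hμ).subtype ∘ₗ (besselB hμ) ^ k)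

/-- The topology of `B`, generated by the seminorms `ρ_m`. -/
noncomputable instance besselSpaceTopology {n : ℕ} {μ : Fin n → ℝ} (hμ : ∀ i, -1 / 2 < μ i) :
    TopologicalSpace (BesselSpace hμ) :=
  (rho hμ).moduleFilterBasis.topology

/-! ### Fréchet spaces and non-negative operators -/

/-- A Fréchet space: a locally convex topological vector space that is metrizable (so Hausdorff)
and complete. -/
structure IsFrechetSpace (X : Type*) [AddCommGroup X] [Module ℂ X] [TopologicalSpace X] :
    Prop where
  isTopologicalAddGroup : IsTopologicalAddGroup X
  continuousSMul : ContinuousSMul ℂ X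
  locallyConvexSpace : LocallyConvexSpace ℝ X
  metrizableSpace : TopologicalSpace.MetrizableSpace X
  completeSpace : @CompleteSpace X (IsTopologicalAddGroup.rightUniformSpace X)

/-- `R` is the inverse `(c + A)⁻¹` of `c + A : D(A) → X`, as an everywhere defined continuous
operator. -/
def IsInverseOfShift {X : Type*} [AddCommGroup X] [Module ℂ X] [TopologicalSpace X]
    (A : X →ₗ.[ℂ] X) (c : ℂ) (R : X →L[ℂ] X) : Prop :=
  (∀ x, ∃ h : R x ∈ A.domain, c • R x + A ⟨R x, h⟩ = x) ∧
    ∀ u : A.domain, R (c • (u : X) + A u) = u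

/-- An operator `A : D(A) ⊆ X → X` in a locally convex space, whose topology is generated by the
directed family of seminorms `p`, is non-negative if it is closed, every `-c < 0` belongs to its
resolvent set, and the operators `c (c + A)⁻¹`, `c > 0`, are equicontinuous. -/
def IsNonnegative {X ι : Type*} [AddCommGroup X] [Module ℂ X] [TopologicalSpace X]
    (p : SeminormFamily ℂ X ι) (A : X →ₗ.[ℂ] X) : Prop :=
  A.IsClosed ∧
    ∃ R : ℝ → X →L[ℂ] X, (∀ c : ℝ, 0 < c → IsInverseOfShift A c (R c)) ∧
      ∀ i, ∃ j, ∃ C : ℝ, 0 ≤ C ∧ ∀ c : ℝ, 0 < c → ∀ x, p i ((c : ℂ) • R c x) ≤ C * p j x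

end Bessel

namespace Bessel

/-! ### The heat kernel of the Bessel operator -/

/-! Multiplication by `r` turns `Y` into `L¹(m) ∩ L^∞(m)` with `dm = s dx` (`besselMeasure`),
because the `L¹(sr)` norm of `f` is the `L¹(m)` norm of `u = r f` and the `L^∞(r)` norm of `f` is
the sup norm of `u`. It turns `S_μ` into `Δ = ∑ᵢ (∂ᵢ² + (2μᵢ + 1) xᵢ⁻¹ ∂ᵢ)`, which is symmetric for
`m` and generates a positive semigroup of total mass one. Its heat kernel is a product of Bessel
series in each coordinate, and the Laplace transform `K_c` of that kernel is symmetric with `∫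
K_c(x, y) dm(y) = 1 / c`. Schur's test therefore bounds the operator `K_c` by `1 / c` on `L¹(m)` and
on `L^∞(m)`, hence on `Y`.

That `K_c` inverts `c - Δ` is checked on Gaussians alone. The heat flow of a Gaussian is an explicit
multiple of another Gaussian and solves the heat equation, so `∫ e^{-ct} (c - Δ) e^{tΔ} g dt = g` by
the fundamental theorem of calculus (`integral_laplace_heatGaussian`). Gaussians separate integrable
functions by Stone–Weierstrass. So any integrable `u`, `v` with `v = Δ u` when tested against
Gaussians satisfy `K_c (c u - v) = u` (`kernelOp_resolventKernel_ae_eq`). This is used twice. For `u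
= r φ` with `φ ∈ H_μ`, where integration by parts gives the hypothesis, the symmetry of `K_c` shows
that `f = r⁻¹ K_c (r g)` solves `c f - S_μ f = g` weakly (`exists_resolvent`). For `u = r f` with
`S_μ f = c f`, it gives `u = K_c 0 = 0`, which is uniqueness; here one needs that `r⁻¹` times a
Gaussian lies in `H_μ`.

The passage to `B` is formal. `Y` is complete and `S_μ` is closed in it, so the limits of `S_μ^j
u_k` fit together and `B` is complete. The resolvent preserves `B` because `S_μ f = c f - g`, and
since `S_μ^k` commutes with `c - S_μ` the estimate `c ‖f‖ ≤ ‖g‖` in `Y` holds for every `ρ_m`, with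
constant `1` and the same `m`. -/

theorem lintegral_pi_prod_eq_prod : ∀ {n : ℕ} (ν : Fin n → Measure ℝ) [∀ i, SigmaFinite (ν i)]
    (f : Fin n → ℝ → ℝ≥0∞), (∀ i, Measurable (f i)) →
    ∫⁻ x, ∏ i, f i (x i) ∂(Measure.pi ν) = ∏ i, ∫⁻ y, f i y ∂(ν i)
  | 0, ν, _, f, _ => by
    simp
  | n + 1, ν, _, f, hf => by
    have h := (measurePreserving_piFinSuccAbove ν 0).symm
    rw [← h.lintegral_comp_emb (MeasurableEquiv.measurableEmbedding _)]
    simp only [MeasurableEquiv.piFinSuccAbove_symm_apply, Fin.insertNthEquiv_apply,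
      Fin.insertNth_zero', Fin.prod_univ_succ, Fin.cons_zero, Fin.cons_succ, Fin.zero_succAbove]
    rw [lintegral_prod_mul (f := f 0) (g := fun z : Fin n → ℝ => ∏ i, f i.succ (z i))
      (hf 0).aemeasurable]
    · congr 1
      exact lintegral_pi_prod_eq_prod (fun i => ν i.succ) (fun i => f i.succ) fun i => hf i.succ
    · exact (Finset.measurable_prod _ fun i _ =>
        (hf i.succ).comp (measurable_pi_apply i)).aemeasurable

/-- The coefficients of the power series of the one-dimensional heat kernel. -/
noncomputable def heatCoeff (ν t : ℝ) (k : ℕ) : ℝ :=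
  2 ^ (ν + 1) * Real.Gamma (ν + 1) * (4 * t) ^ (-(ν + 1)) * ((4 * t) ^ (2 * k))⁻¹ /
    (k.factorial * Real.Gamma (ν + k + 1))

/-- The heat kernel of `d²/dx² + (2ν + 1) x⁻¹ d/dx` on the half line with respect to the measure
`x ^ (2ν + 1) dx / (2 ^ ν Γ(ν + 1))`. -/
noncomputable def heatKernelOne (ν t x y : ℝ) : ℝ≥0∞ :=
  ∑' k : ℕ, ENNReal.ofReal (Real.exp (-(x ^ 2 + y ^ 2) / (4 * t)) * (x * y) ^ (2 * k) *
    heatCoeff ν t k)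

theorem heatKernelOne_symm (ν t x y : ℝ) : heatKernelOne ν t x y = heatKernelOne ν t y x := by
  simp only [heatKernelOne, add_comm (x ^ 2), mul_comm x]

theorem measurable_heatKernelOne (ν : ℝ) :
    Measurable fun p : ℝ × ℝ × ℝ => heatKernelOne ν p.1 p.2.1 p.2.2 := by
  unfold heatKernelOne heatCoeff
  refine Measurable.tsum fun k => ?_
  fun_prop

theorem heatCoeff_pos {ν t : ℝ} (hν : -1 < ν) (ht : 0 < t) (k : ℕ) : 0 < heatCoeff ν t k := by
  have h1 : 0 < Real.Gamma (ν + 1) := Real.Gamma_pos_of_pos (by linarith)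
  have h2 : 0 < Real.Gamma (ν + k + 1) := by
    have hk : (0 : ℝ) ≤ k := k.cast_nonneg
    exact Real.Gamma_pos_of_pos (by linarith)
  unfold heatCoeff
  positivity

theorem integrableOn_rpow_mul_exp_neg_mul_sq {q b : ℝ} (hq : -1 < q) (hb : 0 < b) :
    IntegrableOn (fun y : ℝ => y ^ q * Real.exp (-b * y ^ 2)) (Ioi 0) :=
  (integrable_rpow_mul_exp_neg_mul_sq hb hq).integrableOn

theorem lintegral_rpow_mul_exp_neg_mul_sq {q b : ℝ} (hq : -1 < q) (hb : 0 < b) :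
    ∫⁻ y in Ioi (0 : ℝ), ENNReal.ofReal (y ^ q * Real.exp (-b * y ^ 2)) =
      ENNReal.ofReal (b ^ (-(q + 1) / 2) * (1 / 2) * Real.Gamma ((q + 1) / 2)) := by
  rw [← ofReal_integral_eq_lintegral_ofReal (integrableOn_rpow_mul_exp_neg_mul_sq hq hb)]
  · congr 1
    rw [← integral_rpow_mul_exp_neg_mul_rpow two_pos hq hb]
    simp
  · filter_upwards [ae_restrict_mem measurableSet_Ioi] with y hy
    have : (0 : ℝ) < y := hy
    simp only [Pi.zero_apply]
    positivity

/-- Up to factors the series is that of `(x y)^{-ν} I_ν(x y / 2t)`. With values in `ℝ≥0∞` it may be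
integrated term by term; each term is a Gamma integral whose `Γ(ν + k + 1)` cancels the one in
`heatCoeff`, and what remains is an exponential series. The case `a = 0` says that the heat kernel
has mass one. -/
theorem lintegral_heatKernelOne_mul_gaussian {ν t a : ℝ} (hν : -1 < ν) (ht : 0 < t) (ha : 0 ≤ a)
    (x : ℝ) :
    ∫⁻ y in Ioi (0 : ℝ), ENNReal.ofReal (y ^ (2 * ν + 1) / (2 ^ ν * Real.Gamma (ν + 1))) *
      (heatKernelOne ν t x y * ENNReal.ofReal (Real.exp (-a * y ^ 2))) =
    ENNReal.ofReal ((1 + 4 * a * t) ^ (-(ν + 1)) * Real.exp (-a * x ^ 2 / (1 + 4 * a * t))) := by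
  have hG : 0 < Real.Gamma (ν + 1) := Real.Gamma_pos_of_pos (by linarith)
  have h2ν : (0 : ℝ) < 2 ^ ν := by positivity
  -- The total Gaussian rate in `y`: `a` from the Gaussian and `1 / (4t)` from the kernel.
  set b := a + 1 / (4 * t) with hb_def
  have hb : 0 < b := by positivity
  have hE : 0 < 1 + 4 * a * t := by positivity
  have hbE : 4 * t * b = 1 + 4 * a * t := by rw [hb_def]; field_simp; ring
  have hterm : ∀ k : ℕ, ∫⁻ y in Ioi (0 : ℝ),
      ENNReal.ofReal (y ^ (2 * ν + 1) / (2 ^ ν * Real.Gamma (ν + 1))) *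
      (ENNReal.ofReal (Real.exp (-(x ^ 2 + y ^ 2) / (4 * t)) * (x * y) ^ (2 * k) *
        heatCoeff ν t k) * ENNReal.ofReal (Real.exp (-a * y ^ 2))) =
      ENNReal.ofReal ((1 + 4 * a * t) ^ (-(ν + 1)) * Real.exp (-(x ^ 2) / (4 * t)) *
        ((x ^ 2 / (4 * t * (1 + 4 * a * t))) ^ k / k.factorial)) := by
    intro k
    have hk : (0 : ℝ) ≤ k := k.cast_nonneg
    have hGk : 0 < Real.Gamma (ν + k + 1) := Real.Gamma_pos_of_pos (by linarith)
    have hc := heatCoeff_pos hν ht k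
    set c : ℝ := (2 ^ ν * Real.Gamma (ν + 1))⁻¹ * Real.exp (-(x ^ 2) / (4 * t)) * x ^ (2 * k) *
      heatCoeff ν t k with hc_def
    have hc0 : 0 ≤ c := by
      have : 0 ≤ x ^ (2 * k) := by rw [pow_mul]; positivity
      positivity
    have h1 : ∀ y ∈ Ioi (0 : ℝ),
        ENNReal.ofReal (y ^ (2 * ν + 1) / (2 ^ ν * Real.Gamma (ν + 1))) *
        (ENNReal.ofReal (Real.exp (-(x ^ 2 + y ^ 2) / (4 * t)) * (x * y) ^ (2 * k) *
          heatCoeff ν t k) * ENNReal.ofReal (Real.exp (-a * y ^ 2))) =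
        ENNReal.ofReal c *
          ENNReal.ofReal (y ^ (2 * ν + 1 + 2 * k) * Real.exp (-b * y ^ 2)) := by
      intro y hy
      have hy0 : (0 : ℝ) < y := hy
      have hxy : 0 ≤ (x * y) ^ (2 * k) := by rw [pow_mul]; positivity
      rw [← ENNReal.ofReal_mul (by positivity), ← ENNReal.ofReal_mul (by positivity),
        ← ENNReal.ofReal_mul hc0]
      congr 1
      have e1 : y ^ (2 * ν + 1 + 2 * k) = y ^ (2 * ν + 1) * y ^ (2 * k) := by
        rw [Real.rpow_add hy0]
        congr 1
        exact_mod_cast Real.rpow_natCast y (2 * k)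
      have e2 : Real.exp (-(x ^ 2 + y ^ 2) / (4 * t)) * Real.exp (-a * y ^ 2) =
          Real.exp (-(x ^ 2) / (4 * t)) * Real.exp (-b * y ^ 2) := by
        rw [← Real.exp_add, ← Real.exp_add, hb_def]
        congr 1
        field_simp
        ring
      rw [e1, hc_def, mul_pow]
      linear_combination (y ^ (2 * ν + 1) / (2 ^ ν * Real.Gamma (ν + 1)) * (x ^ (2 * k) *
        y ^ (2 * k)) * heatCoeff ν t k) * e2
    rw [setLIntegral_congr_fun measurableSet_Ioi h1,
      lintegral_const_mul' _ _ ENNReal.ofReal_ne_top,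
      lintegral_rpow_mul_exp_neg_mul_sq (by linarith) hb, ← ENNReal.ofReal_mul hc0]
    congr 1
    have e3 : (2 * ν + 1 + 2 * k + 1) / 2 = ν + k + 1 := by ring
    have e4 : -(2 * ν + 1 + 2 * k + 1) / 2 = -(ν + 1) + -(k : ℝ) := by ring
    have e5 : b ^ (-(ν + 1) + -(k : ℝ)) = b ^ (-(ν + 1)) * (b ^ k)⁻¹ := by
      rw [Real.rpow_add hb, Real.rpow_neg hb.le (k : ℝ), Real.rpow_natCast]
    have e6 : (1 + 4 * a * t) ^ (-(ν + 1)) = (4 * t) ^ (-(ν + 1)) * b ^ (-(ν + 1)) := by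
      rw [← hbE, Real.mul_rpow (by positivity) hb.le]
    have e7 : (2 : ℝ) ^ (ν + 1) = 2 ^ ν * 2 := by rw [Real.rpow_add two_pos, Real.rpow_one]
    rw [e3, e4, e5, e6, hc_def, heatCoeff, e7, ← hbE]
    have hf : (k.factorial : ℝ) ≠ 0 := by positivity
    have e8 : (4 * t : ℝ) ^ (2 * k) = (4 * t) ^ k * (4 * t) ^ k := by rw [two_mul, pow_add]
    rw [e8, div_pow, mul_pow (4 * t) (4 * t * b), mul_pow (4 * t) b, pow_mul x]
    field_simp
  have hsum : ∀ y, ENNReal.ofReal (y ^ (2 * ν + 1) / (2 ^ ν * Real.Gamma (ν + 1))) *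
      (heatKernelOne ν t x y * ENNReal.ofReal (Real.exp (-a * y ^ 2))) =
      ∑' k : ℕ, ENNReal.ofReal (y ^ (2 * ν + 1) / (2 ^ ν * Real.Gamma (ν + 1))) *
      (ENNReal.ofReal (Real.exp (-(x ^ 2 + y ^ 2) / (4 * t)) * (x * y) ^ (2 * k) *
        heatCoeff ν t k) * ENNReal.ofReal (Real.exp (-a * y ^ 2))) := by
    intro y
    rw [heatKernelOne, ← ENNReal.tsum_mul_right, ← ENNReal.tsum_mul_left]
  simp_rw [hsum]
  rw [lintegral_tsum fun k => by fun_prop]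
  simp_rw [hterm]
  have hexp := (NormedSpace.expSeries_div_hasSum_exp (x ^ 2 / (4 * t * (1 + 4 * a * t)))).mul_left
    ((1 + 4 * a * t) ^ (-(ν + 1)) * Real.exp (-(x ^ 2) / (4 * t)))
  rw [← ENNReal.ofReal_tsum_of_nonneg (fun k => by positivity) hexp.summable, hexp.tsum_eq,
    ← Real.exp_eq_exp_ℝ, mul_assoc, ← Real.exp_add]
  -- The exponents combine since `x² / (4t E) - x² / (4t) = -a x² / E` for `E = 1 + 4at`.
  congr 3
  field_simp
  ring


/-! ### Integral operators with a symmetric kernel of bounded mass -/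

section Schur

variable {α : Type*} [MeasurableSpace α] {m : Measure α} {K : α → α → ℝ≥0∞}
  {M : ℝ≥0∞}

/-- The integral operator with kernel `K`. -/
noncomputable def kernelOp (m : Measure α) (K : α → α → ℝ≥0∞) (g : α → ℂ) (x : α) : ℂ :=
  ∫ y, (K x y).toReal • g y ∂m

/-- Only an inequality, as `toReal` sends `⊤` to `0`. This is why the bounds below need no
finiteness of the kernel. -/
theorem enorm_toReal_smul_le (k : ℝ≥0∞) (z : ℂ) : ‖k.toReal • z‖ₑ ≤ k * ‖z‖ₑ := by
  rw [enorm_smul]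
  gcongr
  rw [Real.enorm_of_nonneg ENNReal.toReal_nonneg]
  exact ENNReal.ofReal_toReal_le

theorem enorm_kernelOp_le (g : α → ℂ) (x : α) :
    ‖kernelOp m K g x‖ₑ ≤ ∫⁻ y, K x y * ‖g y‖ₑ ∂m :=
  (enorm_integral_le_lintegral_enorm _).trans
    (lintegral_mono fun _ => enorm_toReal_smul_le _ _)

theorem kernelOp_congr {g h : α → ℂ} (hgh : g =ᵐ[m] h) : kernelOp m K g = kernelOp m K h :=
  funext fun _ => integral_congr_ae (hgh.mono fun y hy => by simp only [hy])

theorem aestronglyMeasurable_kernel_smul (hK : Measurable (Function.uncurry K)) {g : α → ℂ}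
    (hg : AEStronglyMeasurable g m) :
    AEStronglyMeasurable (fun z : α × α => (K z.1 z.2).toReal • g z.2) (m.prod m) :=
  (hK.ennreal_toReal.aestronglyMeasurable (μ := m.prod m)).smul hg.comp_snd

theorem enorm_kernelOp_le_of_ae_le (hM : ∀ x, ∫⁻ y, K x y ∂m ≤ M) {g : α → ℂ} {C : ℝ≥0∞}
    (hC : C ≠ ⊤) (hg : ∀ᵐ y ∂m, ‖g y‖ₑ ≤ C) (x : α) : ‖kernelOp m K g x‖ₑ ≤ M * C := by
  refine (enorm_kernelOp_le g x).trans ?_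
  calc ∫⁻ y, K x y * ‖g y‖ₑ ∂m ≤ ∫⁻ y, K x y * C ∂m :=
        lintegral_mono_ae (hg.mono fun y hy => by gcongr)
    _ = (∫⁻ y, K x y ∂m) * C := lintegral_mul_const' _ _ hC
    _ ≤ M * C := by gcongr; exact hM x

variable [SFinite m]

theorem aestronglyMeasurable_kernelOp (hK : Measurable (Function.uncurry K)) {g : α → ℂ}
    (hg : AEStronglyMeasurable g m) : AEStronglyMeasurable (kernelOp m K g) m :=
  (aestronglyMeasurable_kernel_smul hK hg).integral_prod_right'

/-- The `L¹` half of Schur's test: Tonelli puts the integral over the first variable inside, and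
symmetry lets the row bound serve as the column bound. -/
theorem lintegral_lintegral_kernel_le (hK : Measurable (Function.uncurry K))
    (hs : ∀ x y, K x y = K y x) (hM : ∀ x, ∫⁻ y, K x y ∂m ≤ M) {f : α → ℝ≥0∞}
    (hf : AEMeasurable f m) : ∫⁻ x, ∫⁻ y, K x y * f y ∂m ∂m ≤ M * ∫⁻ y, f y ∂m := by
  rw [lintegral_lintegral_swap (hK.aemeasurable.mul hf.comp_snd), mul_comm,
    ← lintegral_mul_const'' M hf]
  refine lintegral_mono fun y => ?_
  have : Measurable fun x => K x y := hK.comp (measurable_id.prodMk measurable_const)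
  rw [lintegral_mul_const _ this, mul_comm]
  gcongr
  simpa only [hs _ y] using hM y

theorem lintegral_enorm_kernelOp_le (hK : Measurable (Function.uncurry K))
    (hs : ∀ x y, K x y = K y x) (hM : ∀ x, ∫⁻ y, K x y ∂m ≤ M) {g : α → ℂ}
    (hg : AEStronglyMeasurable g m) :
    ∫⁻ x, ‖kernelOp m K g x‖ₑ ∂m ≤ M * ∫⁻ y, ‖g y‖ₑ ∂m :=
  (lintegral_mono fun x => enorm_kernelOp_le g x).trans
    (lintegral_lintegral_kernel_le hK hs hM hg.enorm)

theorem integrable_kernelOp (hK : Measurable (Function.uncurry K))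
    (hs : ∀ x y, K x y = K y x) (hM : ∀ x, ∫⁻ y, K x y ∂m ≤ M) (hMt : M ≠ ⊤) {g : α → ℂ}
    (hg : Integrable g m) : Integrable (kernelOp m K g) m :=
  ⟨aestronglyMeasurable_kernelOp hK hg.1, (lintegral_enorm_kernelOp_le hK hs hM hg.1).trans_lt
    (ENNReal.mul_lt_top hMt.lt_top hg.2)⟩

/-- Self-adjointness in the `L¹`–`L^∞` duality. The double integral is absolutely convergent by the
Schur bound, so Fubini and the symmetry of `K` apply. -/
theorem integral_kernelOp_mul (hK : Measurable (Function.uncurry K))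
    (hs : ∀ x y, K x y = K y x) (hM : ∀ x, ∫⁻ y, K x y ∂m ≤ M) (hMt : M ≠ ⊤) {g h : α → ℂ}
    (hg : Integrable g m) (hh : AEStronglyMeasurable h m) {C : ℝ≥0∞} (hC : C ≠ ⊤)
    (hb : ∀ᵐ x ∂m, ‖h x‖ₑ ≤ C) :
    ∫ x, kernelOp m K g x * h x ∂m = ∫ y, g y * kernelOp m K h y ∂m := by
  have hint : Integrable (fun z : α × α => (K z.1 z.2).toReal • g z.2 * h z.1) (m.prod m) := by
    have hmeas : AEStronglyMeasurable
        (fun z : α × α => (K z.1 z.2).toReal • g z.2 * h z.1) (m.prod m) :=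
      (aestronglyMeasurable_kernel_smul hK hg.1).mul hh.comp_fst
    refine ⟨hmeas, ?_⟩
    rw [hasFiniteIntegral_iff_enorm, lintegral_prod _ hmeas.enorm]
    calc ∫⁻ x, ∫⁻ y, ‖(K x y).toReal • g y * h x‖ₑ ∂m ∂m
        ≤ ∫⁻ x, C * ∫⁻ y, K x y * ‖g y‖ₑ ∂m ∂m := by
          refine lintegral_mono_ae (hb.mono fun x hx => ?_)
          rw [← lintegral_const_mul' _ _ hC]
          refine lintegral_mono fun y => ?_
          dsimp only
          rw [enorm_mul, mul_comm]
          exact mul_le_mul' hx (enorm_toReal_smul_le _ _)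
      _ = C * ∫⁻ x, ∫⁻ y, K x y * ‖g y‖ₑ ∂m ∂m := lintegral_const_mul' _ _ hC
      _ ≤ C * (M * ∫⁻ y, ‖g y‖ₑ ∂m) := by
          gcongr
          exact lintegral_lintegral_kernel_le hK hs hM hg.1.enorm
      _ < ⊤ := ENNReal.mul_lt_top hC.lt_top (ENNReal.mul_lt_top hMt.lt_top hg.2)
  have hswap := integral_integral_swap (f := fun x y => (K x y).toReal • g y * h x) hint
  simp only [kernelOp]
  rw [show (∫ x, (∫ y, (K x y).toReal • g y ∂m) * h x ∂m) =
    ∫ x, ∫ y, (K x y).toReal • g y * h x ∂m ∂m from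
      integral_congr_ae (.of_forall fun x => (integral_mul_const _ _).symm), hswap]
  refine integral_congr_ae (.of_forall fun y => ?_)
  dsimp only
  rw [← integral_const_mul]
  refine integral_congr_ae (.of_forall fun x => ?_)
  simp only [hs x y, Complex.real_smul]
  ring

end Schur

/-! ### The Bessel measure and the resolvent kernel -/

/-- The measure `s(x) dx` on the orthant. -/
noncomputable def besselMeasure {n : ℕ} (μ : Fin n → ℝ) : Measure (Fin n → ℝ) :=
  (orthantMeasure n).withDensity fun x => ENNReal.ofReal (weightS μ x)

@[fun_prop]
theorem measurable_multiPow {n : ℕ} (β : Fin n → ℝ) : Measurable fun x => multiPow x β := by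
  unfold multiPow
  fun_prop

@[fun_prop]
theorem measurable_weightS {n : ℕ} (μ : Fin n → ℝ) : Measurable (weightS μ) :=
  (measurable_multiPow _).div_const _

@[fun_prop]
theorem measurable_weightR {n : ℕ} (μ : Fin n → ℝ) : Measurable (weightR μ) :=
  measurable_multiPow _

instance {n : ℕ} : SigmaFinite (orthantMeasure n) := by
  unfold orthantMeasure
  infer_instance

instance {n : ℕ} (μ : Fin n → ℝ) : SFinite (besselMeasure μ) := by
  unfold besselMeasure
  infer_instance

theorem besselMeasure_absolutelyContinuous {n : ℕ} (μ : Fin n → ℝ) :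
    besselMeasure μ ≪ orthantMeasure n :=
  withDensity_absolutelyContinuous _ _

theorem weightS_pos {n : ℕ} {μ : Fin n → ℝ} (hμ : ∀ i, -1 / 2 < μ i) {x : Fin n → ℝ}
    (hx : x ∈ orthant n) : 0 < weightS μ x :=
  div_pos (multiPow_pos hx _) (normConst_pos hμ)

/-- Since `s > 0` on the orthant, both measures have the same null sets, and almost everywhere
statements pass freely between them. -/
theorem orthantMeasure_absolutelyContinuous {n : ℕ} {μ : Fin n → ℝ} (hμ : ∀ i, -1 / 2 < μ i) :
    orthantMeasure n ≪ besselMeasure μ := by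
  refine withDensity_absolutelyContinuous' (by fun_prop) ?_
  filter_upwards [ae_mem_orthant n] with x hx
  simpa using weightS_pos hμ hx

theorem lintegral_besselMeasure {n : ℕ} (μ : Fin n → ℝ) (f : (Fin n → ℝ) → ℝ≥0∞) :
    ∫⁻ x, f x ∂(besselMeasure μ) =
      ∫⁻ x, ENNReal.ofReal (weightS μ x) * f x ∂(orthantMeasure n) := by
  rw [besselMeasure, lintegral_withDensity_eq_lintegral_mul_non_measurable _ (by fun_prop)]
  · rfl
  · exact .of_forall fun x => ENNReal.ofReal_lt_top

theorem orthantMeasure_eq_pi (n : ℕ) :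
    orthantMeasure n = Measure.pi fun _ : Fin n => (volume : Measure ℝ).restrict (Ioi 0) := by
  rw [← Measure.restrict_pi_pi]
  unfold orthantMeasure
  congr 1
  ext x
  simp [orthant]

theorem lintegral_besselMeasure_prod {n : ℕ} {μ : Fin n → ℝ} (hμ : ∀ i, -1 / 2 < μ i)
    (f : Fin n → ℝ → ℝ≥0∞) (hf : ∀ i, Measurable (f i)) :
    ∫⁻ x, ∏ i, f i (x i) ∂(besselMeasure μ) = ∏ i, ∫⁻ y in Ioi (0 : ℝ),
      ENNReal.ofReal (y ^ (2 * μ i + 1) / (2 ^ μ i * Real.Gamma (μ i + 1))) * f i y := by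
  rw [lintegral_besselMeasure, ← lintegral_pi_prod_eq_prod _ _ (fun i => by fun_prop),
    ← orthantMeasure_eq_pi]
  refine lintegral_congr_ae ?_
  filter_upwards [ae_mem_orthant n] with x hx
  rw [Finset.prod_mul_distrib, ← ENNReal.ofReal_prod_of_nonneg]
  · simp only [weightS, multiPow, normConst, Finset.prod_div_distrib, Finset.prod_mul_distrib]
  · intro i _
    have := hx i
    have := Real.Gamma_pos_of_pos (show 0 < μ i + 1 by linarith [hμ i])
    positivity

/-- The Gaussian `exp (-∑ aᵢ yᵢ²)`. -/
noncomputable def gaussian {n : ℕ} (a y : Fin n → ℝ) : ℝ := Real.exp (-∑ i, a i * y i ^ 2)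

/-- The heat flow of `gaussian a` at time `t`. -/
noncomputable def heatGaussian {n : ℕ} (μ a : Fin n → ℝ) (t : ℝ) (y : Fin n → ℝ) : ℝ :=
  ∏ i, ((1 + 4 * a i * t) ^ (-(μ i + 1)) * Real.exp (-a i * y i ^ 2 / (1 + 4 * a i * t)))

/-- The heat kernel of the Bessel operator on the orthant. -/
noncomputable def heatKernel {n : ℕ} (μ : Fin n → ℝ) (t : ℝ) (x y : Fin n → ℝ) : ℝ≥0∞ :=
  ∏ i, heatKernelOne (μ i) t (x i) (y i)

/-- The kernel of the resolvent `(c - S)⁻¹`, the Laplace transform of the heat kernel. -/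
noncomputable def resolventKernel {n : ℕ} (μ : Fin n → ℝ) (c : ℝ) (x y : Fin n → ℝ) : ℝ≥0∞ :=
  ∫⁻ t in Ioi (0 : ℝ), ENNReal.ofReal (Real.exp (-c * t)) * heatKernel μ t x y

theorem gaussian_eq_prod {n : ℕ} (a y : Fin n → ℝ) :
    gaussian a y = ∏ i, Real.exp (-a i * y i ^ 2) := by
  rw [gaussian, ← Real.exp_sum, ← Finset.sum_neg_distrib]
  simp only [neg_mul]

theorem gaussian_pos {n : ℕ} (a y : Fin n → ℝ) : 0 < gaussian a y := Real.exp_pos _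

theorem gaussian_le_one {n : ℕ} {a : Fin n → ℝ} (ha : ∀ i, 0 ≤ a i) (y : Fin n → ℝ) :
    gaussian a y ≤ 1 := by
  rw [gaussian, Real.exp_le_one_iff, neg_nonpos]
  exact Finset.sum_nonneg fun i _ => mul_nonneg (ha i) (sq_nonneg _)

@[fun_prop]
theorem continuous_gaussian {n : ℕ} (a : Fin n → ℝ) : Continuous (gaussian a) := by
  unfold gaussian
  fun_prop

theorem measurable_heatKernel {n : ℕ} (μ : Fin n → ℝ) :
    Measurable fun p : ℝ × (Fin n → ℝ) × (Fin n → ℝ) => heatKernel μ p.1 p.2.1 p.2.2 := by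
  unfold heatKernel
  refine Finset.measurable_prod _ fun i _ => ?_
  exact (measurable_heatKernelOne (μ i)).comp
    (f := fun p : ℝ × (Fin n → ℝ) × (Fin n → ℝ) => (p.1, p.2.1 i, p.2.2 i)) (by fun_prop)

theorem measurable_resolventKernel {n : ℕ} (μ : Fin n → ℝ) (c : ℝ) :
    Measurable (Function.uncurry (resolventKernel μ c)) := by
  unfold resolventKernel Function.uncurry
  refine Measurable.lintegral_prod_right' (f := fun q : ((Fin n → ℝ) × (Fin n → ℝ)) × ℝ =>
    ENNReal.ofReal (Real.exp (-c * q.2)) * heatKernel μ q.2 q.1.1 q.1.2) ?_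
  refine Measurable.mul (by fun_prop) ?_
  exact (measurable_heatKernel μ).comp
    (f := fun q : ((Fin n → ℝ) × (Fin n → ℝ)) × ℝ => (q.2, q.1)) (by fun_prop)

theorem resolventKernel_symm {n : ℕ} (μ : Fin n → ℝ) (c : ℝ) (x y : Fin n → ℝ) :
    resolventKernel μ c x y = resolventKernel μ c y x := by
  simp only [resolventKernel, heatKernel, heatKernelOne_symm _ _ (x _)]

/-! ### Kernels integrated against Gaussians, and the mass of the resolvent kernel -/

theorem lintegral_heatKernel_mul_gaussian {n : ℕ} {μ : Fin n → ℝ} (hμ : ∀ i, -1 / 2 < μ i)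
    {a : Fin n → ℝ} (ha : ∀ i, 0 ≤ a i) {t : ℝ} (ht : 0 < t) (x : Fin n → ℝ) :
    ∫⁻ y, heatKernel μ t x y * ENNReal.ofReal (gaussian a y) ∂(besselMeasure μ) =
      ENNReal.ofReal (heatGaussian μ a t x) := by
  have h : ∀ y, heatKernel μ t x y * ENNReal.ofReal (gaussian a y) =
      ∏ i, (heatKernelOne (μ i) t (x i) (y i) *
        ENNReal.ofReal (Real.exp (-a i * y i ^ 2))) := by
    intro y
    rw [Finset.prod_mul_distrib, gaussian_eq_prod,
      ENNReal.ofReal_prod_of_nonneg fun i _ => (Real.exp_pos _).le]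
    rfl
  simp_rw [h]
  rw [lintegral_besselMeasure_prod hμ (fun i y => heatKernelOne (μ i) t (x i) y *
    ENNReal.ofReal (Real.exp (-a i * y ^ 2)))]
  · rw [heatGaussian, ENNReal.ofReal_prod_of_nonneg]
    · exact Finset.prod_congr rfl fun i _ =>
        lintegral_heatKernelOne_mul_gaussian (by linarith [hμ i]) ht (ha i) (x i)
    · intro i _
      have := ha i
      positivity
  · intro i
    refine Measurable.mul ?_ (by fun_prop)
    exact (measurable_heatKernelOne (μ i)).comp (f := fun y : ℝ => (t, x i, y)) (by fun_prop)

theorem lintegral_resolventKernel_mul_gaussian {n : ℕ} {μ : Fin n → ℝ}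
    (hμ : ∀ i, -1 / 2 < μ i) {a : Fin n → ℝ} (ha : ∀ i, 0 ≤ a i) (c : ℝ) (x : Fin n → ℝ) :
    ∫⁻ y, resolventKernel μ c x y * ENNReal.ofReal (gaussian a y) ∂(besselMeasure μ) =
      ∫⁻ t in Ioi (0 : ℝ), ENNReal.ofReal (Real.exp (-c * t) * heatGaussian μ a t x) := by
  have hm : Measurable fun p : (Fin n → ℝ) × ℝ =>
      ENNReal.ofReal (Real.exp (-c * p.2)) * heatKernel μ p.2 x p.1 *
        ENNReal.ofReal (gaussian a p.1) := by
    refine Measurable.mul (Measurable.mul (by fun_prop) ?_) (by fun_prop)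
    exact (measurable_heatKernel μ).comp
      (f := fun q : (Fin n → ℝ) × ℝ => (q.2, x, q.1)) (by fun_prop)
  have h1 : ∀ y, resolventKernel μ c x y * ENNReal.ofReal (gaussian a y) =
      ∫⁻ t in Ioi (0 : ℝ), ENNReal.ofReal (Real.exp (-c * t)) * heatKernel μ t x y *
        ENNReal.ofReal (gaussian a y) := fun y =>
    (lintegral_mul_const' _ _ ENNReal.ofReal_ne_top).symm
  simp_rw [h1]
  rw [lintegral_lintegral_swap hm.aemeasurable]
  refine setLIntegral_congr_fun measurableSet_Ioi fun t ht => ?_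
  simp only [mul_assoc]
  rw [lintegral_const_mul' _ _ ENNReal.ofReal_ne_top, lintegral_heatKernel_mul_gaussian hμ ha ht,
    ENNReal.ofReal_mul (Real.exp_pos _).le]

/-- The Gaussian with zero exponent is the constant `1`, which the heat flow fixes, so only `∫
e^{-ct} dt` remains. -/
theorem lintegral_resolventKernel {n : ℕ} {μ : Fin n → ℝ} (hμ : ∀ i, -1 / 2 < μ i) {c : ℝ}
    (hc : 0 < c) (x : Fin n → ℝ) :
    ∫⁻ y, resolventKernel μ c x y ∂(besselMeasure μ) = ENNReal.ofReal c⁻¹ := by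
  have h := lintegral_resolventKernel_mul_gaussian hμ (a := 0) (fun _ => le_rfl) c x
  simp only [gaussian, heatGaussian, Pi.zero_apply, zero_mul, Finset.sum_const_zero, neg_zero,
    Real.exp_zero, ENNReal.ofReal_one, mul_one, mul_zero, add_zero, Real.one_rpow, zero_div,
    Finset.prod_const_one] at h
  rw [h, ← ofReal_integral_eq_lintegral_ofReal]
  · rw [integral_exp_mul_Ioi (by linarith) 0]
    simp
  · exact integrableOn_exp_mul_Ioi (by linarith) 0
  · exact .of_forall fun t => (Real.exp_pos _).le


/-! ### Gaussians separate integrable functions -/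

section Uniqueness

open BoundedContinuousFunction

/-- The bounded continuous function `y ↦ exp (-yᵢ²)` on the closed orthant. -/
noncomputable def expNegSq {n : ℕ} (i : Fin n) : (Fin n → NNReal) →ᵇ ℝ :=
  BoundedContinuousFunction.ofNormedAddCommGroup (fun y => Real.exp (-(y i : ℝ) ^ 2))
    (by fun_prop) 1 fun y => by
      rw [Real.norm_of_nonneg (Real.exp_pos _).le, Real.exp_le_one_iff]
      simp

theorem expNegSq_apply {n : ℕ} (i : Fin n) (y : Fin n → NNReal) :
    expNegSq i y = Real.exp (-(y i : ℝ) ^ 2) := rfl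

/-- The algebra generated by the functions `exp (-yᵢ²)`. -/
noncomputable def gaussianAlgebra (n : ℕ) : StarSubalgebra ℝ ((Fin n → NNReal) →ᵇ ℝ) where
  toSubalgebra := (MvPolynomial.aeval (R := ℝ) (expNegSq (n := n))).range
  star_mem' := by
    intro f hf
    have : star f = f := by ext; simp
    rwa [this]

/-- Squaring is injective only on nonnegative numbers, hence the closed orthant `Fin n → NNReal`;
unlike the open orthant it is also complete in its usual metric, as the uniqueness theorem for
measures requires. -/
theorem gaussianAlgebra_separatesPoints (n : ℕ) :
    ((gaussianAlgebra n).map (toContinuousMapStarₐ ℝ)).SeparatesPoints := by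
  intro y z hyz
  obtain ⟨i, hi⟩ := Function.ne_iff.1 hyz
  refine ⟨expNegSq i, ?_, ?_⟩
  · simp only [StarSubalgebra.coe_toSubalgebra, StarSubalgebra.coe_map, Set.mem_image,
      SetLike.mem_coe, exists_exists_and_eq_and]
    exact ⟨expNegSq i, ⟨MvPolynomial.X i, MvPolynomial.aeval_X _ _⟩, rfl⟩
  · rw [expNegSq_apply, expNegSq_apply]
    intro h
    have h1 := Real.exp_injective h
    rw [neg_inj] at h1
    exact hi (NNReal.coe_injective ((sq_eq_sq₀ (y i).2 (z i).2).1 h1))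

/-- Truncation to the closed orthant. -/
noncomputable def toOrthant {n : ℕ} (x : Fin n → ℝ) (i : Fin n) : NNReal := (x i).toNNReal

theorem measurable_toOrthant {n : ℕ} : Measurable (toOrthant (n := n)) :=
  measurable_pi_lambda _ fun i => (measurable_pi_apply i).real_toNNReal

theorem ae_mem_orthant_besselMeasure {n : ℕ} (μ : Fin n → ℝ) :
    ∀ᵐ x ∂(besselMeasure μ), x ∈ orthant n :=
  (besselMeasure_absolutelyContinuous μ).ae_le (ae_mem_orthant n)

theorem measurable_gaussian {n : ℕ} (a : Fin n → ℝ) : Measurable (gaussian a) :=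
  (continuous_gaussian a).measurable

/-- The positive and negative parts of `w` are densities of two finite measures. Gaussians with
natural exponents are the monomials in `exp (-yᵢ²)`, so the two measures agree on a point-separating
algebra and coincide. -/
theorem ae_eq_zero_of_integral_mul_gaussian_nat {n : ℕ} {μ : Fin n → ℝ} {w : (Fin n → ℝ) → ℝ}
    (hw : Integrable w (besselMeasure μ))
    (h : ∀ k : Fin n → ℕ, ∫ x, w x * gaussian (fun i => (k i : ℝ)) x ∂(besselMeasure μ) = 0) :
    w =ᵐ[besselMeasure μ] 0 := by
  set m := besselMeasure μ
  let ρ : (((Fin n) → ℝ) → ℝ) → Measure (Fin n → ℝ) := fun v =>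
    m.withDensity fun x => ENNReal.ofReal (v x)
  have hfin : ∀ v, Integrable v m → IsFiniteMeasure (ρ v) := fun v hv =>
    isFiniteMeasure_withDensity_ofReal hv.2
  have hint : ∀ v, Integrable v m → ∀ g : (Fin n → ℝ) → ℝ,
      ∫ x, g x ∂(ρ v) = ∫ x, ((v x).toNNReal : ℝ) * g x ∂m := by
    intro v hv g
    rw [integral_withDensity_eq_integral_toReal_smul₀ hv.1.aemeasurable.ennreal_ofReal
      (.of_forall fun _ => ENNReal.ofReal_lt_top)]
    rfl
  -- Nothing is lost in passing to the closed orthant: `m` is carried by the open one, where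
  -- truncation is the identity.
  have hback : ∀ v, (Measure.map toOrthant (ρ v)).map (fun y i => ((y i : NNReal) : ℝ)) = ρ v := by
    intro v
    rw [Measure.map_map (by fun_prop) measurable_toOrthant]
    conv_rhs => rw [← Measure.map_id (μ := ρ v)]
    refine Measure.map_congr ?_
    filter_upwards [(withDensity_absolutelyContinuous m _).ae_le
      (ae_mem_orthant_besselMeasure μ)] with x hx
    funext i
    exact Real.coe_toNNReal _ (hx i).le
  have hF1 := hfin w hw
  have hF2 := hfin (fun x => -w x) hw.neg
  have hnw : Integrable (fun x => -w x) m := hw.neg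
  have hkey : Measure.map toOrthant (ρ w) = Measure.map toOrthant (ρ fun x => -w x) := by
    refine ext_of_forall_mem_subalgebra_integral_eq_of_pseudoEMetric_complete_countable
      (gaussianAlgebra_separatesPoints n) ?_
    rintro g ⟨p, rfl⟩
    have hI1 := Measure.isFiniteMeasure_map (ρ w) (toOrthant (n := n))
    have hI2 := Measure.isFiniteMeasure_map (ρ fun x => -w x) (toOrthant (n := n))
    change ∫ x, (MvPolynomial.aeval expNegSq p : (Fin n → NNReal) →ᵇ ℝ) x ∂_ =
      ∫ x, (MvPolynomial.aeval expNegSq p : (Fin n → NNReal) →ᵇ ℝ) x ∂_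
    induction p using MvPolynomial.induction_on' with
    | monomial k a =>
      have e : ∀ x ∈ orthant n,
          (MvPolynomial.aeval expNegSq (MvPolynomial.monomial k a) : (Fin n → NNReal) →ᵇ ℝ)
            (toOrthant x) = a * gaussian (fun i => (k i : ℝ)) x := by
        intro x hx
        rw [MvPolynomial.aeval_monomial, Finsupp.prod_fintype _ _ (fun i => pow_zero _),
          gaussian_eq_prod, ← Algebra.smul_def]
        change a • (∏ i, expNegSq i ^ k i : (Fin n → NNReal) →ᵇ ℝ) (toOrthant x) = _
        rw [smul_eq_mul]
        congr 1
        rw [BoundedContinuousFunction.coe_prod, Finset.prod_apply]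
        refine Finset.prod_congr rfl fun i _ => ?_
        have hxi : ((toOrthant x i : NNReal) : ℝ) = x i := Real.coe_toNNReal _ (hx i).le
        rw [BoundedContinuousFunction.pow_apply, expNegSq_apply, hxi, ← Real.exp_nat_mul]
        ring_nf
      have e2 : ∀ v : (Fin n → ℝ) → ℝ, Integrable v m →
          ∫ x, (MvPolynomial.aeval expNegSq (MvPolynomial.monomial k a) :
            (Fin n → NNReal) →ᵇ ℝ) x ∂(Measure.map toOrthant (ρ v)) =
          ∫ x, ((v x).toNNReal : ℝ) * (a * gaussian (fun i => (k i : ℝ)) x) ∂m := by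
        intro v hv
        rw [integral_map measurable_toOrthant.aemeasurable
          (BoundedContinuousFunction.continuous _).aestronglyMeasurable, hint v hv]
        refine integral_congr_ae ?_
        filter_upwards [ae_mem_orthant_besselMeasure μ] with x hx
        rw [e x hx]
      have e3 : ∀ v : (Fin n → ℝ) → ℝ, Integrable v m → Integrable (fun x => ((v x).toNNReal : ℝ) *
          (a * gaussian (fun i => (k i : ℝ)) x)) m := by
        intro v hv
        refine hv.real_toNNReal.mul_bdd (c := |a|)
          (by fun_prop) (.of_forall fun x => ?_)
        rw [norm_mul, Real.norm_of_nonneg (gaussian_pos _ x).le]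
        exact mul_le_of_le_one_right (abs_nonneg a)
          (gaussian_le_one (fun i => Nat.cast_nonneg _) x)
      rw [e2 w hw, e2 _ hnw, ← sub_eq_zero, ← integral_sub (e3 w hw) (e3 _ hnw),
        ← mul_zero a, ← h (fun i => k i), ← integral_const_mul]
      refine integral_congr_ae (.of_forall fun x => ?_)
      have e4 : ((w x).toNNReal : ℝ) - ((-w x).toNNReal : ℝ) = w x := by
        rw [Real.coe_toNNReal', Real.coe_toNNReal', max_zero_sub_eq_self]
      dsimp only
      linear_combination (a * gaussian (fun i => (k i : ℝ)) x) * e4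
    | add p q hp hq =>
      simp only [map_add, BoundedContinuousFunction.coe_add, Pi.add_apply]
      rw [integral_add, integral_add, hp, hq] <;> exact BoundedContinuousFunction.integrable _ _
  have h2 : ρ w = ρ fun x => -w x := by rw [← hback w, hkey, hback]
  -- Equal measures have almost everywhere equal densities. At each point one of the two parts of
  -- `w` vanishes, hence so does the other.
  have h3 := (withDensity_eq_iff hw.1.aemeasurable.ennreal_ofReal
    hw.neg.1.aemeasurable.ennreal_ofReal hw.lintegral_lt_top.ne).1 h2
  filter_upwards [h3] with x hx
  have hx' : ENNReal.ofReal (w x) = ENNReal.ofReal (-w x) := hx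
  rcases le_total (w x) 0 with h0 | h0
  · rw [ENNReal.ofReal_of_nonpos h0, eq_comm, ENNReal.ofReal_eq_zero] at hx'
    simp only [Pi.zero_apply]
    linarith
  · rw [ENNReal.ofReal_of_nonpos (neg_nonpos.2 h0), ENNReal.ofReal_eq_zero] at hx'
    simp only [Pi.zero_apply]
    linarith

theorem gaussian_add {n : ℕ} (a b y : Fin n → ℝ) :
    gaussian (fun i => a i + b i) y = gaussian a y * gaussian b y := by
  simp only [gaussian, ← Real.exp_add, add_mul, Finset.sum_add_distrib, neg_add]

theorem integrable_mul_gaussian {n : ℕ} {m : Measure (Fin n → ℝ)} {w : (Fin n → ℝ) → ℂ}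
    (hw : Integrable w m) {a : Fin n → ℝ} (ha : ∀ i, 0 ≤ a i) :
    Integrable (fun x => w x * (gaussian a x : ℂ)) m := by
  refine hw.mul_bdd (c := 1) ?_ (.of_forall fun x => ?_)
  · exact (Complex.continuous_ofReal.comp (continuous_gaussian a)).aestronglyMeasurable
  · rw [Complex.norm_real, Real.norm_of_nonneg (gaussian_pos a x).le]
    exact gaussian_le_one ha x

/-- Test functions must decay in every variable, so only strictly positive exponents are available.
Replacing `w` by `w` times the Gaussian with exponents `1` shifts them to `1 + k` and reduces to
natural exponents, zero included. -/
theorem ae_eq_zero_of_integral_mul_gaussian {n : ℕ} {μ : Fin n → ℝ} {w : (Fin n → ℝ) → ℂ}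
    (hw : Integrable w (besselMeasure μ))
    (h : ∀ a : Fin n → ℝ, (∀ i, 0 < a i) → ∫ x, w x * (gaussian a x : ℂ) ∂(besselMeasure μ) = 0) :
    w =ᵐ[besselMeasure μ] 0 := by
  have hg := integrable_mul_gaussian hw (a := fun _ => 1) (fun _ => zero_le_one)
  have hk : ∀ k : Fin n → ℕ, ∫ x, w x * (gaussian (fun _ => 1) x : ℂ) *
      (gaussian (fun i => (k i : ℝ)) x : ℂ) ∂(besselMeasure μ) = 0 := by
    intro k
    rw [← h (fun i => 1 + k i) (fun i => by positivity)]
    refine integral_congr_ae (.of_forall fun x => ?_)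
    simp only [gaussian_add, Complex.ofReal_mul, mul_assoc]
  have hki : ∀ k : Fin n → ℕ, Integrable (fun x => w x * (gaussian (fun _ => 1) x : ℂ) *
      (gaussian (fun i => (k i : ℝ)) x : ℂ)) (besselMeasure μ) := fun k =>
    integrable_mul_gaussian hg fun i => Nat.cast_nonneg _
  have hre := ae_eq_zero_of_integral_mul_gaussian_nat (μ := μ) hg.re fun k => by
    have h1 := integral_re (hki k)
    rw [hk k] at h1
    simpa using h1
  have him := ae_eq_zero_of_integral_mul_gaussian_nat (μ := μ) hg.im fun k => by
    have h1 := integral_im (hki k)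
    rw [hk k] at h1
    simpa using h1
  filter_upwards [hre, him] with x h1 h2
  have h3 : w x * (gaussian (fun _ => 1) x : ℂ) = 0 := Complex.ext h1 h2
  exact (mul_eq_zero.1 h3).resolve_right (by exact_mod_cast (gaussian_pos _ x).ne')

end Uniqueness

/-! ### The resolvent identity -/

/-- The Bessel operator, in the form `∑ᵢ (∂ᵢ² + (2μᵢ + 1) yᵢ⁻¹ ∂ᵢ)`, applied to `gaussian b`. -/
noncomputable def gaussianLaplacian {n : ℕ} (μ b y : Fin n → ℝ) : ℝ :=
  (∑ i, (4 * b i ^ 2 * y i ^ 2 - 4 * b i * (μ i + 1))) * gaussian b y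

/-- The mass factor of the heat flow of a Gaussian. -/
noncomputable def heatFactor {n : ℕ} (μ a : Fin n → ℝ) (t : ℝ) : ℝ :=
  ∏ i, (1 + 4 * a i * t) ^ (-(μ i + 1))

theorem heatGaussian_eq {n : ℕ} (μ a : Fin n → ℝ) (t : ℝ) (y : Fin n → ℝ) :
    heatGaussian μ a t y = heatFactor μ a t * gaussian (fun i => a i / (1 + 4 * a i * t)) y := by
  rw [heatGaussian, heatFactor, gaussian_eq_prod, ← Finset.prod_mul_distrib]
  refine Finset.prod_congr rfl fun i _ => ?_
  congr 2
  ring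

theorem heatGaussian_zero {n : ℕ} (μ a y : Fin n → ℝ) : heatGaussian μ a 0 y = gaussian a y := by
  simp [heatGaussian, gaussian_eq_prod]

theorem heatFactor_nonneg {n : ℕ} (μ : Fin n → ℝ) {a : Fin n → ℝ} (ha : ∀ i, 0 ≤ a i) {t : ℝ}
    (ht : 0 ≤ t) : 0 ≤ heatFactor μ a t :=
  Finset.prod_nonneg fun i _ => by
    have := ha i
    positivity

theorem heatFactor_le_one {n : ℕ} {μ : Fin n → ℝ} (hμ : ∀ i, -1 / 2 < μ i) {a : Fin n → ℝ}
    (ha : ∀ i, 0 ≤ a i) {t : ℝ} (ht : 0 ≤ t) : heatFactor μ a t ≤ 1 := by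
  refine Finset.prod_le_one (fun i _ => ?_) fun i _ => ?_
  · have := ha i
    positivity
  · have h1 : 0 ≤ 4 * a i * t := mul_nonneg (mul_nonneg (by norm_num) (ha i)) ht
    exact Real.rpow_le_one_of_one_le_of_nonpos (by linarith) (by linarith [hμ i])

theorem abs_gaussianLaplacian_le {n : ℕ} {μ : Fin n → ℝ} (hμ : ∀ i, -1 / 2 < μ i)
    {b : Fin n → ℝ} (hb : ∀ i, 0 ≤ b i) (y : Fin n → ℝ) :
    |gaussianLaplacian μ b y| ≤ ∑ i, (4 * b i + 4 * b i * (μ i + 1)) := by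
  rw [gaussianLaplacian, Finset.sum_mul]
  refine (Finset.abs_sum_le_sum_abs _ _).trans (Finset.sum_le_sum fun i _ => ?_)
  have hg := gaussian_pos b y
  have hg1 := gaussian_le_one hb y
  -- This is `s e^{-s} ≤ 1` for the full exponent `s`, from `1 + s ≤ e^s`.
  have h1 : b i * y i ^ 2 * gaussian b y ≤ 1 := by
    have h2 : b i * y i ^ 2 ≤ ∑ j, b j * y j ^ 2 :=
      Finset.single_le_sum (f := fun j => b j * y j ^ 2)
        (fun j _ => mul_nonneg (hb j) (sq_nonneg _)) (Finset.mem_univ i)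
    have h3 := Real.add_one_le_exp (∑ j, b j * y j ^ 2)
    have h4 : Real.exp (∑ j, b j * y j ^ 2) * gaussian b y = 1 := by
      rw [gaussian, ← Real.exp_add, add_neg_cancel, Real.exp_zero]
    rw [← h4]
    gcongr
    linarith
  have h5 : 0 ≤ b i * y i ^ 2 * gaussian b y :=
    mul_nonneg (mul_nonneg (hb i) (sq_nonneg _)) hg.le
  have h6 : 0 ≤ b i * (μ i + 1) := mul_nonneg (hb i) (by linarith [hμ i])
  have h7 : (4 * b i ^ 2 * y i ^ 2 - 4 * b i * (μ i + 1)) * gaussian b y =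
      4 * b i * (b i * y i ^ 2 * gaussian b y) - 4 * (b i * (μ i + 1)) * gaussian b y := by ring
  have h8 : 4 * b i * (b i * y i ^ 2 * gaussian b y) ≤ 4 * b i * 1 := by
    have := hb i
    gcongr
  have h9 : 4 * (b i * (μ i + 1)) * gaussian b y ≤ 4 * (b i * (μ i + 1)) * 1 := by gcongr
  have h10 : 0 ≤ 4 * b i * (b i * y i ^ 2 * gaussian b y) := by have := hb i; positivity
  have h11 : 0 ≤ 4 * (b i * (μ i + 1)) * gaussian b y := by positivity
  rw [h7, abs_le]
  constructor <;> linarith [hb i]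

theorem integrable_mul_gaussianLaplacian {n : ℕ} {μ : Fin n → ℝ} {m : Measure (Fin n → ℝ)}
    (hμ : ∀ i, -1 / 2 < μ i) {u : (Fin n → ℝ) → ℂ} (hu : Integrable u m) {b : Fin n → ℝ}
    (hb : ∀ i, 0 ≤ b i) :
    Integrable (fun y => u y * (gaussianLaplacian μ b y : ℂ)) m := by
  refine hu.mul_bdd (c := ∑ i, (4 * b i + 4 * b i * (μ i + 1))) ?_ (.of_forall fun y => ?_)
  · have : Continuous (gaussianLaplacian μ b) := by
      unfold gaussianLaplacian
      fun_prop
    exact (Complex.continuous_ofReal.comp this).aestronglyMeasurable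
  · rw [Complex.norm_real]
    exact abs_gaussianLaplacian_le hμ hb y

/-- The heat equation. Each one-dimensional factor has logarithmic derivative `4 bᵢ² yᵢ² - 4 bᵢ (μᵢ
+ 1)` with `bᵢ = aᵢ / (1 + 4 aᵢ t)`, and these add up over the product. -/
theorem hasDerivAt_heatGaussian {n : ℕ} (μ : Fin n → ℝ) {a : Fin n → ℝ} (ha : ∀ i, 0 ≤ a i)
    {t : ℝ} (ht : 0 ≤ t) (y : Fin n → ℝ) :
    HasDerivAt (fun t => heatGaussian μ a t y)
      (heatFactor μ a t * gaussianLaplacian μ (fun i => a i / (1 + 4 * a i * t)) y) t := by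
  have hE : ∀ i, 0 < 1 + 4 * a i * t := fun i => by have := ha i; positivity
  have h1 : ∀ i, HasDerivAt (fun t => (1 + 4 * a i * t) ^ (-(μ i + 1)) *
      Real.exp (-a i * y i ^ 2 / (1 + 4 * a i * t)))
      ((4 * (a i / (1 + 4 * a i * t)) ^ 2 * y i ^ 2 -
        4 * (a i / (1 + 4 * a i * t)) * (μ i + 1)) * ((1 + 4 * a i * t) ^ (-(μ i + 1)) *
      Real.exp (-a i * y i ^ 2 / (1 + 4 * a i * t)))) t := by
    intro i
    have hl : HasDerivAt (fun t => 1 + 4 * a i * t) (4 * a i) t := by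
      simpa using ((hasDerivAt_id t).const_mul (4 * a i)).const_add 1
    have hp := hl.rpow_const (p := -(μ i + 1)) (.inl (hE i).ne')
    have he := ((hasDerivAt_const t (-a i * y i ^ 2)).div hl (hE i).ne').exp
    refine (hp.mul he).congr_deriv ?_
    simp only [Pi.div_apply]
    rw [Real.rpow_sub_one (hE i).ne']
    have := (hE i).ne'
    field_simp
    ring
  have h2 := HasDerivAt.fun_finsetProd (u := Finset.univ) fun i _ => h1 i
  refine h2.congr_deriv ?_
  rw [gaussianLaplacian, mul_left_comm, ← heatGaussian_eq, Finset.sum_mul]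
  refine Finset.sum_congr rfl fun i _ => ?_
  rw [heatGaussian, ← Finset.mul_prod_erase _ _ (Finset.mem_univ i), smul_eq_mul]
  ring

theorem heatGaussian_nonneg {n : ℕ} (μ : Fin n → ℝ) {a : Fin n → ℝ} (ha : ∀ i, 0 ≤ a i) {t : ℝ}
    (ht : 0 ≤ t) (y : Fin n → ℝ) : 0 ≤ heatGaussian μ a t y := by
  rw [heatGaussian_eq]
  exact mul_nonneg (heatFactor_nonneg μ ha ht) (gaussian_pos _ _).le

theorem heatGaussian_le_one {n : ℕ} {μ : Fin n → ℝ} (hμ : ∀ i, -1 / 2 < μ i) {a : Fin n → ℝ}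
    (ha : ∀ i, 0 ≤ a i) {t : ℝ} (ht : 0 ≤ t) (y : Fin n → ℝ) : heatGaussian μ a t y ≤ 1 := by
  rw [heatGaussian_eq]
  refine mul_le_one₀ (heatFactor_le_one hμ ha ht) (gaussian_pos _ _).le (gaussian_le_one ?_ y)
  intro i
  have := ha i
  positivity

theorem abs_heatFactor_mul_gaussianLaplacian_le {n : ℕ} {μ : Fin n → ℝ}
    (hμ : ∀ i, -1 / 2 < μ i) {a : Fin n → ℝ} (ha : ∀ i, 0 ≤ a i) {t : ℝ} (ht : 0 ≤ t)
    (y : Fin n → ℝ) :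
    |heatFactor μ a t * gaussianLaplacian μ (fun i => a i / (1 + 4 * a i * t)) y| ≤
      ∑ i, (4 * a i + 4 * a i * (μ i + 1)) := by
  have hb : ∀ i, 0 ≤ a i / (1 + 4 * a i * t) := fun i => by have := ha i; positivity
  have hba : ∀ i, a i / (1 + 4 * a i * t) ≤ a i := fun i =>
    div_le_self (ha i) (by have := ha i; have : 0 ≤ 4 * a i * t := (by positivity); linarith)
  rw [abs_mul, abs_of_nonneg (heatFactor_nonneg μ ha ht)]
  refine (mul_le_of_le_one_left (abs_nonneg _) (heatFactor_le_one hμ ha ht)).trans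
    ((abs_gaussianLaplacian_le hμ hb y).trans (Finset.sum_le_sum fun i _ => ?_))
  have h1 : 0 ≤ μ i + 1 := by linarith [hμ i]
  have := hba i
  gcongr

theorem measurable_heatGaussian {n : ℕ} (μ a : Fin n → ℝ) :
    Measurable fun p : (Fin n → ℝ) × ℝ => heatGaussian μ a p.2 p.1 := by
  unfold heatGaussian
  fun_prop

theorem measurable_heatFactor_mul_gaussianLaplacian {n : ℕ} (μ a : Fin n → ℝ) :
    Measurable fun p : (Fin n → ℝ) × ℝ =>
      heatFactor μ a p.2 * gaussianLaplacian μ (fun i => a i / (1 + 4 * a i * p.2)) p.1 := by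
  unfold heatFactor gaussianLaplacian gaussian
  fun_prop

/-- Supplies the hypothesis of Fubini in `(y, t)`: `|w(y)| C e^{-ct}` is an integrable majorant. -/
theorem integrable_mul_laplace {n : ℕ} {m : Measure (Fin n → ℝ)} [SFinite m]
    {w : (Fin n → ℝ) → ℂ} (hw : Integrable w m) {c : ℝ} (hc : 0 < c)
    {k : (Fin n → ℝ) → ℝ → ℝ} (hk : Measurable fun p : (Fin n → ℝ) × ℝ => k p.1 p.2) {C : ℝ}
    (hC : ∀ y, ∀ t > 0, |k y t| ≤ C) :
    Integrable (fun p : (Fin n → ℝ) × ℝ => w p.1 * ((Real.exp (-c * p.2) * k p.1 p.2 : ℝ) : ℂ))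
      (m.prod (volume.restrict (Ioi 0))) := by
  have he : Integrable (fun t : ℝ => Real.exp (-c * t) * C) (volume.restrict (Ioi 0)) :=
    (integrableOn_exp_mul_Ioi (by linarith) 0).mul_const C
  refine (hw.norm.mul_prod he).mono' ?_ ?_
  · refine hw.1.comp_fst.mul ?_
    exact (Complex.measurable_ofReal.comp (by fun_prop)).aestronglyMeasurable
  · have h1 : ∀ᵐ p ∂(m.prod ((volume : Measure ℝ).restrict (Ioi 0))), p.2 ∈ Ioi (0 : ℝ) :=
      Measure.quasiMeasurePreserving_snd.ae (ae_restrict_mem measurableSet_Ioi)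
    filter_upwards [h1] with p hp
    rw [norm_mul, Complex.norm_real, norm_mul, Real.norm_of_nonneg (Real.exp_pos _).le]
    gcongr
    exact hC p.1 p.2 hp

/-- By the heat equation the integrand is the `t`-derivative of `-e^{-ct}` times the heat flow,
which tends to `0` at infinity and equals `-gaussian a y` at `t = 0`. -/
theorem integral_laplace_heatGaussian {n : ℕ} {μ : Fin n → ℝ} (hμ : ∀ i, -1 / 2 < μ i)
    {a : Fin n → ℝ} (ha : ∀ i, 0 ≤ a i) {c : ℝ} (hc : 0 < c) (y : Fin n → ℝ) :
    ∫ t in Ioi (0 : ℝ), Real.exp (-c * t) * (c * heatGaussian μ a t y -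
      heatFactor μ a t * gaussianLaplacian μ (fun i => a i / (1 + 4 * a i * t)) y) =
      gaussian a y := by
  have hexp : ∀ t : ℝ, HasDerivAt (fun t => Real.exp (-c * t)) (Real.exp (-c * t) * -c) t :=
    fun t => by simpa using ((hasDerivAt_id t).const_mul (-c)).exp
  have hd : ∀ t ∈ Ici (0 : ℝ), HasDerivAt (fun t => -(Real.exp (-c * t) * heatGaussian μ a t y))
      (Real.exp (-c * t) * (c * heatGaussian μ a t y -
      heatFactor μ a t * gaussianLaplacian μ (fun i => a i / (1 + 4 * a i * t)) y)) t := by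
    intro t ht
    refine ((hexp t).mul (hasDerivAt_heatGaussian μ ha ht y)).neg.congr_deriv ?_
    ring
  have hint : IntegrableOn (fun t => Real.exp (-c * t) * (c * heatGaussian μ a t y -
      heatFactor μ a t * gaussianLaplacian μ (fun i => a i / (1 + 4 * a i * t)) y)) (Ioi 0) := by
    refine (integrableOn_exp_mul_Ioi (show -c < 0 by linarith) 0).mul_bdd
      (c := c + ∑ i, (4 * a i + 4 * a i * (μ i + 1))) ?_ ?_
    · have h1 := (measurable_heatGaussian μ a).comp
        (f := fun t : ℝ => (y, t)) (by fun_prop)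
      have h2 := (measurable_heatFactor_mul_gaussianLaplacian μ a).comp
        (f := fun t : ℝ => (y, t)) (by fun_prop)
      exact ((h1.const_mul c).sub h2).aestronglyMeasurable
    · filter_upwards [ae_restrict_mem measurableSet_Ioi] with t ht
      have ht' : (0 : ℝ) ≤ t := le_of_lt ht
      refine (norm_sub_le _ _).trans (add_le_add ?_
        (abs_heatFactor_mul_gaussianLaplacian_le hμ ha ht' y))
      rw [norm_mul, Real.norm_of_nonneg hc.le, Real.norm_of_nonneg (heatGaussian_nonneg μ ha ht' y)]
      exact mul_le_of_le_one_right hc.le (heatGaussian_le_one hμ ha ht' y)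
  have hlim : Filter.Tendsto (fun t => -(Real.exp (-c * t) * heatGaussian μ a t y)) Filter.atTop
      (nhds 0) := by
    have h0 : Filter.Tendsto (fun t : ℝ => Real.exp (-c * t)) Filter.atTop (nhds 0) := by
      refine Real.tendsto_exp_atBot.comp ?_
      exact Filter.tendsto_id.const_mul_atTop_of_neg (by linarith)
    rw [← neg_zero]
    refine Filter.Tendsto.neg (squeeze_zero' ?_ ?_ h0)
    · filter_upwards [Filter.eventually_ge_atTop 0] with t ht
      exact mul_nonneg (Real.exp_pos _).le (heatGaussian_nonneg μ ha ht y)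
    · filter_upwards [Filter.eventually_ge_atTop 0] with t ht
      exact mul_le_of_le_one_right (Real.exp_pos _).le (heatGaussian_le_one hμ ha ht y)
  rw [integral_Ioi_of_hasDerivAt_of_tendsto' hd hint hlim]
  simp [heatGaussian_zero]

/-- Carries the `ℝ≥0∞` computation over to Bochner integrals. The kernel is finite almost everywhere
because its mass is finite, so `toReal` does no harm. -/
theorem kernelOp_gaussian {n : ℕ} {μ : Fin n → ℝ} (hμ : ∀ i, -1 / 2 < μ i)
    {a : Fin n → ℝ} (ha : ∀ i, 0 ≤ a i) {c : ℝ} (hc : 0 < c) (y : Fin n → ℝ) :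
    kernelOp (besselMeasure μ) (resolventKernel μ c) (fun x => (gaussian a x : ℂ)) y =
      ∫ t in Ioi (0 : ℝ), ((Real.exp (-c * t) * heatGaussian μ a t y : ℝ) : ℂ) := by
  have hm : Measurable (resolventKernel μ c y) :=
    (measurable_resolventKernel μ c).of_uncurry_left
  have h1 : ∀ x, (resolventKernel μ c y x).toReal • (gaussian a x : ℂ) =
      (((resolventKernel μ c y x).toReal * gaussian a x : ℝ) : ℂ) := fun x => by
    rw [Complex.real_smul, Complex.ofReal_mul]
  simp only [kernelOp, h1]
  rw [integral_complex_ofReal, integral_complex_ofReal]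
  congr 1
  rw [integral_eq_lintegral_of_nonneg_ae, integral_eq_lintegral_of_nonneg_ae,
    ← lintegral_resolventKernel_mul_gaussian hμ ha c y]
  · congr 1
    have hfin := ae_lt_top (μ := besselMeasure μ) hm
      (by rw [lintegral_resolventKernel hμ hc]; exact ENNReal.ofReal_ne_top)
    refine lintegral_congr_ae (hfin.mono fun x hx => ?_)
    dsimp only
    rw [ENNReal.ofReal_mul ENNReal.toReal_nonneg, ENNReal.ofReal_toReal hx.ne]
  · filter_upwards [ae_restrict_mem measurableSet_Ioi] with t ht
    exact mul_nonneg (Real.exp_pos _).le (heatGaussian_nonneg μ ha (le_of_lt ht) y)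
  · have h2 := (measurable_heatGaussian μ a).comp (f := fun t : ℝ => (y, t)) (by fun_prop)
    exact (Measurable.mul (by fun_prop) h2).aestronglyMeasurable
  · exact .of_forall fun x => mul_nonneg ENNReal.toReal_nonneg (gaussian_pos _ _).le
  · exact (hm.ennreal_toReal.mul (measurable_gaussian a)).aestronglyMeasurable

/-- If `v` is the image of `u` under the Bessel operator, tested against Gaussians, then
`u = (c - S)⁻¹ (c u - v)`. -/
theorem kernelOp_resolventKernel_ae_eq {n : ℕ} {μ : Fin n → ℝ} (hμ : ∀ i, -1 / 2 < μ i) {c : ℝ}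
    (hc : 0 < c) {u v : (Fin n → ℝ) → ℂ} (hu : Integrable u (besselMeasure μ))
    (hv : Integrable v (besselMeasure μ))
    (h : ∀ b : Fin n → ℝ, (∀ i, 0 < b i) → ∫ y, v y * (gaussian b y : ℂ) ∂(besselMeasure μ) =
      ∫ y, u y * (gaussianLaplacian μ b y : ℂ) ∂(besselMeasure μ)) :
    kernelOp (besselMeasure μ) (resolventKernel μ c) (fun y => (c : ℂ) * u y - v y)
      =ᵐ[besselMeasure μ] u := by
  set m := besselMeasure μ
  have hK := measurable_resolventKernel μ c
  have hs := resolventKernel_symm μ c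
  have hM : ∀ x, ∫⁻ y, resolventKernel μ c x y ∂m ≤ ENNReal.ofReal c⁻¹ := fun x =>
    (lintegral_resolventKernel hμ hc x).le
  have hw : Integrable (fun y => (c : ℂ) * u y - v y) m := (hu.const_mul _).sub hv
  have hR := integrable_kernelOp hK hs hM ENNReal.ofReal_ne_top hw
  -- It suffices to pair both sides with a Gaussian; by symmetry the kernel then acts on the
  -- Gaussian, where it is explicit.
  have key := ae_eq_zero_of_integral_mul_gaussian (hR.sub hu) fun a ha => ?_
  · filter_upwards [key] with x hx
    exact sub_eq_zero.1 hx
  have ha0 : ∀ i, 0 ≤ a i := fun i => (ha i).le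
  simp only [Pi.sub_apply, sub_mul]
  rw [integral_sub (integrable_mul_gaussian hR ha0) (integrable_mul_gaussian hu ha0), sub_eq_zero,
    integral_kernelOp_mul hK hs hM ENNReal.ofReal_ne_top hw (h := fun x => (gaussian a x : ℂ))
      (Complex.continuous_ofReal.comp (continuous_gaussian a)).aestronglyMeasurable
      ENNReal.one_ne_top (.of_forall fun x => ?_)]
  · have i1 := integrable_mul_laplace hw hc (k := fun y t => heatGaussian μ a t y)
      (measurable_heatGaussian μ a) (C := 1) fun y t ht => by
        rw [abs_of_nonneg (heatGaussian_nonneg μ ha0 (le_of_lt ht) y)]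
        exact heatGaussian_le_one hμ ha0 (le_of_lt ht) y
    have i2 := integrable_mul_laplace hu hc (k := fun y t => c * heatGaussian μ a t y -
        heatFactor μ a t * gaussianLaplacian μ (fun i => a i / (1 + 4 * a i * t)) y)
      (((measurable_heatGaussian μ a).const_mul c).sub
        (measurable_heatFactor_mul_gaussianLaplacian μ a))
      (C := c + ∑ i, (4 * a i + 4 * a i * (μ i + 1))) fun y t ht => by
        refine (abs_sub _ _).trans (add_le_add ?_
          (abs_heatFactor_mul_gaussianLaplacian_le hμ ha0 (le_of_lt ht) y))
        rw [abs_mul, abs_of_nonneg hc.le, abs_of_nonneg (heatGaussian_nonneg μ ha0 (le_of_lt ht) y)]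
        exact mul_le_of_le_one_right hc.le (heatGaussian_le_one hμ ha0 (le_of_lt ht) y)
    -- Exchange `y` and `t`. For fixed `t` the flowed Gaussian is a multiple of a Gaussian with
    -- positive exponents, so `h` trades `v` for `u` against its Laplacian. After exchanging back,
    -- the integral in `t` collapses to `gaussian a y`.
    calc ∫ y, ((c : ℂ) * u y - v y) * kernelOp m (resolventKernel μ c)
          (fun x => (gaussian a x : ℂ)) y ∂m
        = ∫ y, (∫ t in Ioi (0 : ℝ), ((c : ℂ) * u y - v y) *
            ((Real.exp (-c * t) * heatGaussian μ a t y : ℝ) : ℂ)) ∂m := by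
          refine integral_congr_ae (.of_forall fun y => ?_)
          dsimp only
          rw [kernelOp_gaussian hμ ha0 hc, integral_const_mul]
      _ = ∫ t in Ioi (0 : ℝ), ∫ y, ((c : ℂ) * u y - v y) *
            ((Real.exp (-c * t) * heatGaussian μ a t y : ℝ) : ℂ) ∂m := integral_integral_swap i1
      _ = ∫ t in Ioi (0 : ℝ), ∫ y, u y * ((Real.exp (-c * t) * (c * heatGaussian μ a t y -
            heatFactor μ a t * gaussianLaplacian μ (fun i => a i / (1 + 4 * a i * t)) y) : ℝ) : ℂ)
            ∂m := by
          refine setIntegral_congr_fun measurableSet_Ioi fun t ht => ?_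
          have hb : ∀ i, 0 < a i / (1 + 4 * a i * t) := fun i => by
            have := ha i
            have : (0 : ℝ) < t := ht
            positivity
          have hb0 : ∀ i, 0 ≤ a i / (1 + 4 * a i * t) := fun i => (hb i).le
          have hbt := h _ hb
          set b : Fin n → ℝ := fun i => a i / (1 + 4 * a i * t)
          have j1 := integrable_mul_gaussian hu hb0
          have j2 := integrable_mul_gaussian hv hb0
          have j3 := integrable_mul_gaussianLaplacian hμ hu hb0
          set e : ℂ := (Real.exp (-c * t) : ℂ) * (heatFactor μ a t : ℂ) with he
          calc ∫ y, ((c : ℂ) * u y - v y) * ((Real.exp (-c * t) * heatGaussian μ a t y : ℝ) : ℂ) ∂m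
              = ∫ y, e * c * (u y * (gaussian b y : ℂ)) - e * (v y * (gaussian b y : ℂ)) ∂m := by
                refine integral_congr_ae (.of_forall fun y => ?_)
                simp only [heatGaussian_eq, Complex.ofReal_mul, he]
                ring
            _ = e * c * ∫ y, u y * (gaussian b y : ℂ) ∂m -
                e * ∫ y, u y * (gaussianLaplacian μ b y : ℂ) ∂m := by
                rw [integral_sub (j1.const_mul _) (j2.const_mul _), integral_const_mul,
                  integral_const_mul, hbt]
            _ = ∫ y, e * c * (u y * (gaussian b y : ℂ)) -
                e * (u y * (gaussianLaplacian μ b y : ℂ)) ∂m := by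
                rw [integral_sub (j1.const_mul _) (j3.const_mul _), integral_const_mul,
                  integral_const_mul]
            _ = _ := by
                refine integral_congr_ae (.of_forall fun y => ?_)
                simp only [heatGaussian_eq, Complex.ofReal_mul, Complex.ofReal_sub, he]
                ring
      _ = ∫ y, (∫ t in Ioi (0 : ℝ), u y * ((Real.exp (-c * t) * (c * heatGaussian μ a t y -
            heatFactor μ a t * gaussianLaplacian μ (fun i => a i / (1 + 4 * a i * t)) y) : ℝ) :
            ℂ)) ∂m := (integral_integral_swap i2).symm
      _ = ∫ y, u y * (gaussian a y : ℂ) ∂m := by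
          refine integral_congr_ae (.of_forall fun y => ?_)
          dsimp only
          rw [integral_const_mul, integral_complex_ofReal, integral_laplace_heatGaussian hμ ha0 hc]
  · rw [← enorm_one (G := ℝ), enorm_le_iff_norm_le, Complex.norm_real, norm_one,
      Real.norm_of_nonneg (gaussian_pos a x).le]
    exact gaussian_le_one ha0 x


/-! ### Gaussians as test functions -/

theorem opT_congr {n : ℕ} (j : Fin n) {f g : (Fin n → ℝ) → ℂ} (h : EqOn f g (orthant n)) :
    EqOn (opT j f) (opT j g) (orthant n) := fun x hx => by
  simp only [opT, pderiv_congr j h hx]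

theorem contDiffOn_opT {n : ℕ} (i : Fin n) {f : (Fin n → ℝ) → ℂ}
    (h : ContDiffOn ℝ ∞ f (orthant n)) : ContDiffOn ℝ ∞ (opT i f) (orthant n) := by
  refine ContDiffOn.smul (f := fun x : Fin n → ℝ => (x i)⁻¹) ?_ (contDiffOn_pderiv i h)
  exact (contDiff_apply ℝ ℝ i).contDiffOn.inv fun x hx => (hx i).ne'

theorem pderiv_eq_smul_opT {n : ℕ} (i : Fin n) (f : (Fin n → ℝ) → ℂ) {x : Fin n → ℝ}
    (hx : x ∈ orthant n) : pderiv i f x = x i • opT i f x := by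
  rw [opT, smul_inv_smul₀ (hx i).ne']

theorem contDiff_gaussian {n : ℕ} (b : Fin n → ℝ) :
    ContDiff ℝ ∞ fun x => (gaussian b x : ℂ) := by
  have h : ContDiff ℝ ∞ (gaussian b) := by
    unfold gaussian
    fun_prop
  exact Complex.ofRealCLM.contDiff.comp h

theorem pderiv_gaussian {n : ℕ} (b : Fin n → ℝ) (j : Fin n) (x : Fin n → ℝ) :
    pderiv j (fun x => (gaussian b x : ℂ)) x = (-2 * b j * x j) • (gaussian b x : ℂ) := by
  have h1 : HasFDerivAt (fun y : Fin n → ℝ => -∑ i, b i * y i ^ 2)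
      (-∑ i, b i • ((2 * x i) • ContinuousLinearMap.proj (R := ℝ) (φ := fun _ : Fin n => ℝ) i))
      x := by
    refine (HasFDerivAt.fun_sum fun i _ => ?_).neg
    refine HasFDerivAt.const_mul ?_ _
    simpa using ((ContinuousLinearMap.proj (R := ℝ) (φ := fun _ : Fin n => ℝ) i).hasFDerivAt
      (x := x)).pow 2
  have h2 := Complex.ofRealCLM.hasFDerivAt.comp x h1.exp
  have h3 : fderiv ℝ (fun x => (gaussian b x : ℂ)) x = _ := h2.fderiv
  rw [pderiv, h3]
  simp [Pi.single_apply, gaussian]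
  ring

theorem pderiv_const_mul {n : ℕ} (c : ℂ) (j : Fin n) {f : (Fin n → ℝ) → ℂ} {x : Fin n → ℝ}
    (hf : DifferentiableAt ℝ f x) : pderiv j (fun x => c * f x) x = c * pderiv j f x := by
  rw [pderiv, fderiv_const_mul hf]
  rfl

/-- Differentiation produces a factor `x_j`, which `x_j⁻¹` cancels: Gaussians are eigenfunctions of
every `T_j`, so the seminorms of `H_μ` only require bounds on polynomials times Gaussians. -/
theorem opT_const_mul_gaussian {n : ℕ} (b : Fin n → ℝ) (c : ℂ) (j : Fin n) :
    EqOn (opT j fun x => c * (gaussian b x : ℂ)) (fun x => c * (-2 * b j) * (gaussian b x : ℂ))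
      (orthant n) := by
  intro x hx
  have hxj : (x j : ℂ) ≠ 0 := by exact_mod_cast (hx j).ne'
  rw [opT, pderiv_const_mul _ _ ((contDiff_gaussian b).differentiable (by simp) x),
    pderiv_gaussian]
  simp only [Complex.real_smul]
  push_cast
  field_simp

theorem opTPow_eqOn_gaussian {n : ℕ} (b : Fin n → ℝ) (k : Fin n → ℕ) {f : (Fin n → ℝ) → ℂ}
    (hf : EqOn f (fun x => (gaussian b x : ℂ)) (orthant n)) :
    ∃ c : ℂ, EqOn (opTPow k f) (fun x => c * (gaussian b x : ℂ)) (orthant n) := by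
  have h1 : ∀ (j : Fin n) (m : ℕ) (g : (Fin n → ℝ) → ℂ),
      (∃ c : ℂ, EqOn g (fun x => c * (gaussian b x : ℂ)) (orthant n)) →
      ∃ c : ℂ, EqOn ((opT j)^[m] g) (fun x => c * (gaussian b x : ℂ)) (orthant n) := by
    intro j m
    induction m with
    | zero => exact fun g hg => hg
    | succ m ih =>
      rintro g ⟨c, hc⟩
      exact ih _ ⟨_, (opT_congr j hc).trans (opT_const_mul_gaussian b c j)⟩
  have h2 : ∀ (l : List (Fin n)) (g : (Fin n → ℝ) → ℂ),
      (∃ c : ℂ, EqOn g (fun x => c * (gaussian b x : ℂ)) (orthant n)) →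
      ∃ c : ℂ, EqOn (l.foldl (fun g j => (opT j)^[k j] g) g)
        (fun x => c * (gaussian b x : ℂ)) (orthant n) := by
    intro l
    induction l with
    | nil => exact fun g hg => hg
    | cons a l ih => exact fun g hg => ih _ (h1 a (k a) g hg)
  exact h2 _ f ⟨1, fun x hx => by simp [hf hx]⟩

theorem exists_pow_mul_gaussian_le {n : ℕ} {b : Fin n → ℝ} (hb : ∀ i, 0 < b i) (m : ℕ) :
    ∃ C : ℝ, ∀ x : Fin n → ℝ, (1 + ∑ i, x i ^ 2) ^ m * gaussian b x ≤ C := by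
  have hsum : 0 ≤ ∑ i, (b i)⁻¹ := Finset.sum_nonneg fun i _ => (inv_pos.2 (hb i)).le
  -- A positive lower bound for all `b i` that makes sense for `n = 0` too. The bound then follows
  -- from `s^m / m! ≤ e^s` at `s = β (1 + ‖x‖²)`.
  set β := (1 + ∑ i, (b i)⁻¹)⁻¹ with hβ
  have hβ0 : 0 < β := inv_pos.2 (by linarith)
  have hβb : ∀ i, β ≤ b i := fun i => by
    rw [hβ, inv_le_comm₀ (by linarith) (hb i)]
    have := Finset.single_le_sum (f := fun i => (b i)⁻¹) (fun i _ => (inv_pos.2 (hb i)).le)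
      (Finset.mem_univ i)
    linarith
  refine ⟨m.factorial / β ^ m * Real.exp β, fun x => ?_⟩
  have hs : 0 ≤ ∑ i, x i ^ 2 := Finset.sum_nonneg fun i _ => sq_nonneg _
  have h1 := Real.pow_div_factorial_le_exp (β * (1 + ∑ i, x i ^ 2)) (by positivity) m
  have h2 : gaussian b x ≤ Real.exp (-(β * ∑ i, x i ^ 2)) := by
    refine Real.exp_le_exp.2 (neg_le_neg ?_)
    rw [Finset.mul_sum]
    exact Finset.sum_le_sum fun i _ => mul_le_mul_of_nonneg_right (hβb i) (sq_nonneg _)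
  have h3 : (1 + ∑ i, x i ^ 2) ^ m ≤
      m.factorial / β ^ m * Real.exp (β * (1 + ∑ i, x i ^ 2)) := by
    rw [mul_pow, div_le_iff₀ (by positivity)] at h1
    rw [div_mul_eq_mul_div, le_div_iff₀ (by positivity)]
    linarith
  calc (1 + ∑ i, x i ^ 2) ^ m * gaussian b x
      ≤ m.factorial / β ^ m * Real.exp (β * (1 + ∑ i, x i ^ 2)) *
          Real.exp (-(β * ∑ i, x i ^ 2)) := by
        have := (gaussian_pos b x).le
        gcongr
    _ = m.factorial / β ^ m * Real.exp β := by
        rw [mul_assoc, ← Real.exp_add]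
        ring_nf

/-! ### Gaussians divided by the weight `r`, as elements of `H_μ` -/

theorem weightR_pos {n : ℕ} (μ : Fin n → ℝ) {x : Fin n → ℝ} (hx : x ∈ orthant n) :
    0 < weightR μ x := multiPow_pos hx _

/-- The test function whose product with `r` is `gaussian b`. -/
noncomputable def gaussianTest {n : ℕ} (μ b x : Fin n → ℝ) : ℂ :=
  (weightR μ x)⁻¹ • (gaussian b x : ℂ)

theorem weightR_smul_gaussianTest {n : ℕ} (μ b : Fin n → ℝ) :
    EqOn (fun x => weightR μ x • gaussianTest μ b x) (fun x => (gaussian b x : ℂ))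
      (orthant n) := fun _ hx => smul_inv_smul₀ (weightR_pos μ hx).ne' _

theorem contDiffOn_gaussianTest {n : ℕ} (μ b : Fin n → ℝ) :
    ContDiffOn ℝ ∞ (gaussianTest μ b) (orthant n) :=
  ((contDiffOn_multiPow _).inv fun _ hx => (weightR_pos μ hx).ne').smul
    (contDiff_gaussian b).contDiffOn

theorem isZemanian_gaussianTest {n : ℕ} (μ : Fin n → ℝ) {b : Fin n → ℝ} (hb : ∀ i, 0 < b i) :
    IsZemanian μ (gaussianTest μ b) := by
  refine ⟨contDiffOn_gaussianTest μ b, fun m k => ?_⟩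
  obtain ⟨c, hc⟩ := opTPow_eqOn_gaussian b k (weightR_smul_gaussianTest μ b)
  obtain ⟨C, hC⟩ := exists_pow_mul_gaussian_le hb m
  refine ⟨‖c‖ * C, fun x hx => ?_⟩
  have hs : 0 ≤ ∑ i, x i ^ 2 := Finset.sum_nonneg fun i _ => sq_nonneg _
  rw [hc hx, norm_smul, norm_mul, Complex.norm_real, Real.norm_of_nonneg (gaussian_pos b x).le,
    Real.norm_of_nonneg (by positivity), mul_left_comm]
  exact mul_le_mul_of_nonneg_left (hC x) (norm_nonneg c)

/-- In the form `x_i² T_i² + (2μ_i + 2) T_i` the conjugated operator is read off from `T_i = -2 b_i`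
on the Gaussian. -/
theorem weightR_smul_besselOp_gaussianTest {n : ℕ} (μ b : Fin n → ℝ) {x : Fin n → ℝ}
    (hx : x ∈ orthant n) :
    weightR μ x • besselOp μ (gaussianTest μ b) x = (gaussianLaplacian μ b x : ℂ) := by
  rw [weightR_smul_besselOp μ (contDiffOn_gaussianTest μ b) hx, gaussianLaplacian, Finset.sum_mul,
    Complex.ofReal_sum]
  refine Finset.sum_congr rfl fun i _ => ?_
  have h1 : EqOn (opT i fun y => weightR μ y • gaussianTest μ b y)
      (fun x => 1 * (-2 * b i) * (gaussian b x : ℂ)) (orthant n) :=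
    (opT_congr i fun x hx => by simpa using weightR_smul_gaussianTest μ b hx).trans
      (opT_const_mul_gaussian b 1 i)
  rw [(opT_congr i h1).trans (opT_const_mul_gaussian b _ i) hx, h1 hx]
  simp only [Complex.real_smul]
  push_cast
  ring

/-- The pairing of `H'_μ` with `H_μ` in terms of the Bessel measure. -/
theorem integral_orthantMeasure_mul {n : ℕ} {μ : Fin n → ℝ} (hμ : ∀ i, -1 / 2 < μ i)
    (f φ : (Fin n → ℝ) → ℂ) :
    ∫ x, f x * φ x ∂(orthantMeasure n) =
      normConst μ * ∫ x, (weightR μ x • f x) * (weightR μ x • φ x) ∂(besselMeasure μ) := by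
  rw [besselMeasure, integral_withDensity_eq_integral_toReal_smul (by fun_prop)
    (.of_forall fun _ => ENNReal.ofReal_lt_top), ← integral_const_mul]
  refine integral_congr_ae ?_
  filter_upwards [ae_mem_orthant n] with x hx
  rw [ENNReal.toReal_ofReal (weightS_pos hμ hx).le]
  have h3 : ((normConst μ : ℝ) : ℂ) * (weightS μ x * weightR μ x * weightR μ x) = 1 := by
    exact_mod_cast normConst_mul_weights hμ hx
  simp only [Complex.real_smul]
  linear_combination (-(f x * φ x)) * h3

theorem IsBesselOf.integral_gaussian {n : ℕ} {μ : Fin n → ℝ} (hμ : ∀ i, -1 / 2 < μ i)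
    {f g : SpaceY μ} (h : IsBesselOf μ f g) {b : Fin n → ℝ} (hb : ∀ i, 0 < b i) :
    ∫ y, (weightR μ y • g.1 y) * (gaussian b y : ℂ) ∂(besselMeasure μ) =
      ∫ y, (weightR μ y • f.1 y) * (gaussianLaplacian μ b y : ℂ) ∂(besselMeasure μ) := by
  have h1 := h _ (isZemanian_gaussianTest μ hb)
  rw [integral_orthantMeasure_mul hμ, integral_orthantMeasure_mul hμ] at h1
  have hC : ((normConst μ : ℝ) : ℂ) ≠ 0 := by exact_mod_cast (normConst_pos hμ).ne'
  have h2 := mul_left_cancel₀ hC h1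
  convert h2 using 1 <;> refine integral_congr_ae ?_
  · filter_upwards [ae_mem_orthant_besselMeasure μ] with x hx
    exact congrArg _ (weightR_smul_gaussianTest μ b hx).symm
  · filter_upwards [ae_mem_orthant_besselMeasure μ] with x hx
    exact congrArg _ (weightR_smul_besselOp_gaussianTest μ b hx).symm

/-! ### Integration by parts against Gaussians -/

/-- The `i`-th summand of `r S_μ r⁻¹`. -/
noncomputable def besselPart {n : ℕ} (μ : Fin n → ℝ) (i : Fin n) (ψ : (Fin n → ℝ) → ℂ)
    (x : Fin n → ℝ) : ℂ :=
  (x i ^ 2) • opT i (opT i ψ) x + (2 * μ i + 2) • opT i ψ x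

theorem contDiffOn_besselPart {n : ℕ} (μ : Fin n → ℝ) (i : Fin n) {ψ : (Fin n → ℝ) → ℂ}
    (hψ : ContDiffOn ℝ ∞ ψ (orthant n)) : ContDiffOn ℝ ∞ (besselPart μ i ψ) (orthant n) :=
  (ContDiffOn.smul (f := fun x : Fin n → ℝ => x i ^ 2)
    ((contDiff_apply ℝ ℝ i).contDiffOn.pow 2) (contDiffOn_opT i (contDiffOn_opT i hψ))).add
    (ContDiffOn.smul (f := fun _ : Fin n → ℝ => 2 * μ i + 2) contDiffOn_const
      (contDiffOn_opT i hψ))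

theorem insertNth_mem_orthant {n : ℕ} (i : Fin (n + 1)) {t : ℝ} (ht : 0 < t) {z : Fin n → ℝ}
    (hz : z ∈ orthant n) : (i.insertNth t z : Fin (n + 1) → ℝ) ∈ orthant (n + 1) := by
  intro j
  refine Fin.succAboveCases i ?_ (fun k => ?_) j
  · simpa using ht
  · simpa using hz k

theorem hasDerivAt_insertNth {n : ℕ} (i : Fin (n + 1)) (z : Fin n → ℝ) (t : ℝ) :
    HasDerivAt (fun t => (i.insertNth t z : Fin (n + 1) → ℝ)) (Pi.single i 1) t := by
  rw [hasDerivAt_pi]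
  intro j
  refine Fin.succAboveCases i ?_ (fun k => ?_) j
  · simpa using hasDerivAt_id' t
  · simpa using hasDerivAt_const t (z k)

theorem hasDerivAt_comp_insertNth {n : ℕ} (i : Fin (n + 1)) {z : Fin n → ℝ} {t : ℝ}
    {f : (Fin (n + 1) → ℝ) → ℂ} (hf : DifferentiableAt ℝ f (i.insertNth t z)) :
    HasDerivAt (fun t => f (i.insertNth t z)) (pderiv i f (i.insertNth t z)) t :=
  hf.hasFDerivAt.comp_hasDerivAt t (hasDerivAt_insertNth i z t)

theorem gaussian_insertNth_le {n : ℕ} {b : Fin (n + 1) → ℝ} (hb : ∀ i, 0 < b i)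
    (i : Fin (n + 1)) (z : Fin n → ℝ) (t : ℝ) :
    gaussian b (i.insertNth t z) ≤ Real.exp (-(b i * t ^ 2)) := by
  refine Real.exp_le_exp.2 (neg_le_neg ?_)
  have := Finset.single_le_sum
    (f := fun j => b j * (i.insertNth t z : Fin (n + 1) → ℝ) j ^ 2)
    (fun j _ => mul_nonneg (hb j).le (sq_nonneg _)) (Finset.mem_univ i)
  simpa using this

/-- Lagrange's identity in the variable `t = x_i`: the integrand is the derivative of `t^{2μ_i + 1}
(ψ' g - ψ g')` for the Gaussian `g`. As `ψ' = t T_i ψ` and `g' = -2 b_i t g`, this is the function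
`W` below, and boundedness of `ψ` and `T_i ψ` makes it vanish at both ends. -/
theorem integral_wronskian_eq_zero {n : ℕ} {μ : Fin (n + 1) → ℝ} (hμ : ∀ i, -1 / 2 < μ i)
    {b : Fin (n + 1) → ℝ} (hb : ∀ i, 0 < b i) (i : Fin (n + 1)) {ψ : (Fin (n + 1) → ℝ) → ℂ}
    (hψ : ContDiffOn ℝ ∞ ψ (orthant (n + 1))) {C₀ C₁ : ℝ}
    (h0 : ∀ x ∈ orthant (n + 1), ‖ψ x‖ ≤ C₀) (h1 : ∀ x ∈ orthant (n + 1), ‖opT i ψ x‖ ≤ C₁)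
    {z : Fin n → ℝ} (hz : z ∈ orthant n) :
    ∫ t in Ioi (0 : ℝ), ((t ^ (2 * μ i + 1) : ℝ) : ℂ) *
      ((besselPart μ i ψ (i.insertNth t z) -
        (4 * b i ^ 2 * t ^ 2 - 4 * b i * (μ i + 1)) * ψ (i.insertNth t z)) *
        (gaussian b (i.insertNth t z) : ℂ)) = 0 := by
  by_cases hint : IntegrableOn (fun t : ℝ => ((t ^ (2 * μ i + 1) : ℝ) : ℂ) *
      ((besselPart μ i ψ (i.insertNth t z) -
        (4 * b i ^ 2 * t ^ 2 - 4 * b i * (μ i + 1)) * ψ (i.insertNth t z)) *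
        (gaussian b (i.insertNth t z) : ℂ))) (Ioi 0)
  swap
  -- A non-integrable function has Bochner integral `0`, so nothing is left to prove in that case.
  · exact integral_undef hint
  set W : ℝ → ℂ := fun t => ((t ^ (2 * μ i + 2) : ℝ) : ℂ) *
    ((opT i ψ (i.insertNth t z) + 2 * b i * ψ (i.insertNth t z)) *
      (gaussian b (i.insertNth t z) : ℂ)) with hW
  have hpos : 0 < 2 * μ i + 2 := by linarith [hμ i]
  -- The point `t = 0` lies outside the orthant, where `ψ` is arbitrary; the vanishing power makes
  -- its value there irrelevant.
  have hW0 : W 0 = 0 := by simp [hW, Real.zero_rpow hpos.ne']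
  have hd : ∀ t ∈ Ioi (0 : ℝ), HasDerivAt W (((t ^ (2 * μ i + 1) : ℝ) : ℂ) *
      ((besselPart μ i ψ (i.insertNth t z) -
        (4 * b i ^ 2 * t ^ 2 - 4 * b i * (μ i + 1)) * ψ (i.insertNth t z)) *
        (gaussian b (i.insertNth t z) : ℂ))) t := by
    intro t ht
    have ht0 : (0 : ℝ) < t := ht
    have hx := insertNth_mem_orthant i ht0 hz
    have d1 := hasDerivAt_comp_insertNth i (differentiableAt_of_contDiffOn hψ hx)
    have d2 := hasDerivAt_comp_insertNth i
      (differentiableAt_of_contDiffOn (contDiffOn_opT i hψ) hx)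
    have d3 := hasDerivAt_comp_insertNth i (z := z) (t := t)
      ((contDiff_gaussian b).differentiable (by simp) _)
    have d4 : HasDerivAt (fun t : ℝ => ((t ^ (2 * μ i + 2) : ℝ) : ℂ))
        (((2 * μ i + 2) * t ^ (2 * μ i + 2 - 1) : ℝ) : ℂ) t :=
      (Real.hasDerivAt_rpow_const (.inl ht0.ne')).ofReal_comp
    rw [pderiv_eq_smul_opT i _ hx, Fin.insertNth_apply_same] at d1 d2
    rw [pderiv_gaussian, Fin.insertNth_apply_same] at d3
    refine (d4.mul ((d2.add (d1.const_mul (2 * b i : ℂ))).mul d3)).congr_deriv ?_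
    have e1 : (2 * μ i + 2 - 1) = 2 * μ i + 1 := by ring
    have e2 : t ^ (2 * μ i + 2) = t ^ (2 * μ i + 1) * t := by
      rw [← Real.rpow_add_one ht0.ne']
      ring_nf
    simp only [e1, e2, besselPart, Complex.real_smul, Fin.insertNth_apply_same, Pi.add_apply,
      Pi.mul_apply]
    push_cast
    ring
  have hC0 : 0 ≤ C₀ := (norm_nonneg _).trans (h0 _ (insertNth_mem_orthant i one_pos hz))
  have hC1 : 0 ≤ C₁ := (norm_nonneg _).trans (h1 _ (insertNth_mem_orthant i one_pos hz))
  have hbi := hb i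
  have hWb : ∀ t : ℝ, 0 < t → ‖W t‖ ≤ (C₁ + 2 * b i * C₀) *
      (t ^ (2 * μ i + 2) * Real.exp (-(b i * t ^ 2))) := by
    intro t ht
    have hx := insertNth_mem_orthant i ht hz
    have hp : 0 ≤ t ^ (2 * μ i + 2) := by positivity
    rw [hW]
    dsimp only
    rw [norm_mul, norm_mul, Complex.norm_real, Complex.norm_real, Real.norm_of_nonneg hp,
      Real.norm_of_nonneg (gaussian_pos _ _).le]
    have n1 : ‖opT i ψ (i.insertNth t z) + 2 * b i * ψ (i.insertNth t z)‖ ≤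
        C₁ + 2 * b i * C₀ := by
      refine (norm_add_le _ _).trans (add_le_add (h1 _ hx) ?_)
      rw [norm_mul, norm_mul, Complex.norm_real, Real.norm_of_nonneg hbi.le]
      simp only [Complex.norm_ofNat]
      gcongr
      exact h0 _ hx
    have n2 := gaussian_insertNth_le hb i z t
    have n3 := gaussian_pos b (i.insertNth t z)
    calc _ ≤ t ^ (2 * μ i + 2) * ((C₁ + 2 * b i * C₀) * Real.exp (-(b i * t ^ 2))) := by gcongr
      _ = _ := by ring
  have hcont : ContinuousWithinAt W (Ici 0) 0 := by
    rw [ContinuousWithinAt, hW0]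
    have hlim : Filter.Tendsto (fun t : ℝ => (C₁ + 2 * b i * C₀) *
        (t ^ (2 * μ i + 2) * Real.exp (-(b i * t ^ 2)))) (nhdsWithin 0 (Ici 0)) (nhds 0) := by
      have hc : Continuous fun t : ℝ => (C₁ + 2 * b i * C₀) *
          (t ^ (2 * μ i + 2) * Real.exp (-(b i * t ^ 2))) := by
        have := Real.continuous_rpow_const hpos.le
        fun_prop
      have := (hc.tendsto 0).mono_left (nhdsWithin_le_nhds (s := Ici 0))
      simpa [Real.zero_rpow hpos.ne'] using this
    refine squeeze_zero_norm' ?_ hlim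
    filter_upwards [self_mem_nhdsWithin] with t ht
    rcases (show (0 : ℝ) ≤ t from ht).eq_or_lt with rfl | ht'
    · simp [hW0, Real.zero_rpow hpos.ne']
    · exact hWb t ht'
  have hinf : Filter.Tendsto W Filter.atTop (nhds 0) := by
    have h2 := tendsto_rpow_mul_exp_neg_mul_atTop_nhds_zero (2 * μ i + 2) (2 * b i)
      (by linarith)
    have h3 := h2.const_mul ((C₁ + 2 * b i * C₀) * Real.exp (b i))
    rw [mul_zero] at h3
    refine squeeze_zero_norm' ?_ h3
    filter_upwards [Filter.eventually_gt_atTop 0] with t ht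
    refine (hWb t ht).trans ?_
    -- From `(t - 1)² ≥ 0`, that is `t² ≥ 2t - 1`: the Gaussian is compared with a simple
    -- exponential.
    have h4 : Real.exp (-(b i * t ^ 2)) ≤ Real.exp (b i) * Real.exp (-(2 * b i) * t) := by
      rw [← Real.exp_add, Real.exp_le_exp]
      nlinarith [sq_nonneg (t - 1)]
    calc _ ≤ (C₁ + 2 * b i * C₀) * (t ^ (2 * μ i + 2) *
          (Real.exp (b i) * Real.exp (-(2 * b i) * t))) := by gcongr
      _ = _ := by ring
  rw [integral_Ioi_of_hasDerivAt_of_tendsto hcont hd hint hinf, hW0, sub_zero]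

/-- Fubini with the `i`-th variable innermost: the weight `s` is a product, so its other factors
come out of the one-dimensional integral, which vanishes. -/
theorem integral_besselPart_sub_eq_zero {n : ℕ} {μ : Fin n → ℝ} (hμ : ∀ i, -1 / 2 < μ i)
    {b : Fin n → ℝ} (hb : ∀ i, 0 < b i) (i : Fin n) {ψ : (Fin n → ℝ) → ℂ}
    (hψ : ContDiffOn ℝ ∞ ψ (orthant n)) {C₀ C₁ : ℝ}
    (h0 : ∀ x ∈ orthant n, ‖ψ x‖ ≤ C₀) (h1 : ∀ x ∈ orthant n, ‖opT i ψ x‖ ≤ C₁) :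
    ∫ x, (besselPart μ i ψ x - (4 * b i ^ 2 * x i ^ 2 - 4 * b i * (μ i + 1)) * ψ x) *
      (gaussian b x : ℂ) ∂(besselMeasure μ) = 0 := by
  cases n with
  | zero => exact i.elim0
  | succ n =>
    rw [besselMeasure, integral_withDensity_eq_integral_toReal_smul (by fun_prop)
      (.of_forall fun _ => ENNReal.ofReal_lt_top), orthantMeasure_eq_pi]
    have hmp := (measurePreserving_piFinSuccAbove
      (fun _ : Fin (n + 1) => (volume : Measure ℝ).restrict (Ioi 0)) i).symm
    rw [← hmp.integral_comp (MeasurableEquiv.measurableEmbedding _)]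
    by_cases hint : Integrable (fun p : ℝ × (Fin n → ℝ) =>
      (ENNReal.ofReal (weightS μ (i.insertNth p.1 p.2))).toReal •
      ((besselPart μ i ψ (i.insertNth p.1 p.2) -
        (4 * b i ^ 2 * (i.insertNth p.1 p.2 : Fin (n + 1) → ℝ) i ^ 2 - 4 * b i * (μ i + 1)) *
          ψ (i.insertNth p.1 p.2)) * (gaussian b (i.insertNth p.1 p.2) : ℂ)))
      (((volume : Measure ℝ).restrict (Ioi 0)).prod
        (Measure.pi fun _ : Fin n => (volume : Measure ℝ).restrict (Ioi 0)))
    swap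
    · exact integral_undef hint
    refine (integral_prod_symm _ hint).trans ?_
    rw [← orthantMeasure_eq_pi]
    refine integral_eq_zero_of_ae ?_
    filter_upwards [ae_mem_orthant n] with z hz
    have hW := integral_wronskian_eq_zero hμ hb i hψ h0 h1 hz
    have e1 : ∀ t ∈ Ioi (0 : ℝ), (ENNReal.ofReal (weightS μ (i.insertNth t z))).toReal •
        ((besselPart μ i ψ (i.insertNth t z) -
        (4 * b i ^ 2 * (i.insertNth t z : Fin (n + 1) → ℝ) i ^ 2 - 4 * b i * (μ i + 1)) *
          ψ (i.insertNth t z)) * (gaussian b (i.insertNth t z) : ℂ)) =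
        (((∏ j, z j ^ (2 * μ (i.succAbove j) + 1)) / normConst μ : ℝ) : ℂ) *
        (((t ^ (2 * μ i + 1) : ℝ) : ℂ) * ((besselPart μ i ψ (i.insertNth t z) -
          (4 * b i ^ 2 * t ^ 2 - 4 * b i * (μ i + 1)) * ψ (i.insertNth t z)) *
          (gaussian b (i.insertNth t z) : ℂ))) := by
      intro t ht
      rw [ENNReal.toReal_ofReal (weightS_pos hμ (insertNth_mem_orthant i ht hz)).le, weightS,
        multiPow, Fin.prod_univ_succAbove _ i]
      simp only [Fin.insertNth_apply_same, Fin.insertNth_apply_succAbove, Complex.real_smul]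
      push_cast
      ring
    refine (setIntegral_congr_fun measurableSet_Ioi e1).trans ?_
    rw [integral_const_mul, hW, mul_zero]
    rfl


/-! ### Integrability of rapidly decreasing functions -/

theorem rpow_le_one_add_sq_pow {x q : ℝ} (hx : 0 < x) (hq : 0 ≤ q) {K : ℕ} (hK : q ≤ K) :
    x ^ q ≤ (1 + x ^ 2) ^ K := by
  have h1 : x ≤ 1 + x ^ 2 := by nlinarith [sq_nonneg (x - 1)]
  calc x ^ q ≤ (1 + x ^ 2) ^ q := Real.rpow_le_rpow hx.le h1 hq
    _ ≤ (1 + x ^ 2) ^ (K : ℝ) :=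
        Real.rpow_le_rpow_of_exponent_le (by nlinarith [sq_nonneg x]) hK
    _ = (1 + x ^ 2) ^ K := Real.rpow_natCast _ _

/-- With `Q = ∏ (1 + xᵢ²)`, the weight `s` is at most `Q^K / C_μ` and `Q⁻¹` is integrable. Hence
decay of order `Q^(K + 1)` suffices, and `Q ≤ (1 + ‖x‖²)^n` gives `M = n (K + 1)`. -/
theorem exists_integrable_of_decay {n : ℕ} {μ : Fin n → ℝ} (hμ : ∀ i, -1 / 2 < μ i) :
    ∃ M : ℕ, ∀ F : (Fin n → ℝ) → ℂ, ContinuousOn F (orthant n) →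
      (∃ C : ℝ, ∀ x ∈ orthant n, (1 + ∑ i, x i ^ 2) ^ M * ‖F x‖ ≤ C) →
      Integrable F (besselMeasure μ) := by
  -- The summands are positive as `μ i > -1/2`, so their sum dominates each of them.
  set K : ℕ := ⌈∑ i, (2 * μ i + 1)⌉₊
  have hK : ∀ i, 2 * μ i + 1 ≤ K := fun i =>
    (Finset.single_le_sum (f := fun i => 2 * μ i + 1) (fun i _ => by linarith [hμ i])
      (Finset.mem_univ i)).trans (Nat.le_ceil _)
  refine ⟨n * (K + 1), fun F hF => ?_⟩
  rintro ⟨C, hC⟩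
  rw [besselMeasure, integrable_withDensity_iff_integrable_smul' (by fun_prop)
    (.of_forall fun _ => ENNReal.ofReal_lt_top)]
  have hp : Integrable (fun x : Fin n → ℝ => ∏ i, (1 + x i ^ 2)⁻¹) (orthantMeasure n) := by
    rw [orthantMeasure_eq_pi]
    exact Integrable.fintype_prod (f := fun _ y => (1 + y ^ 2)⁻¹)
      fun i => integrable_inv_one_add_sq.integrableOn
  refine (hp.const_mul (C / normConst μ)).mono' ?_ ?_
  · refine (measurable_weightS μ).ennreal_ofReal.ennreal_toReal.aestronglyMeasurable.smul ?_
    exact hF.aestronglyMeasurable (isOpen_orthant n).measurableSet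
  · filter_upwards [ae_mem_orthant n] with x hx
    have hs := weightS_pos hμ hx
    have hN := normConst_pos hμ
    rw [ENNReal.toReal_ofReal hs.le, norm_smul, Real.norm_of_nonneg hs.le]
    have hQ : 0 < ∏ i, (1 + x i ^ 2) := Finset.prod_pos fun i _ => by positivity
    have h1 : multiPow x (fun i => 2 * μ i + 1) ≤ (∏ i, (1 + x i ^ 2)) ^ K := by
      rw [← Finset.prod_pow]
      exact Finset.prod_le_prod (fun i _ => (Real.rpow_pos_of_pos (hx i) _).le)
        fun i _ => rpow_le_one_add_sq_pow (hx i) (by linarith [hμ i]) (hK i)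
    have h2 : ∏ i, (1 + x i ^ 2) ≤ (1 + ∑ i, x i ^ 2) ^ n := by
      calc ∏ i, (1 + x i ^ 2) ≤ ∏ _i : Fin n, (1 + ∑ j, x j ^ 2) := by
            refine Finset.prod_le_prod (fun i _ => by positivity) fun i _ => ?_
            have := Finset.single_le_sum (f := fun j => x j ^ 2) (fun j _ => sq_nonneg _)
              (Finset.mem_univ i)
            linarith
        _ = _ := by simp
    have h3 : (∏ i, (1 + x i ^ 2)) ^ (K + 1) ≤ (1 + ∑ i, x i ^ 2) ^ (n * (K + 1)) := by
      rw [pow_mul]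
      gcongr
    have h4 : (∏ i, (1 + x i ^ 2)) ^ (K + 1) * ‖F x‖ ≤ C :=
      (mul_le_mul_of_nonneg_right h3 (norm_nonneg _)).trans (hC x hx)
    rw [Finset.prod_inv_distrib, weightS, ← div_eq_mul_inv, le_div_iff₀ hQ,
      div_mul_eq_mul_div, div_mul_eq_mul_div]
    gcongr
    calc multiPow x (fun i => 2 * μ i + 1) * ‖F x‖ * ∏ i, (1 + x i ^ 2)
        ≤ (∏ i, (1 + x i ^ 2)) ^ K * ‖F x‖ * ∏ i, (1 + x i ^ 2) := by gcongr
      _ = (∏ i, (1 + x i ^ 2)) ^ (K + 1) * ‖F x‖ := by ring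
      _ ≤ C := h4

theorem norm_one_add_sum_pow_smul {n : ℕ} (M : ℕ) (x : Fin n → ℝ) (z : ℂ) :
    ‖(1 + ∑ i, x i ^ 2) ^ M • z‖ = (1 + ∑ i, x i ^ 2) ^ M * ‖z‖ := by
  have h0 : 0 ≤ ∑ j, x j ^ 2 := Finset.sum_nonneg fun j _ => sq_nonneg _
  rw [norm_smul, Real.norm_of_nonneg (by positivity)]

theorem sq_mul_le_one_add_sum_pow {n : ℕ} (M : ℕ) (x : Fin n → ℝ) (i : Fin n) :
    (1 + ∑ j, x j ^ 2) ^ M * x i ^ 2 ≤ (1 + ∑ j, x j ^ 2) ^ (M + 1) := by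
  have h0 : 0 ≤ ∑ j, x j ^ 2 := Finset.sum_nonneg fun j _ => sq_nonneg _
  have h1 := Finset.single_le_sum (f := fun j => x j ^ 2) (fun j _ => sq_nonneg _)
    (Finset.mem_univ i)
  rw [pow_succ]
  exact mul_le_mul_of_nonneg_left (by linarith) (by positivity)

/-! ### Decay, integrability and symmetry of test functions in the form `r φ` -/

section Zemanian

variable {n : ℕ} {μ : Fin n → ℝ} {φ : (Fin n → ℝ) → ℂ}

theorem IsZemanian.contDiffOn_weightR_smul (hφ : IsZemanian μ φ) :
    ContDiffOn ℝ ∞ (fun y => weightR μ y • φ y) (orthant n) :=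
  ContDiffOn.smul (contDiffOn_multiPow _) hφ.smooth

theorem IsZemanian.decay (hφ : IsZemanian μ φ) (M : ℕ) :
    ∃ C : ℝ, ∀ x ∈ orthant n, (1 + ∑ i, x i ^ 2) ^ M * ‖weightR μ x • φ x‖ ≤ C := by
  obtain ⟨C, hC⟩ := hφ.bounded M 0
  refine ⟨C, fun x hx => ?_⟩
  simpa only [norm_one_add_sum_pow_smul, opTPow_zero] using hC x hx

theorem IsZemanian.decay_besselPart (hφ : IsZemanian μ φ) (M : ℕ) (i : Fin n) :
    ∃ C : ℝ, ∀ x ∈ orthant n,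
      (1 + ∑ i, x i ^ 2) ^ M * ‖besselPart μ i (fun y => weightR μ y • φ y) x‖ ≤ C := by
  -- One extra power absorbs the factor `x_i²` in front of `T_i²`.
  obtain ⟨C₁, h₁⟩ := hφ.bounded (M + 1) (Pi.single i 2)
  obtain ⟨C₂, h₂⟩ := hφ.bounded M (Pi.single i 1)
  refine ⟨C₁ + |2 * μ i + 2| * C₂, fun x hx => ?_⟩
  have h0 : 0 ≤ ∑ j, x j ^ 2 := Finset.sum_nonneg fun j _ => sq_nonneg _
  have k₁ := h₁ x hx
  have k₂ := h₂ x hx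
  rw [norm_one_add_sum_pow_smul, opTPow_single] at k₁ k₂
  rw [Function.iterate_one] at k₂
  change (1 + ∑ j, x j ^ 2) ^ (M + 1) *
    ‖opT i (opT i fun y => weightR μ y • φ y) x‖ ≤ C₁ at k₁
  set p := opT i (fun y => weightR μ y • φ y) x
  set q := opT i (opT i fun y => weightR μ y • φ y) x
  calc (1 + ∑ j, x j ^ 2) ^ M * ‖(x i ^ 2) • q + (2 * μ i + 2) • p‖
      ≤ (1 + ∑ j, x j ^ 2) ^ M * (x i ^ 2 * ‖q‖ + |2 * μ i + 2| * ‖p‖) := by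
        gcongr
        refine (norm_add_le _ _).trans (le_of_eq ?_)
        rw [norm_smul, norm_smul, Real.norm_of_nonneg (sq_nonneg _), Real.norm_eq_abs]
    _ = (1 + ∑ j, x j ^ 2) ^ M * x i ^ 2 * ‖q‖ +
          |2 * μ i + 2| * ((1 + ∑ j, x j ^ 2) ^ M * ‖p‖) := by ring
    _ ≤ C₁ + |2 * μ i + 2| * C₂ := by
        gcongr
        exact (mul_le_mul_of_nonneg_right (sq_mul_le_one_add_sum_pow M x i)
          (norm_nonneg _)).trans k₁

theorem weightR_smul_besselOp_eq_sum (hφ : IsZemanian μ φ) {x : Fin n → ℝ} (hx : x ∈ orthant n) :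
    weightR μ x • besselOp μ φ x = ∑ i, besselPart μ i (fun y => weightR μ y • φ y) x :=
  weightR_smul_besselOp μ hφ.smooth hx

theorem IsZemanian.integrable_weightR_smul (hφ : IsZemanian μ φ) (hμ : ∀ i, -1 / 2 < μ i) :
    Integrable (fun x => weightR μ x • φ x) (besselMeasure μ) := by
  obtain ⟨M, hM⟩ := exists_integrable_of_decay hμ
  exact hM _ hφ.contDiffOn_weightR_smul.continuousOn (hφ.decay M)

theorem IsZemanian.integrable_sq_smul (hφ : IsZemanian μ φ) (hμ : ∀ i, -1 / 2 < μ i)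
    (i : Fin n) :
    Integrable (fun x => (x i ^ 2) • (weightR μ x • φ x)) (besselMeasure μ) := by
  obtain ⟨M, hM⟩ := exists_integrable_of_decay hμ
  refine hM _ (((continuous_apply i).pow 2).continuousOn.smul
    hφ.contDiffOn_weightR_smul.continuousOn) ?_
  obtain ⟨C, hC⟩ := hφ.decay (M + 1)
  refine ⟨C, fun x hx => ?_⟩
  rw [norm_smul, Real.norm_of_nonneg (sq_nonneg _), ← mul_assoc]
  exact (mul_le_mul_of_nonneg_right (sq_mul_le_one_add_sum_pow M x i)
    (norm_nonneg _)).trans (hC x hx)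

theorem IsZemanian.integrable_besselPart (hφ : IsZemanian μ φ) (hμ : ∀ i, -1 / 2 < μ i)
    (i : Fin n) :
    Integrable (besselPart μ i fun y => weightR μ y • φ y) (besselMeasure μ) := by
  obtain ⟨M, hM⟩ := exists_integrable_of_decay hμ
  exact hM _ (contDiffOn_besselPart μ i hφ.contDiffOn_weightR_smul).continuousOn
    (hφ.decay_besselPart M i)

theorem IsZemanian.integrable_weightR_smul_besselOp (hφ : IsZemanian μ φ)
    (hμ : ∀ i, -1 / 2 < μ i) :
    Integrable (fun x => weightR μ x • besselOp μ φ x) (besselMeasure μ) := by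
  refine (integrable_finsetSum Finset.univ fun i _ => hφ.integrable_besselPart hμ i).congr ?_
  filter_upwards [ae_mem_orthant_besselMeasure μ] with x hx
  rw [weightR_smul_besselOp_eq_sum hφ hx]

/-- Symmetry of the Bessel operator between test functions and Gaussians. -/
theorem IsZemanian.integral_besselOp_mul_gaussian (hφ : IsZemanian μ φ)
    (hμ : ∀ i, -1 / 2 < μ i) {b : Fin n → ℝ} (hb : ∀ i, 0 < b i) :
    ∫ x, (weightR μ x • besselOp μ φ x) * (gaussian b x : ℂ) ∂(besselMeasure μ) =
      ∫ x, (weightR μ x • φ x) * (gaussianLaplacian μ b x : ℂ) ∂(besselMeasure μ) := by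
  have hb0 : ∀ i, 0 ≤ b i := fun i => (hb i).le
  set ψ : (Fin n → ℝ) → ℂ := fun y => weightR μ y • φ y with hψ
  have hψi : Integrable ψ (besselMeasure μ) := hφ.integrable_weightR_smul hμ
  have hA : ∀ i, Integrable (fun x => (besselPart μ i ψ x -
      (4 * b i ^ 2 * x i ^ 2 - 4 * b i * (μ i + 1)) * ψ x) * (gaussian b x : ℂ))
      (besselMeasure μ) := by
    intro i
    have h1 := ((hφ.integrable_besselPart hμ i).sub
      ((hφ.integrable_sq_smul hμ i).const_mul (4 * b i ^ 2 : ℂ))).add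
      (hψi.const_mul (4 * b i * (μ i + 1) : ℂ))
    refine (integrable_mul_gaussian h1 hb0).congr (.of_forall fun x => ?_)
    simp only [Pi.add_apply, Pi.sub_apply, hψ, Complex.real_smul]
    push_cast
    ring
  rw [← sub_eq_zero, ← integral_sub
    (integrable_mul_gaussian (hφ.integrable_weightR_smul_besselOp hμ) hb0)
    (integrable_mul_gaussianLaplacian hμ hψi hb0)]
  -- The identity holds in each coordinate separately; `hA` allows the sum to leave the integral.
  have hsum : ∫ x, ∑ i, (besselPart μ i ψ x -
      (4 * b i ^ 2 * x i ^ 2 - 4 * b i * (μ i + 1)) * ψ x) * (gaussian b x : ℂ)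
      ∂(besselMeasure μ) = 0 := by
    rw [integral_finsetSum _ fun i _ => hA i]
    refine Finset.sum_eq_zero fun i _ => ?_
    obtain ⟨C₀, h₀⟩ := hφ.weightR_bounded
    obtain ⟨C₁, h₁⟩ := hφ.bounded 0 (Pi.single i 1)
    refine integral_besselPart_sub_eq_zero hμ hb i hφ.contDiffOn_weightR_smul h₀ (C₁ := C₁)
      fun x hx => ?_
    simpa only [pow_zero, one_smul, opTPow_single, Function.iterate_one] using h₁ x hx
  rw [← hsum]
  refine integral_congr_ae ?_
  filter_upwards [ae_mem_orthant_besselMeasure μ] with x hx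
  rw [weightR_smul_besselOp_eq_sum hφ hx, gaussianLaplacian]
  rw [Complex.ofReal_mul, Complex.ofReal_sum, ← Finset.sum_mul, Finset.sum_sub_distrib,
    ← Finset.sum_mul]
  push_cast
  ring

end Zemanian

/-! ### The resolvent on `Y` -/

section SpaceY

variable {n : ℕ} {μ : Fin n → ℝ}

/-- This makes `f ↦ r f` an isometry from `L¹(sr)` to `L¹(m)`; for `L^∞(r)` the same holds by
definition. -/
theorem lintegral_enorm_weight (hμ : ∀ i, -1 / 2 < μ i) (f : (Fin n → ℝ) → ℂ) :
    ∫⁻ x, ‖(weightS μ x * weightR μ x) • f x‖ₑ ∂(orthantMeasure n) =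
      ∫⁻ x, ‖weightR μ x • f x‖ₑ ∂(besselMeasure μ) := by
  rw [lintegral_besselMeasure]
  refine lintegral_congr_ae ?_
  filter_upwards [ae_mem_orthant n] with x hx
  rw [mul_smul, enorm_smul, Real.enorm_of_nonneg (weightS_pos hμ hx).le]

theorem normL1_eq (hμ : ∀ i, -1 / 2 < μ i) (f : (Fin n → ℝ) → ℂ) :
    normL1 μ f = (∫⁻ x, ‖weightR μ x • f x‖ₑ ∂(besselMeasure μ)).toReal := by
  rw [normL1, eLpNorm_one_eq_lintegral_enorm, lintegral_enorm_weight hμ]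

theorem aestronglyMeasurable_weightR_smul (f : SpaceY μ) :
    AEStronglyMeasurable (fun x => weightR μ x • f.1 x) (besselMeasure μ) :=
  f.2.2.1.mono_ac (besselMeasure_absolutelyContinuous μ)

theorem lintegral_enorm_weightR_smul_lt_top (hμ : ∀ i, -1 / 2 < μ i) (f : SpaceY μ) :
    ∫⁻ x, ‖weightR μ x • f.1 x‖ₑ ∂(besselMeasure μ) < ⊤ := by
  rw [← lintegral_enorm_weight hμ, ← eLpNorm_one_eq_lintegral_enorm]
  exact f.2.1.2

theorem integrable_weightR_smul (hμ : ∀ i, -1 / 2 < μ i) (f : SpaceY μ) :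
    Integrable (fun x => weightR μ x • f.1 x) (besselMeasure μ) :=
  ⟨aestronglyMeasurable_weightR_smul f, lintegral_enorm_weightR_smul_lt_top hμ f⟩

/-- The inverse map `u ↦ r⁻¹ u`, from bounded integrable functions back to `Y`. -/
theorem exists_spaceY (hμ : ∀ i, -1 / 2 < μ i) {u : (Fin n → ℝ) → ℂ}
    (hu : Integrable u (besselMeasure μ)) {C : ℝ≥0∞} (hC : C ≠ ⊤)
    (hb : ∀ᵐ x ∂(besselMeasure μ), ‖u x‖ₑ ≤ C) :
    ∃ f : SpaceY μ, (fun x => weightR μ x • f.1 x) =ᵐ[orthantMeasure n] u := by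
  have hac := orthantMeasure_absolutelyContinuous hμ
  have hm : AEStronglyMeasurable (fun x => (weightR μ x)⁻¹ • u x) (orthantMeasure n) :=
    (measurable_weightR μ).inv.aestronglyMeasurable.smul (hu.1.mono_ac hac)
  have he : (fun x => weightR μ x • (AEEqFun.mk _ hm : (Fin n → ℝ) →ₘ[orthantMeasure n] ℂ) x)
      =ᵐ[orthantMeasure n] u := by
    filter_upwards [AEEqFun.coeFn_mk _ hm, ae_mem_orthant n] with x hx hxo
    rw [hx, smul_inv_smul₀ (weightR_pos μ hxo).ne']
  refine ⟨⟨AEEqFun.mk _ hm, ⟨?_, ?_⟩, ?_, ?_⟩, he⟩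
  · exact ((measurable_weightS μ).mul (measurable_weightR μ)).aestronglyMeasurable.smul
      (AEEqFun.aestronglyMeasurable _)
  · rw [eLpNorm_one_eq_lintegral_enorm, lintegral_enorm_weight hμ,
      lintegral_congr_ae (((besselMeasure_absolutelyContinuous μ).ae_eq he).mono fun x hx =>
        congrArg enorm hx)]
    exact hu.2
  · exact (measurable_weightR μ).aestronglyMeasurable.smul (AEEqFun.aestronglyMeasurable _)
  · rw [eLpNorm_congr_ae he, eLpNorm_exponent_top]
    exact (eLpNormEssSup_le_of_ae_enorm_bound (hac.ae_le hb)).trans_lt hC.lt_top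

theorem normY_apply (f : SpaceY μ) : normY μ f = max (normL1 μ f.1) (normLinf μ f.1) := rfl

theorem ae_enorm_weightR_smul_le (f : SpaceY μ) :
    ∀ᵐ x ∂(orthantMeasure n), ‖weightR μ x • f.1 x‖ₑ ≤ ENNReal.ofReal (normLinf μ f.1) := by
  rw [normLinf, ENNReal.ofReal_toReal f.2.2.2.ne, eLpNorm_exponent_top]
  exact enorm_ae_le_eLpNormEssSup _ _

theorem normLinf_le (f : SpaceY μ) {C : ℝ} (hC : 0 ≤ C)
    (h : ∀ᵐ x ∂(orthantMeasure n), ‖weightR μ x • f.1 x‖ₑ ≤ ENNReal.ofReal C) :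
    normLinf μ f.1 ≤ C := by
  rw [normLinf, eLpNorm_exponent_top]
  exact ENNReal.toReal_le_of_le_ofReal hC (eLpNormEssSup_le_of_ae_enorm_bound h)

/-- A solution of `c f - S f = g` in `Y`, with the resolvent estimate. -/
theorem exists_resolvent (hμ : ∀ i, -1 / 2 < μ i) {c : ℝ} (hc : 0 < c) (g : SpaceY μ) :
    ∃ f : SpaceY μ, IsBesselOf μ f ((c : ℂ) • f - g) ∧ c * normY μ f ≤ normY μ g := by
  set m := besselMeasure μ with hm
  set K := resolventKernel μ c
  have hK : Measurable (Function.uncurry K) := measurable_resolventKernel μ c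
  have hs : ∀ x y, K x y = K y x := resolventKernel_symm μ c
  have hM : ∀ x, ∫⁻ y, K x y ∂m ≤ ENNReal.ofReal c⁻¹ := fun x =>
    (lintegral_resolventKernel hμ hc x).le
  have hac := besselMeasure_absolutelyContinuous μ
  set U : (Fin n → ℝ) → ℂ := fun x => weightR μ x • g.1 x
  have hU : Integrable U m := integrable_weightR_smul hμ g
  have hUb := hac.ae_le (ae_enorm_weightR_smul_le g)
  have hRU := integrable_kernelOp hK hs hM ENNReal.ofReal_ne_top hU
  have hRb := enorm_kernelOp_le_of_ae_le hM ENNReal.ofReal_ne_top hUb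
  -- The solution is `f = r⁻¹ K (r g)`.
  obtain ⟨f, hf⟩ := exists_spaceY hμ hRU
    (ENNReal.mul_ne_top ENNReal.ofReal_ne_top ENNReal.ofReal_ne_top) (.of_forall hRb)
  have hfm : (fun x => weightR μ x • f.1 x) =ᵐ[m] kernelOp m K U := hac.ae_le hf
  refine ⟨f, fun φ hφ => ?_, ?_⟩
  · have hsub : (fun x => weightR μ x • ((c : ℂ) • f - g).1 x) =ᵐ[m]
        fun x => (c : ℂ) * kernelOp m K U x - U x := by
      have h1 : ((c : ℂ) • f - g).1 = (c : ℂ) • f.1 - g.1 := rfl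
      rw [h1]
      filter_upwards [hfm, hac.ae_le (AEEqFun.coeFn_sub ((c : ℂ) • f.1) g.1),
        hac.ae_le (AEEqFun.coeFn_smul (c : ℂ) f.1)] with x e1 e2 e3
      rw [e2, Pi.sub_apply, e3, ← e1]
      simp only [Pi.smul_apply, smul_eq_mul, Complex.real_smul, U]
      ring
    rw [integral_orthantMeasure_mul hμ, integral_orthantMeasure_mul hμ]
    congr 1
    set ψ : (Fin n → ℝ) → ℂ := fun x => weightR μ x • φ x
    set v : (Fin n → ℝ) → ℂ := fun x => weightR μ x • besselOp μ φ x
    have hψ : Integrable ψ m := hφ.integrable_weightR_smul hμ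
    have hv : Integrable v m := hφ.integrable_weightR_smul_besselOp hμ
    obtain ⟨C₀, h₀⟩ := hφ.weightR_bounded
    obtain ⟨C₁, h₁⟩ := hφ.weightR_besselOp_bounded
    have hψb : ∀ᵐ x ∂m, ‖ψ x‖ ≤ C₀ := (ae_mem_orthant_besselMeasure μ).mono h₀
    have hvb : ∀ᵐ x ∂m, ‖v x‖ ≤ C₁ := (ae_mem_orthant_besselMeasure μ).mono h₁
    have hb : ∀ᵐ x ∂m, ‖(c : ℂ) * ψ x - v x‖ₑ ≤ ENNReal.ofReal (c * C₀ + C₁) := by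
      filter_upwards [hψb, hvb] with x e1 e2
      rw [← ofReal_norm]
      refine ENNReal.ofReal_le_ofReal ((norm_sub_le _ _).trans (add_le_add ?_ e2))
      rw [norm_mul, Complex.norm_real, Real.norm_of_nonneg hc.le]
      gcongr
    -- `K` inverts `c - S` on test functions. The symmetry in `hsym` then moves `K` onto `r g`,
    -- which yields the weak equation for `f`.
    have hres := kernelOp_resolventKernel_ae_eq hμ hc hψ hv fun b hb =>
      hφ.integral_besselOp_mul_gaussian hμ hb
    have hsym := integral_kernelOp_mul hK hs hM ENNReal.ofReal_ne_top hU
      (((hψ.const_mul (c : ℂ)).sub hv).1) ENNReal.ofReal_ne_top hb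
    have i1 : Integrable (fun x => kernelOp m K U x * ψ x) m := hRU.mul_bdd hψ.1 hψb
    have i2 : Integrable (fun x => kernelOp m K U x * v x) m := hRU.mul_bdd hv.1 hvb
    have i3 : Integrable (fun x => U x * ψ x) m := hU.mul_bdd hψ.1 hψb
    have e1 : ∫ x, U x * kernelOp m K (fun y => (c : ℂ) * ψ y - v y) x ∂m =
        ∫ x, U x * ψ x ∂m :=
      integral_congr_ae (hres.mono fun x hx => by dsimp only; rw [hx])
    have e2 : ∫ x, kernelOp m K U x * ((c : ℂ) * ψ x - v x) ∂m =
        c * ∫ x, kernelOp m K U x * ψ x ∂m - ∫ x, kernelOp m K U x * v x ∂m := by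
      rw [← integral_const_mul, ← integral_sub (i1.const_mul _) i2]
      refine integral_congr_ae (.of_forall fun x => ?_)
      dsimp only
      ring
    have e3 : ∫ x, (weightR μ x • ((c : ℂ) • f - g).1 x) * ψ x ∂m =
        c * ∫ x, kernelOp m K U x * ψ x ∂m - ∫ x, U x * ψ x ∂m := by
      rw [← integral_const_mul, ← integral_sub (i1.const_mul _) i3]
      refine integral_congr_ae (hsub.mono fun x hx => ?_)
      dsimp only at hx ⊢
      rw [hx]
      ring
    have e4 : ∫ x, (weightR μ x • f.1 x) * v x ∂m = ∫ x, kernelOp m K U x * v x ∂m :=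
      integral_congr_ae (hfm.mono fun x hx => by dsimp only at hx ⊢; rw [hx])
    have e5 : c * ∫ x, kernelOp m K U x * ψ x ∂m - ∫ x, kernelOp m K U x * v x ∂m =
        ∫ x, U x * ψ x ∂m := e2.symm.trans (hsym.trans e1)
    rw [e3, e4, ← e5]
    ring
  -- The two halves of Schur's test, with mass `1 / c`.
  · have hL1 : normL1 μ f.1 ≤ c⁻¹ * normL1 μ g.1 := by
      rw [normL1_eq hμ, normL1_eq hμ, ← ENNReal.toReal_ofReal (inv_pos.2 hc).le,
        ← ENNReal.toReal_mul]
      refine ENNReal.toReal_mono (ENNReal.mul_ne_top ENNReal.ofReal_ne_top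
        (lintegral_enorm_weightR_smul_lt_top hμ g).ne) ?_
      refine (lintegral_congr_ae (hfm.mono fun x hx => congrArg enorm hx)).trans_le ?_
      exact lintegral_enorm_kernelOp_le hK hs hM hU.1
    have hLi : normLinf μ f.1 ≤ c⁻¹ * normLinf μ g.1 := by
      have h0 : 0 ≤ normLinf μ g.1 := ENNReal.toReal_nonneg
      refine normLinf_le f (by positivity) ?_
      filter_upwards [hf] with x hx
      rw [ENNReal.ofReal_mul (by positivity)]
      exact (congrArg enorm hx).trans_le (hRb x)
    have h2 : normY μ f ≤ c⁻¹ * normY μ g := by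
      rw [normY_apply, normY_apply, mul_max_of_nonneg _ _ (inv_pos.2 hc).le]
      exact max_le_max hL1 hLi
    calc c * normY μ f ≤ c * (c⁻¹ * normY μ g) := by gcongr
      _ = normY μ g := by rw [mul_inv_cancel_left₀ hc.ne']

/-- The representation `u = K (c u - v)` with `v = c u` reads `u = K 0 = 0`. -/
theorem IsBesselOf.eq_zero_of_eq_smul (hμ : ∀ i, -1 / 2 < μ i) {c : ℝ} (hc : 0 < c)
    {f : SpaceY μ} (h : IsBesselOf μ f ((c : ℂ) • f)) : f = 0 := by
  have hac := besselMeasure_absolutelyContinuous μ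
  have h1 := kernelOp_resolventKernel_ae_eq hμ hc (integrable_weightR_smul hμ f)
    (integrable_weightR_smul hμ ((c : ℂ) • f)) fun b hb => h.integral_gaussian hμ hb
  have h2 : (fun y => (c : ℂ) * (weightR μ y • f.1 y) - weightR μ y • ((c : ℂ) • f).1 y)
      =ᵐ[besselMeasure μ] fun _ => 0 := by
    have e : ((c : ℂ) • f).1 = (c : ℂ) • f.1 := rfl
    rw [e]
    filter_upwards [hac.ae_le (AEEqFun.coeFn_smul (c : ℂ) f.1)] with x hx
    rw [hx]
    simp only [Pi.smul_apply, smul_eq_mul, Complex.real_smul]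
    ring
  rw [kernelOp_congr h2] at h1
  refine Subtype.ext (AEEqFun.ext ?_)
  have h0 : ((0 : (Fin n → ℝ) →ₘ[orthantMeasure n] ℂ) : (Fin n → ℝ) → ℂ)
      =ᵐ[orthantMeasure n] 0 := AEEqFun.coeFn_zero
  filter_upwards [(orthantMeasure_absolutelyContinuous hμ).ae_le h1, ae_mem_orthant n, h0]
    with x hx hxo hx0
  simp only [kernelOp, smul_zero, integral_zero] at hx
  have h3 := (smul_eq_zero.1 hx.symm).resolve_left (weightR_pos μ hxo).ne'
  exact h3.trans hx0.symm

end SpaceY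


/-! ### Completeness of `Y` and closedness of the Bessel operator -/

section Completeness

variable {n : ℕ} {μ : Fin n → ℝ}

/-- Multiplying by `w` lands in the complete space `L^p`; since `w > 0` on the orthant, the limit
can be divided by `w` again. -/
theorem exists_limit_weight {w : (Fin n → ℝ) → ℝ} (hw : Measurable w)
    (hpos : ∀ x ∈ orthant n, 0 < w x) (p : ℝ≥0∞) [hp : Fact (1 ≤ p)]
    {f : ℕ → (Fin n → ℝ) →ₘ[orthantMeasure n] ℂ}
    (hf : ∀ k, MemLp (fun x => w x • f k x) p (orthantMeasure n))
    (hc : ∀ ε > 0, ∃ N, ∀ k ≥ N, ∀ l ≥ N,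
      (eLpNorm (fun x => w x • (f k - f l) x) p (orthantMeasure n)).toReal < ε) :
    ∃ F : (Fin n → ℝ) → ℂ, AEStronglyMeasurable F (orthantMeasure n) ∧
      MemLp (fun x => w x • F x) p (orthantMeasure n) ∧
      Filter.Tendsto (fun k => eLpNorm (fun x => w x • f k x - w x • F x) p (orthantMeasure n))
        Filter.atTop (nhds 0) := by
  have hcs : CauchySeq fun k => (hf k).toLp _ := by
    refine Metric.cauchySeq_iff.2 fun ε hε => ?_
    obtain ⟨N, hN⟩ := hc ε hε
    refine ⟨N, fun k hk l hl => ?_⟩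
    rw [dist_eq_norm, ← MemLp.toLp_sub, Lp.norm_toLp]
    refine (congrArg ENNReal.toReal (eLpNorm_congr_ae ?_)).trans_lt (hN k hk l hl)
    filter_upwards [AEEqFun.coeFn_sub (f k) (f l)] with x hx
    simp only [Pi.sub_apply, hx, smul_sub]
  obtain ⟨L, hL⟩ := cauchySeq_tendsto_of_complete hcs
  have hLw : (fun x => w x • ((w x)⁻¹ • L x)) =ᵐ[orthantMeasure n] L := by
    filter_upwards [ae_mem_orthant n] with x hx
    rw [smul_inv_smul₀ (hpos x hx).ne']
  have hmem := (Lp.memLp L).ae_eq hLw.symm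
  refine ⟨fun x => (w x)⁻¹ • L x, hw.inv.aestronglyMeasurable.smul (Lp.aestronglyMeasurable L),
    hmem, ?_⟩
  have hL' : L = hmem.toLp _ := by
    refine Lp.ext (hLw.symm.trans (MemLp.coeFn_toLp hmem).symm)
  rw [hL'] at hL
  exact (Lp.tendsto_Lp_iff_tendsto_eLpNorm'' _ hf _ hmem).1 hL

theorem weightS_mul_weightR_pos (hμ : ∀ i, -1 / 2 < μ i) {x : Fin n → ℝ} (hx : x ∈ orthant n) :
    0 < weightS μ x * weightR μ x := mul_pos (weightS_pos hμ hx) (weightR_pos μ hx)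

/-- Serves to identify the limits taken in the two weighted spaces: pointwise limits do not see the
weight. -/
theorem exists_subseq_tendsto_ae {w : (Fin n → ℝ) → ℝ}
    (hpos : ∀ x ∈ orthant n, 0 < w x) {p : ℝ≥0∞} (hp : p ≠ 0)
    {f : ℕ → (Fin n → ℝ) →ₘ[orthantMeasure n] ℂ} {F : (Fin n → ℝ) → ℂ}
    (hf : ∀ k, MemLp (fun x => w x • f k x) p (orthantMeasure n))
    (hF : MemLp (fun x => w x • F x) p (orthantMeasure n))
    (h : Filter.Tendsto (fun k => eLpNorm (fun x => w x • f k x - w x • F x) p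
      (orthantMeasure n)) Filter.atTop (nhds 0)) :
    ∃ ns : ℕ → ℕ, StrictMono ns ∧ ∀ᵐ x ∂(orthantMeasure n),
      Filter.Tendsto (fun k => f (ns k) x) Filter.atTop (nhds (F x)) := by
  obtain ⟨ns, hns, hae⟩ := (tendstoInMeasure_of_tendsto_eLpNorm hp
    (fun k => (hf k).1) hF.1 h).exists_seq_tendsto_ae
  refine ⟨ns, hns, ?_⟩
  filter_upwards [hae, ae_mem_orthant n] with x hx hxo
  have h1 := hx.const_smul (w x)⁻¹
  simpa only [inv_smul_smul₀ (hpos x hxo).ne'] using h1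

theorem normLinf_nonneg (f : (Fin n → ℝ) → ℂ) : 0 ≤ normLinf μ f := ENNReal.toReal_nonneg

theorem normL1_le_normY (f : SpaceY μ) : normL1 μ f.1 ≤ normY μ f := le_max_left _ _

theorem normLinf_le_normY (f : SpaceY μ) : normLinf μ f.1 ≤ normY μ f := le_max_right _ _

/-- `Y` is complete. -/
theorem exists_limit_spaceY (hμ : ∀ i, -1 / 2 < μ i) {f : ℕ → SpaceY μ}
    (hc : ∀ ε > 0, ∃ N, ∀ k ≥ N, ∀ l ≥ N, normY μ (f k - f l) < ε) :
    ∃ g : SpaceY μ, Filter.Tendsto (fun k => normY μ (f k - g)) Filter.atTop (nhds 0) := by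
  have hc1 : ∀ ε > 0, ∃ N, ∀ k ≥ N, ∀ l ≥ N, normL1 μ
      ((f k).1 - (f l).1 : (Fin n → ℝ) →ₘ[orthantMeasure n] ℂ) < ε := fun ε hε =>
    (hc ε hε).imp fun N hN k hk l hl => (normL1_le_normY (f k - f l)).trans_lt (hN k hk l hl)
  have hci : ∀ ε > 0, ∃ N, ∀ k ≥ N, ∀ l ≥ N, normLinf μ
      ((f k).1 - (f l).1 : (Fin n → ℝ) →ₘ[orthantMeasure n] ℂ) < ε := fun ε hε =>
    (hc ε hε).imp fun N hN k hk l hl => (normLinf_le_normY (f k - f l)).trans_lt (hN k hk l hl)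
  have hm1 : ∀ k, MemLp (fun x => (weightS μ x * weightR μ x) • (f k).1 x) 1 (orthantMeasure n) :=
    fun k => (f k).2.1
  have hmi : ∀ k, MemLp (fun x => weightR μ x • (f k).1 x) ⊤ (orthantMeasure n) :=
    fun k => (f k).2.2
  have hp1 := fun x (hx : x ∈ orthant n) => weightS_mul_weightR_pos hμ hx
  have hpi := fun x (hx : x ∈ orthant n) => weightR_pos μ hx
  obtain ⟨F, -, hFm, hF⟩ := exists_limit_weight
    (w := fun x => weightS μ x * weightR μ x) (by fun_prop) hp1 1 hm1 hc1
  obtain ⟨G, hG0, hGm, hG⟩ := exists_limit_weight (by fun_prop) hpi ⊤ hmi hci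
  -- The second subsequence is taken inside the first, so that along it both limits are attained
  -- pointwise.
  have hFG : F =ᵐ[orthantMeasure n] G := by
    obtain ⟨ns, hns, h1⟩ := exists_subseq_tendsto_ae hp1 one_ne_zero hm1 hFm hF
    obtain ⟨ms, hms, h2⟩ := exists_subseq_tendsto_ae hpi ENNReal.top_ne_zero
      (fun k => hmi (ns k)) hGm (hG.comp hns.tendsto_atTop)
    filter_upwards [h1, h2] with x e1 e2
    exact tendsto_nhds_unique (e1.comp hms.tendsto_atTop) e2
  have hmk := AEEqFun.coeFn_mk G hG0
  have e1 : (fun x => (weightS μ x * weightR μ x) • F x) =ᵐ[orthantMeasure n]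
      fun x => (weightS μ x * weightR μ x) • AEEqFun.mk G hG0 x := by
    filter_upwards [hmk, hFG] with x h1 h2
    rw [h1, h2]
  have e2 : (fun x => weightR μ x • G x) =ᵐ[orthantMeasure n]
      fun x => weightR μ x • AEEqFun.mk G hG0 x := by
    filter_upwards [hmk] with x h1
    rw [h1]
  refine ⟨⟨AEEqFun.mk G hG0, hFm.ae_eq e1, hGm.ae_eq e2⟩, ?_⟩
  have t1 := (ENNReal.tendsto_toReal ENNReal.zero_ne_top).comp hF
  have t2 := (ENNReal.tendsto_toReal ENNReal.zero_ne_top).comp hG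
  have t3 := t1.max t2
  rw [ENNReal.toReal_zero, max_self] at t3
  refine t3.congr fun k => ?_
  rw [normY_apply]
  have hsub := AEEqFun.coeFn_sub (f k).1 (AEEqFun.mk G hG0)
  refine congrArg₂ max (congrArg ENNReal.toReal (eLpNorm_congr_ae ?_))
    (congrArg ENNReal.toReal (eLpNorm_congr_ae ?_))
  · filter_upwards [hsub, e1] with x h1 h2
    refine Eq.trans ?_ (congrArg (fun z => (weightS μ x * weightR μ x) • z) h1.symm)
    rw [h2, Pi.sub_apply, smul_sub]
  · filter_upwards [hsub, e2] with x h1 h2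
    refine Eq.trans ?_ (congrArg (fun z => weightR μ x • z) h1.symm)
    rw [h2, Pi.sub_apply, smul_sub]

/-- Pairing with a function bounded after multiplication by `r` is continuous on `Y`, already for
the `L¹` part of the norm. This is what makes the weak equation stable under limits. -/
theorem norm_integral_pairing_le (hμ : ∀ i, -1 / 2 < μ i) (f : SpaceY μ)
    {ψ : (Fin n → ℝ) → ℂ} {C : ℝ} (hC : ∀ x ∈ orthant n, ‖weightR μ x • ψ x‖ ≤ C) :
    ‖∫ x, f.1 x * ψ x ∂(orthantMeasure n)‖ ≤ normConst μ * |C| * normY μ f := by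
  have hN := normConst_pos hμ
  rw [integral_orthantMeasure_mul hμ, norm_mul, Complex.norm_real, Real.norm_of_nonneg hN.le,
    mul_assoc]
  gcongr
  have h1 : (∫ x, ‖weightR μ x • f.1 x‖ ∂(besselMeasure μ)) ≤ normY μ f := by
    rw [integral_norm_eq_lintegral_enorm (aestronglyMeasurable_weightR_smul f)]
    exact (normL1_eq hμ _).symm.trans_le (normL1_le_normY f)
  refine le_trans ?_ (mul_le_mul_of_nonneg_left h1 (abs_nonneg C))
  rw [← integral_const_mul]
  refine norm_integral_le_of_norm_le ((integrable_weightR_smul hμ f).norm.const_mul |C|) ?_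
  filter_upwards [ae_mem_orthant_besselMeasure μ] with x hx
  rw [norm_mul, mul_comm]
  gcongr
  exact (hC x hx).trans (le_abs_self C)

theorem integral_sub_pairing (hμ : ∀ i, -1 / 2 < μ i) (f g : SpaceY μ) {ψ : (Fin n → ℝ) → ℂ}
    (hψ : ContinuousOn ψ (orthant n)) (hb : ∃ C : ℝ, ∀ x ∈ orthant n, ‖weightR μ x • ψ x‖ ≤ C) :
    ∫ x, (f - g).1 x * ψ x ∂(orthantMeasure n) =
      ∫ x, f.1 x * ψ x ∂(orthantMeasure n) - ∫ x, g.1 x * ψ x ∂(orthantMeasure n) := by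
  rw [← integral_sub (integrable_pairing hμ f hψ hb) (integrable_pairing hμ g hψ hb)]
  refine integral_congr_ae ?_
  filter_upwards [AEEqFun.coeFn_sub f.1 g.1] with x hx
  refine (congrArg (fun z => z * ψ x) hx).trans ?_
  rw [Pi.sub_apply, sub_mul]

/-- The Bessel operator in `Y` is closed. -/
theorem isBesselOf_of_tendsto (hμ : ∀ i, -1 / 2 < μ i) {f g : ℕ → SpaceY μ} {F G : SpaceY μ}
    (h : ∀ k, IsBesselOf μ (f k) (g k))
    (hf : Filter.Tendsto (fun k => normY μ (f k - F)) Filter.atTop (nhds 0))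
    (hg : Filter.Tendsto (fun k => normY μ (g k - G)) Filter.atTop (nhds 0)) :
    IsBesselOf μ F G := by
  intro φ hφ
  have c1 := hφ.smooth.continuousOn
  have c2 := (contDiffOn_besselOp μ hφ.smooth).continuousOn
  obtain ⟨C₁, h₁⟩ := hφ.weightR_bounded
  obtain ⟨C₂, h₂⟩ := hφ.weightR_besselOp_bounded
  have hlim : Filter.Tendsto (fun k => normConst μ * |C₂| * normY μ (f k - F) +
      normConst μ * |C₁| * normY μ (g k - G)) Filter.atTop (nhds 0) := by
    simpa using (hf.const_mul _).add (hg.const_mul _)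
  -- The defect of the limit equation does not depend on `k` and is bounded by a sequence tending to
  -- `0`.
  rw [← sub_eq_zero, ← norm_le_zero_iff]
  refine ge_of_tendsto' hlim fun k => ?_
  have e1 := integral_sub_pairing hμ (g k) G c1 ⟨C₁, h₁⟩
  have e2 := integral_sub_pairing hμ (f k) F c2 ⟨C₂, h₂⟩
  have e3 := h k φ hφ
  have e4 : ∫ x, G.1 x * φ x ∂(orthantMeasure n) -
      ∫ x, F.1 x * besselOp μ φ x ∂(orthantMeasure n) =
      ∫ x, (f k - F).1 x * besselOp μ φ x ∂(orthantMeasure n) -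
        ∫ x, (g k - G).1 x * φ x ∂(orthantMeasure n) := by
    rw [e1, e2, e3]
    ring
  rw [e4]
  exact (norm_sub_le _ _).trans
    (add_le_add (norm_integral_pairing_le hμ _ h₂) (norm_integral_pairing_le hμ _ h₁))

theorem eq_zero_of_normY_eq_zero {f : SpaceY μ} (h : normY μ f = 0) : f = 0 := by
  have h1 : normLinf μ f.1 = 0 :=
    le_antisymm ((normLinf_le_normY f).trans_eq h) (normLinf_nonneg _)
  have h2 : eLpNorm (fun x => weightR μ x • f.1 x) ⊤ (orthantMeasure n) = 0 :=
    ((ENNReal.toReal_eq_zero_iff _).1 h1).resolve_right f.2.2.2.ne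
  rw [eLpNorm_eq_zero_iff f.2.2.1 ENNReal.top_ne_zero] at h2
  refine Subtype.ext (AEEqFun.ext ?_)
  have h0 : ((0 : (Fin n → ℝ) →ₘ[orthantMeasure n] ℂ) : (Fin n → ℝ) → ℂ)
      =ᵐ[orthantMeasure n] 0 := AEEqFun.coeFn_zero
  filter_upwards [h2, ae_mem_orthant n, h0] with x hx hxo hx0
  exact ((smul_eq_zero.1 hx).resolve_left (weightR_pos μ hxo).ne').trans hx0.symm

end Completeness

/-! ### The space `B` -/

section SpaceB

variable {n : ℕ} {μ : Fin n → ℝ} (hμ : ∀ i, -1 / 2 < μ i)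

theorem besselY_eq_of_isBesselOf {f g : SpaceY μ} (h : IsBesselOf μ f g) :
    ∃ hf : f ∈ (besselY hμ).domain, besselY hμ ⟨f, hf⟩ = g := by
  have h1 : (f, g) ∈ (besselY hμ).graph := by
    rw [besselY_graph]
    exact h
  obtain ⟨y, hy1, hy2⟩ := (LinearPMap.mem_graph_iff _).1 h1
  dsimp only at hy1 hy2
  subst hy1
  exact ⟨y.2, hy2⟩

theorem mem_powDomain_succ {f g : SpaceY μ} (h : IsBesselOf μ f g) {k : ℕ}
    (hg : g ∈ powDomain (besselY hμ) k) : f ∈ powDomain (besselY hμ) (k + 1) := by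
  obtain ⟨hf, hfg⟩ := besselY_eq_of_isBesselOf hμ h
  refine ⟨⟨f, hf⟩, ?_, rfl⟩
  change besselY hμ ⟨f, hf⟩ ∈ powDomain (besselY hμ) k
  rwa [hfg]

theorem isBesselOf_besselB (f : BesselSpace hμ) : IsBesselOf μ f.1 (besselB hμ f).1 :=
  besselY_spec hμ ⟨f.1, mem_domain_of_mem_besselSubmodule f.2⟩

theorem besselB_eq {f g : BesselSpace hμ} (h : IsBesselOf μ f.1 g.1) : besselB hμ f = g := by
  obtain ⟨hf, hfg⟩ := besselY_eq_of_isBesselOf hμ h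
  exact Subtype.ext hfg

theorem withSeminorms_rho : WithSeminorms (rho hμ) := ⟨rfl⟩

theorem rho_apply_le_iff {m : ℕ} {f : BesselSpace hμ} {C : ℝ} (hC : 0 ≤ C) :
    rho hμ m f ≤ C ↔ ∀ k ≤ m, normY μ ((besselB hμ ^ k) f).1 ≤ C := by
  refine ⟨fun h k hk => ?_, fun h => ?_⟩
  · exact (Seminorm.le_finset_sup_apply (Finset.mem_range.2 (Nat.lt_succ_of_le hk))
      (p := fun k => (normY μ).comp ((besselSubmodule hμ).subtype ∘ₗ (besselB hμ) ^ k))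
      (x := f)).trans h
  · exact Seminorm.finset_sup_apply_le hC fun k hk => h k (Nat.lt_succ_iff.1 (Finset.mem_range.1 hk))

theorem normY_pow_le_rho {m k : ℕ} (hk : k ≤ m) (f : BesselSpace hμ) :
    normY μ ((besselB hμ ^ k) f).1 ≤ rho hμ m f :=
  (rho_apply_le_iff hμ (apply_nonneg _ _)).1 le_rfl k hk

theorem rho_besselB_le (m : ℕ) (f : BesselSpace hμ) :
    rho hμ m (besselB hμ f) ≤ rho hμ (m + 1) f := by
  refine (rho_apply_le_iff hμ (apply_nonneg _ _)).2 fun k hk => ?_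
  rw [← Module.End.mul_apply, ← pow_succ]
  exact normY_pow_le_rho hμ (Nat.succ_le_succ hk) f

theorem continuous_of_rho_le {T : BesselSpace hμ →ₗ[ℂ] BesselSpace hμ}
    (h : ∀ m, ∃ m', ∃ C : ℝ, 0 ≤ C ∧ ∀ f, rho hμ m (T f) ≤ C * rho hμ m' f) : Continuous T := by
  refine WithSeminorms.continuous_of_isBounded (withSeminorms_rho hμ) (withSeminorms_rho hμ) T
    fun m => ?_
  obtain ⟨m', C, hC, hle⟩ := h m
  refine ⟨{m'}, ⟨C, hC⟩, fun f => ?_⟩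
  rw [Finset.sup_singleton]
  exact hle f

theorem continuous_neg_besselB : Continuous (-(besselB hμ)) := by
  refine continuous_of_rho_le hμ fun m => ⟨m + 1, 1, zero_le_one, fun f => ?_⟩
  rw [LinearMap.neg_apply, map_neg_eq_map, one_mul]
  exact rho_besselB_le hμ m f

/-- `ρ_0` is the norm of `Y`, which separates points by itself. -/
theorem t1Space_besselSpace : T1Space (BesselSpace hμ) := by
  refine (withSeminorms_rho hμ).T1_of_separating fun f hf => ⟨0, fun h0 => hf ?_⟩
  have h1 := normY_pow_le_rho hμ (le_refl 0) f
  rw [h0, pow_zero] at h1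
  exact Subtype.ext (eq_zero_of_normY_eq_zero (le_antisymm h1 (apply_nonneg _ _)))

/-- Each sequence `S^j u_k` has a limit `g_j` in the complete space `Y`, and closedness of `S` gives
`S g_j = g_{j+1}`. Hence `g_0` lies in `B`, and convergence for every `ρ_m` follows. -/
theorem exists_limit_besselSpace {u : ℕ → BesselSpace hμ}
    (hu : ∀ m, ∀ ε > 0, ∃ N, ∀ k ≥ N, ∀ l ≥ N, rho hμ m (u k - u l) < ε) :
    ∃ g : BesselSpace hμ, Filter.Tendsto u Filter.atTop (nhds g) := by
  have h1 : ∀ j, ∃ g : SpaceY μ, Filter.Tendsto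
      (fun k => normY μ (((besselB hμ ^ j) (u k)).1 - g)) Filter.atTop (nhds 0) := by
    intro j
    refine exists_limit_spaceY hμ fun ε hε => (hu j ε hε).imp fun N hN k hk l hl => ?_
    have := (normY_pow_le_rho hμ (le_refl j) (u k - u l)).trans_lt (hN k hk l hl)
    rwa [map_sub] at this
  choose g hg using h1
  have h2 : ∀ j, IsBesselOf μ (g j) (g (j + 1)) := fun j =>
    isBesselOf_of_tendsto hμ (fun k => by
      have := isBesselOf_besselB hμ ((besselB hμ ^ j) (u k))
      rwa [← Module.End.mul_apply, ← pow_succ'] at this) (hg j) (hg (j + 1))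
  -- The index `j` stays universally quantified: membership of `g j` at level `k + 1` rests on `g (j
  -- + 1)` at level `k`.
  have h3 : ∀ k j, g j ∈ powDomain (besselY hμ) k := by
    intro k
    induction k with
    | zero => exact fun j => Submodule.mem_top
    | succ k ih => exact fun j => mem_powDomain_succ hμ (h2 j) (ih (j + 1))
  have h4 : ∀ j, g j ∈ besselSubmodule hμ := fun j => (Submodule.mem_iInf _).2 fun k => h3 k j
  have h5 : ∀ j, (besselB hμ ^ j) ⟨g 0, h4 0⟩ = ⟨g j, h4 j⟩ := by
    intro j
    induction j with
    | zero => rfl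
    | succ j ih =>
      rw [pow_succ', Module.End.mul_apply, ih]
      exact besselB_eq hμ (h2 j)
  refine ⟨⟨g 0, h4 0⟩, ((withSeminorms_rho hμ).tendsto_nhds _ _).2 fun m ε hε => ?_⟩
  have h6 : ∀ j ∈ Finset.range (m + 1), ∀ᶠ k in Filter.atTop,
      normY μ (((besselB hμ ^ j) (u k)).1 - g j) < ε := fun j _ => (hg j).eventually_lt_const hε
  filter_upwards [(Finset.eventually_all _).2 h6] with k hk
  refine Seminorm.finset_sup_apply_lt hε fun j hj => ?_
  have h7 := hk j hj
  have h8 : ((besselB hμ ^ j) (u k - ⟨g 0, h4 0⟩)).1 = ((besselB hμ ^ j) (u k)).1 - g j := by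
    rw [map_sub, h5]
    rfl
  rw [← h8] at h7
  exact h7

theorem isFrechetSpace_besselSpace : IsFrechetSpace (BesselSpace hμ) := by
  have hW := withSeminorms_rho hμ
  have hG := hW.topologicalAddGroup
  have hT := t1Space_besselSpace hμ
  have hF := hW.firstCountableTopology
  let _ : UniformSpace (BesselSpace hμ) := IsTopologicalAddGroup.rightUniformSpace _
  have hU : IsUniformAddGroup (BesselSpace hμ) := isUniformAddGroup_of_addCommGroup
  -- Countably many seminorms: this yields metrizability and reduces completeness to Cauchy
  -- sequences.
  have hC : (uniformity (BesselSpace hμ)).IsCountablyGenerated :=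
    IsUniformAddGroup.uniformity_countably_generated
  refine ⟨hG, hW.continuousSMul, hW.toLocallyConvexSpace, UniformSpace.metrizableSpace, ?_⟩
  refine UniformSpace.complete_of_cauchySeq_tendsto fun u hu => exists_limit_besselSpace hμ ?_
  intro m ε hε
  have hball : {f : BesselSpace hμ | rho hμ m f < ε} ∈ nhds (0 : BesselSpace hμ) := by
    refine (hW.continuous_seminorm m).continuousAt.eventually_lt_const ?_
    simpa using hε
  have hent : {p : BesselSpace hμ × BesselSpace hμ | rho hμ m (p.2 - p.1) < ε} ∈
      uniformity (BesselSpace hμ) := by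
    rw [uniformity_eq_comap_nhds_zero]
    exact ⟨_, hball, fun p hp => hp⟩
  obtain ⟨N, hN⟩ := cauchySeq_iff.1 hu _ hent
  exact ⟨N, fun k hk l hl => hN l hl k hk⟩

/-! ### Non-negativity -/

/-- The estimate is known for the solution built from the kernel. Its difference from `f` is an
eigenvector of `S` with eigenvalue `c > 0`, hence zero. -/
theorem mul_normY_le_of_besselB {c : ℝ} (hc : 0 < c) {f g : BesselSpace hμ}
    (h : (c : ℂ) • f - besselB hμ f = g) : c * normY μ f.1 ≤ normY μ g.1 := by
  obtain ⟨F, hF, hle⟩ := exists_resolvent hμ hc g.1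
  have h1 := (besselGraph hμ).sub_mem (x := (f.1, (besselB hμ f).1))
    (y := (F, (c : ℂ) • F - g.1)) (isBesselOf_besselB hμ f) hF
  have h2 : (besselB hμ f).1 = (c : ℂ) • f.1 - g.1 := by
    rw [← h]
    simp
  have h3 : IsBesselOf μ (f.1 - F) ((c : ℂ) • (f.1 - F)) := by
    have h4 : (besselB hμ f).1 - ((c : ℂ) • F - g.1) = (c : ℂ) • (f.1 - F) := by
      rw [h2, smul_sub]
      abel
    rw [← h4]
    exact h1
  rwa [sub_eq_zero.1 (h3.eq_zero_of_eq_smul hμ hc)]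

/-- `S^k` commutes with `c - S`, so the estimate in `Y` applies to `S^k f` and `S^k g`. Neither the
index `m` nor the constant deteriorates, which is the equicontinuity. -/
theorem mul_rho_le_of_besselB {c : ℝ} (hc : 0 < c) {f g : BesselSpace hμ}
    (h : (c : ℂ) • f - besselB hμ f = g) (m : ℕ) : c * rho hμ m f ≤ rho hμ m g := by
  rw [mul_comm, ← le_div_iff₀ hc]
  refine (rho_apply_le_iff hμ (div_nonneg (apply_nonneg _ _) hc.le)).2 fun k hk => ?_
  rw [le_div_iff₀ hc, mul_comm]
  refine (mul_normY_le_of_besselB hμ hc (g := (besselB hμ ^ k) g) ?_).trans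
    (normY_pow_le_rho hμ hk g)
  rw [← h, map_sub, map_smul, ← Module.End.mul_apply, ← Module.End.mul_apply, ← pow_succ,
    ← pow_succ']

theorem exists_resolvent_besselB {c : ℝ} (hc : 0 < c) (g : BesselSpace hμ) :
    ∃ f : BesselSpace hμ, (c : ℂ) • f - besselB hμ f = g := by
  obtain ⟨f, hf, -⟩ := exists_resolvent hμ hc g.1
  -- Bootstrap: `S f = c f - g` lies in every power domain that contains `f`, so `f` lies in the
  -- next one.
  have h1 : ∀ k, f ∈ powDomain (besselY hμ) k := by
    intro k
    induction k with
    | zero => exact Submodule.mem_top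
    | succ k ih =>
      exact mem_powDomain_succ hμ hf (Submodule.sub_mem _ (Submodule.smul_mem _ _ ih)
        ((Submodule.mem_iInf _).1 g.2 k))
  set F : BesselSpace hμ := ⟨f, (Submodule.mem_iInf _).2 h1⟩
  have h2 : besselB hμ F = (c : ℂ) • F - g := besselB_eq hμ hf
  exact ⟨F, by rw [h2, sub_sub_cancel]⟩

theorem bijective_sub_besselB {c : ℝ} (hc : 0 < c) :
    Function.Bijective ((c : ℂ) • (LinearMap.id : BesselSpace hμ →ₗ[ℂ] BesselSpace hμ) -
      besselB hμ) := by
  refine ⟨(injective_iff_map_eq_zero _).2 fun f hf => ?_, fun g => exists_resolvent_besselB hμ hc g⟩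
  have h1 := mul_normY_le_of_besselB hμ hc (f := f) (g := 0) hf
  have h2 : normY μ (0 : BesselSpace hμ).1 = 0 := map_zero _
  rw [h2] at h1
  have h3 : 0 ≤ normY μ f.1 := apply_nonneg _ _
  exact Subtype.ext (eq_zero_of_normY_eq_zero (by nlinarith))

theorem exists_inverse_sub_besselB {c : ℝ} (hc : 0 < c) :
    ∃ R : BesselSpace hμ →L[ℂ] BesselSpace hμ,
      (∀ g, (c : ℂ) • R g - besselB hμ (R g) = g) ∧
      (∀ f, R ((c : ℂ) • f - besselB hμ f) = f) ∧
      ∀ m g, rho hμ m ((c : ℂ) • R g) ≤ 1 * rho hμ m g := by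
  set e := LinearEquiv.ofBijective _ (bijective_sub_besselB hμ hc)
  have h1 : ∀ g, (c : ℂ) • e.symm g - besselB hμ (e.symm g) = g := e.apply_symm_apply
  have h2 : ∀ f, e.symm ((c : ℂ) • f - besselB hμ f) = f := e.symm_apply_apply
  have h3 : ∀ m g, c * rho hμ m (e.symm g) ≤ rho hμ m g := fun m g =>
    mul_rho_le_of_besselB hμ hc (h1 g) m
  refine ⟨⟨e.symm.toLinearMap, continuous_of_rho_le hμ fun m => ⟨m, c⁻¹, (inv_pos.2 hc).le,
    fun g => ?_⟩⟩, h1, h2, fun m g => ?_⟩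
  · rw [← div_eq_inv_mul, le_div_iff₀ hc, mul_comm]
    exact h3 m g
  · rw [map_smul_eq_mul, Complex.norm_real, Real.norm_of_nonneg hc.le, one_mul]
    exact h3 m g

theorem isNonnegative_neg_besselB :
    IsNonnegative (rho hμ) ((-(besselB hμ)).toPMap ⊤) := by
  have hG := (withSeminorms_rho hμ).topologicalAddGroup
  have hT := t1Space_besselSpace hμ
  refine ⟨?_, ?_⟩
  · have h1 : (((-(besselB hμ)).toPMap ⊤).graph : Set (BesselSpace hμ × BesselSpace hμ)) =
        {p | (-(besselB hμ)) p.1 = p.2} := by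
      ext p
      simp [LinearPMap.mem_graph_iff]
    rw [LinearPMap.IsClosed, h1]
    -- The graph of a continuous, everywhere defined operator on a Hausdorff space is closed.
    exact isClosed_eq ((continuous_neg_besselB hμ).comp continuous_fst) continuous_snd
  · choose R hR1 hR2 hR3 using fun c : {c : ℝ // 0 < c} => exists_inverse_sub_besselB hμ c.2
    refine ⟨fun c => if h : 0 < c then R ⟨c, h⟩ else 0, fun c hc => ?_, fun m =>
      ⟨m, 1, zero_le_one, fun c hc x => ?_⟩⟩
    · simp only [dif_pos hc]
      refine ⟨fun x => ⟨Submodule.mem_top, ?_⟩, fun u => ?_⟩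
      · exact (sub_eq_add_neg _ _).symm.trans (hR1 ⟨c, hc⟩ x)
      · exact (congrArg (R ⟨c, hc⟩) (sub_eq_add_neg _ _).symm).trans (hR2 ⟨c, hc⟩ u.1)
    · simp only [dif_pos hc]
      exact hR3 ⟨c, hc⟩ m x

end SpaceB

end Bessel

theorem theorem4p8 {n : ℕ} {μ : Fin n → ℝ} (hμ : ∀ i, -1 / 2 < μ i) :
    Bessel.IsFrechetSpace (Bessel.BesselSpace hμ) ∧
      Continuous (-(Bessel.besselB hμ)) ∧
      Bessel.IsNonnegative (Bessel.rho hμ) ((-(Bessel.besselB hμ)).toPMap ⊤) :=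
  ⟨Bessel.isFrechetSpace_besselSpace hμ, Bessel.continuous_neg_besselB hμ,
    Bessel.isNonnegative_neg_besselB hμ⟩
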